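/- Let $M$ be a smooth (Hausdorff, boundaryless) manifold of dimension $p+2n$ with a smooth foliation $\mathcal F$ of leaf dimension $p$, and let $\omega$ be a transversely symplectic form for $\mathcal F$, i.e. a smooth closed $2$-form on $M$ with $\{X\in T_xM : i(X)\omega=0\}=T_x\mathcal F$ for all $x\in M$. A smooth real form $\phi$ is basic if $i(X)\phi=0$ and $\theta(X)\phi=0$ (contraction and Lie derivative) for all vector fields $X$ tangent to $\mathcal F$; $\Omega_B^k(\mathcal F)$ is the space of basic $k$-forms. Fix a Riemannian metric on $M$ and let $Q=T\mathcal F^\perp$. For a local orthonormal frame $E_1,\dots,E_p$ of $T\mathcal F$ let $\chi_{\mathcal F}=\alpha_1\wedge\dots\wedge\alpha_p$, where $\alpha_i(E_j)=\delta_{ij}$ and $\alpha_i|_Q=0$; the mean curvature form is $\kappa=(-1)^{p+1}i(E_p)\cdots i(E_1)\,d\chi_{\mathcal F}$, which does not depend on the frame. Assume that $\mathcal F$ is isoparametric, i.e. $\kappa$ is basic. For a one-form $\alpha$ vanishing on $T\mathcal F$ let $\alpha^\sharp$ be the section of $Q$ with $i(\alpha^\sharp)\omega=\alpha$. Extend $\omega(\alpha,\beta)=\omega(\alpha^\sharp,\beta^\sharp)$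 bilinearly to $\Lambda^kQ^*$ by $\omega(\alpha_1\wedge\dots\wedge\alpha_k,\beta_1\wedge\dots\wedge\beta_k)=\det(\omega(\alpha_i,\beta_j))$, put $\nu=\omega^n/n!$, and let $\bar\star:\Lambda^kQ^*\to\Lambda^{2n-k}Q^*$ be defined by $\phi\wedge\bar\star\psi=\omega(\phi,\psi)\,\nu$. On basic $k$-forms put $$d_\kappa\phi=d\phi-\tfrac12\,\kappa\wedge\phi,\qquad \delta_\kappa\phi=(-1)^k\,\bar\star\,(d-\kappa\wedge)\,\bar\star\,\phi+\tfrac12\,i(\kappa^\sharp)\phi$$ (with $\delta_\kappa=0$ on functions), and $$\mathcal H_{SK}^k(\mathcal F)=\{\phi\in\Omega_B^k(\mathcal F) : d_\kappa\phi=\delta_\kappa\phi=0\}.$$ Then, with $L\phi=\omega\wedge\phi$, for every $0\le r\le n$ the map $L^r$ restricts to an isomorphism of real vector spaces $$L^r:\mathcal H_{SK}^{n-r}(\mathcal F)\longrightarrow\mathcal H_{SK}^{n+r}(\mathcal F).$$ -/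

import Mathlib

open scoped Manifold ContDiff Topology

noncomputable section

namespace TransSymp

/-! ### Alternating forms on one real vector space -/

section Pointwise

variable {V : Type*} [AddCommGroup V] [Module ℝ V] [TopologicalSpace V]

/-- Change of the name of the degree along an equality of natural numbers. -/
def castDeg {k l : ℕ} (h : k = l) (φ : V [⋀^Fin k]→L[ℝ] ℝ) : V [⋀^Fin l]→L[ℝ] ℝ :=
  { φ.toAlternatingMap.domDomCongr (finCongr h) with
    cont := φ.cont.comp (continuous_pi fun i => continuous_apply (finCongr h i)) }

/-- The exterior product, in the shuffle normalization: for one-forms,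
`(α ∧ β)(u, v) = α u * β v - α v * β u`. -/
def wedge {k l : ℕ} (φ : V [⋀^Fin k]→L[ℝ] ℝ) (ψ : V [⋀^Fin l]→L[ℝ] ℝ) :
    V [⋀^Fin (k + l)]→L[ℝ] ℝ :=
  { ((LinearMap.mul' ℝ ℝ).compAlternatingMap
      (AlternatingMap.domCoprod φ.toAlternatingMap ψ.toAlternatingMap)).domDomCongr
        finSumFinEquiv with
    cont := by
      change Continuous fun v : Fin (k + l) → V => LinearMap.mul' ℝ ℝ
        ((∑ σ : Equiv.Perm.ModSumCongr (Fin k) (Fin l),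
          AlternatingMap.domCoprod.summand φ.toAlternatingMap ψ.toAlternatingMap σ)
            fun i => v (finSumFinEquiv i))
      simp only [sum_apply, map_sum]
      refine continuous_finsetSum _ fun σ _ => ?_
      induction σ using Quotient.inductionOn' with
      | h σ =>
        have hσ : Continuous fun v : Fin (k + l) → V =>
            ((Equiv.Perm.sign σ : ℤ) : ℝ) *
              (φ (fun i => v (finSumFinEquiv (σ (Sum.inl i)))) *
                ψ (fun i => v (finSumFinEquiv (σ (Sum.inr i))))) := by
          refine continuous_const.mul (Continuous.mul ?_ ?_)
          · exact φ.cont.comp (continuous_pi fun i => continuous_apply _)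
          · exact ψ.cont.comp (continuous_pi fun i => continuous_apply _)
        refine hσ.congr fun v => ?_
        rw [AlternatingMap.domCoprod.summand_mk'', smul_apply, Units.smul_def, map_zsmul,
          zsmul_eq_mul]
        rfl }

/-- The interior product `i(X)φ = φ(X, ⋯)`. -/
def interior {k : ℕ} (X : V) (φ : V [⋀^Fin (k + 1)]→L[ℝ] ℝ) : V [⋀^Fin k]→L[ℝ] ℝ :=
  { φ.toAlternatingMap.curryLeft X with
    cont := φ.cont.comp (continuous_pi fun i => by
      refine Fin.cases ?_ (fun j => ?_) i
      · exact continuous_const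
      · exact continuous_apply j) }

/-- The product `α₁ ∧ ⋯ ∧ α_k` of one-forms, `(X₁, …, X_k) ↦ det (αᵢ Xⱼ)`. -/
def wedgeOneForms {k : ℕ} (α : Fin k → V →L[ℝ] ℝ) : V [⋀^Fin k]→L[ℝ] ℝ :=
  { (Matrix.detRowAlternating (R := ℝ) (n := Fin k)).compLinearMap
      (LinearMap.pi fun i => (α i).toLinearMap) with
    cont := by
      change Continuous fun v : Fin k → V => Matrix.det fun i j => α j (v i)
      exact Continuous.matrix_det
        (continuous_matrix fun i j => (α j).continuous.comp (continuous_apply i)) }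

/-- The kernel `{X | i(X)Ω = 0}` of a two-form. -/
def formKer (Ω : V [⋀^Fin 2]→L[ℝ] ℝ) : Set V := {X | ∀ Y, Ω ![X, Y] = 0}

/-- `φ` is an exterior form on the quotient by the kernel of `Ω` (that is, `φ ∈ Λᵏ Q^*`):
it vanishes as soon as one of its arguments lies in the kernel of `Ω`. -/
def IsTransverse (Ω : V [⋀^Fin 2]→L[ℝ] ℝ) {k : ℕ} (φ : V [⋀^Fin k]→L[ℝ] ℝ) : Prop :=
  ∀ X : Fin k → V, (∃ i, X i ∈ formKer Ω) → φ X = 0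

/-- `v₁, …, v_n, w₁, …, w_n` is a symplectic frame of the quotient of `V` by the kernel of `Ω`
(the representatives of the classes in `V` do not matter for forms in `Λ Q^*`). -/
structure IsSymplecticFrame (Ω : V [⋀^Fin 2]→L[ℝ] ℝ) {n : ℕ} (v w : Fin n → V) : Prop where
  vv : ∀ a b, Ω ![v a, v b] = 0
  ww : ∀ a b, Ω ![w a, w b] = 0
  vw : ∀ a b, Ω ![v a, w b] = if a = b then 1 else 0
  expand : ∀ X, X - ∑ a, (Ω ![X, w a] • v a - Ω ![X, v a] • w a) ∈ formKer Ω

/-- The pairing of two `k`-forms in a frame `v₁, …, v_n, w₁, …, w_n`. On one-forms it is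
`∑ₐ (α(vₐ) β(wₐ) - α(wₐ) β(vₐ)) = Ω(α^♯, β^♯)`. -/
def framePairing {n : ℕ} (v w : Fin n → V) {k : ℕ} (φ ψ : V [⋀^Fin k]→L[ℝ] ℝ) : ℝ :=
  (k.factorial : ℝ)⁻¹ * ∑ s : Fin k → Fin n ⊕ Fin n,
    φ (fun i => Sum.elim v w (s i)) * ψ (fun i => Sum.elim w (fun a => -v a) (s i))

/-- If `αᵢ = i(Xᵢ)Ω` and `βⱼ = i(Yⱼ)Ω`, then
`Ω(α₁ ∧ ⋯ ∧ α_k, β₁ ∧ ⋯ ∧ β_k) = det (Ω(Xᵢ, Yⱼ))`. -/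
theorem framePairing_wedgeOneForms (Ω : V [⋀^Fin 2]→L[ℝ] ℝ) {n : ℕ} {v w : Fin n → V}
    (h : IsSymplecticFrame Ω v w) {k : ℕ} (α β : Fin k → V →L[ℝ] ℝ) (X Y : Fin k → V)
    (hα : ∀ i Z, α i Z = Ω ![X i, Z]) (hβ : ∀ i Z, β i Z = Ω ![Y i, Z]) :
    framePairing v w (wedgeOneForms α) (wedgeOneForms β) =
      Matrix.det (Matrix.of fun i j => Ω ![X i, Y j]) := by
  have key : ∀ A B : Fin k → Fin n ⊕ Fin n → ℝ,
      ∑ s : Fin k → Fin n ⊕ Fin n, Matrix.det (Matrix.of fun i j => A j (s i)) *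
        Matrix.det (Matrix.of fun i j => B j (s i)) =
      (k.factorial : ℝ) * Matrix.det (Matrix.of fun i j => ∑ t, A i t * B j t) := by
    intro A B
    have e1 : Matrix.det (Matrix.of fun i j => ∑ t, A i t * B j t) =
        ∑ s : Fin k → Fin n ⊕ Fin n, (∏ i, A i (s i)) *
          Matrix.det (Matrix.of fun i j => B j (s i)) := by
      have := (Matrix.detRowAlternating (R := ℝ) (n := Fin k)).toMultilinearMap.map_sum
        (fun i (t : Fin n ⊕ Fin n) => A i t • fun j => B j t)
      have e0 : (Matrix.of fun i j => ∑ t, A i t * B j t) =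
          fun i => ∑ t : Fin n ⊕ Fin n, A i t • fun j => B j t := by
        ext i j
        simp [Finset.sum_apply]
      rw [e0]
      refine this.trans (Finset.sum_congr rfl fun s _ => ?_)
      exact (Matrix.detRowAlternating (R := ℝ) (n := Fin k)).toMultilinearMap.map_smul_univ
        (fun i => A i (s i)) (fun i j => B j (s i))
    have e2 : ∀ s : Fin k → Fin n ⊕ Fin n, Matrix.det (Matrix.of fun i j => A j (s i)) =
        ∑ σ : Equiv.Perm (Fin k), ((Equiv.Perm.sign σ : ℤ) : ℝ) * ∏ i, A i (s (σ i)) := by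
      intro s
      rw [Matrix.det_apply']
      rfl
    simp only [e2, Finset.sum_mul]
    rw [Finset.sum_comm]
    have e3 : ∀ σ : Equiv.Perm (Fin k), ∑ s : Fin k → Fin n ⊕ Fin n,
        ((Equiv.Perm.sign σ : ℤ) : ℝ) * (∏ i, A i (s (σ i))) *
          Matrix.det (Matrix.of fun i j => B j (s i)) =
        Matrix.det (Matrix.of fun i j => ∑ t, A i t * B j t) := by
      intro σ
      rw [e1, ← (Equiv.arrowCongr σ (Equiv.refl (Fin n ⊕ Fin n))).sum_comp]
      refine Finset.sum_congr rfl fun s _ => ?_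
      have e4 := Matrix.det_permute σ⁻¹ (Matrix.of fun i j => B j (s i))
      have e5 : (Matrix.of fun i j => B j ((Equiv.arrowCongr σ
          (Equiv.refl (Fin n ⊕ Fin n))) s i)) =
          (Matrix.of fun i j => B j (s i)).submatrix (σ⁻¹ : Equiv.Perm (Fin k)) id := by
        ext i j
        simp [Equiv.arrowCongr]
      rw [e5, e4]
      have e6 : ((Equiv.Perm.sign σ : ℤ) : ℝ) * ((Equiv.Perm.sign σ : ℤ) : ℝ) = 1 := by
        rw [← Int.cast_mul, Int.units_coe_mul_self]
        simp
      simp only [Equiv.arrowCongr_apply, Function.comp_apply, Equiv.symm_apply_apply,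
        Equiv.refl_apply, Equiv.Perm.sign_inv]
      linear_combination (∏ i, A i (s i)) * Matrix.det (Matrix.of fun i j => B j (s i)) * e6
    rw [Finset.sum_congr rfl fun σ _ => e3 σ]
    simp [Fintype.card_perm]
  have hk := key (fun i t => α i (Sum.elim v w t))
    (fun i t => β i (Sum.elim w (fun a => -v a) t))
  have hfac : (k.factorial : ℝ) ≠ 0 := Nat.cast_ne_zero.mpr (Nat.factorial_ne_zero k)
  have hlin : ∀ Z : V, ∃ f : V →ₗ[ℝ] ℝ, ∀ W, f W = Ω ![Z, W] := fun Z =>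
    ⟨((Ω.toAlternatingMap.curryLeft Z).toMultilinearMap.toLinearMap (fun _ => 0) 0), fun W => by
      change Ω _ = Ω _
      congr 1
      ext i
      fin_cases i <;> rfl⟩
  have hskew : ∀ Z W : V, Ω ![Z, W] = - Ω ![W, Z] := by
    intro Z W
    have := Ω.toAlternatingMap.map_swap ![W, Z] (i := 0) (j := 1) (by decide)
    have e : (![W, Z] ∘ (Equiv.swap (0 : Fin 2) 1)) = ![Z, W] := by
      ext i
      fin_cases i <;> simp
    rw [e] at this
    exact this
  have hent : ∀ i j, ∑ t, α i (Sum.elim v w t) * β j (Sum.elim w (fun a => -v a) t) =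
      Ω ![X i, Y j] := by
    intro i j
    obtain ⟨f, hf⟩ := hlin (X i)
    have h0 : Ω ![X i, Y j - ∑ a, (Ω ![Y j, w a] • v a - Ω ![Y j, v a] • w a)] = 0 := by
      rw [hskew, h.expand (Y j) (X i), neg_zero]
    rw [← hf, map_sub, sub_eq_zero, map_sum] at h0
    rw [← hf, h0, Fintype.sum_sum_type, ← Finset.sum_add_distrib]
    refine Finset.sum_congr rfl fun a _ => ?_
    simp only [Sum.elim_inl, Sum.elim_inr, map_neg, map_sub, map_smul, smul_eq_mul]
    simp only [hα, hβ, hf]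
    ring
  simp only [hent] at hk
  rw [framePairing, inv_mul_eq_iff_eq_mul₀ hfac, ← hk]
  rfl

open Classical in
/-- The pairing `Ω(φ, ψ)` of `k`-forms in `Λᵏ Q^*`, for `Q` of rank `2n`: the bilinear extension of
`Ω(α₁ ∧ ⋯ ∧ α_k, β₁ ∧ ⋯ ∧ β_k) = det (Ω(αᵢ^♯, βⱼ^♯))`, computed in a symplectic frame. -/
def pairing (Ω : V [⋀^Fin 2]→L[ℝ] ℝ) (n : ℕ) {k : ℕ} (φ ψ : V [⋀^Fin k]→L[ℝ] ℝ) : ℝ :=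
  if h : ∃ e : (Fin n → V) × (Fin n → V), IsSymplecticFrame Ω e.1 e.2 then
    framePairing h.choose.1 h.choose.2 φ ψ
  else 0

/-- `L φ = Ω ∧ φ`. -/
def lef (Ω : V [⋀^Fin 2]→L[ℝ] ℝ) {k : ℕ} (φ : V [⋀^Fin k]→L[ℝ] ℝ) : V [⋀^Fin (k + 2)]→L[ℝ] ℝ :=
  castDeg (Nat.add_comm 2 k) (wedge Ω φ)

/-- `L^r φ = Ω^r ∧ φ`. -/
def lefPow (Ω : V [⋀^Fin 2]→L[ℝ] ℝ) {k : ℕ} (φ : V [⋀^Fin k]→L[ℝ] ℝ) :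
    (r : ℕ) → V [⋀^Fin (k + 2 * r)]→L[ℝ] ℝ
  | 0 => φ
  | r + 1 => lef Ω (lefPow Ω φ r)

/-- The transversal volume form `ν = Ω^n / n!`. -/
def transVol (Ω : V [⋀^Fin 2]→L[ℝ] ℝ) (n : ℕ) : V [⋀^Fin (2 * n)]→L[ℝ] ℝ :=
  (n.factorial : ℝ)⁻¹ •
    castDeg (Nat.zero_add (2 * n))
      (lefPow Ω (ContinuousAlternatingMap.constOfIsEmpty ℝ V (Fin 0) (1 : ℝ)) n)

open Classical in
/-- The transversal symplectic star of a `k`-form `ψ`: the form `⋆ψ ∈ Λ^l Q^*`, `k + l = 2n`, with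
`φ ∧ ⋆ψ = Ω(φ, ψ) ν` for all `φ ∈ Λ^k Q^*`. -/
def star (Ω : V [⋀^Fin 2]→L[ℝ] ℝ) (n : ℕ) {k l : ℕ} (hkl : k + l = 2 * n)
    (ψ : V [⋀^Fin k]→L[ℝ] ℝ) : V [⋀^Fin l]→L[ℝ] ℝ :=
  if h : ∃ η : V [⋀^Fin l]→L[ℝ] ℝ, IsTransverse Ω η ∧
      ∀ φ : V [⋀^Fin k]→L[ℝ] ℝ, IsTransverse Ω φ →
        castDeg hkl (wedge φ η) = pairing Ω n φ ψ • transVol Ω n then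
    h.choose
  else 0

end Pointwise

/-! ### Differential forms on a smooth manifold modelled on `E` -/

section Manifold

variable {E : Type*} [NormedAddCommGroup E] [NormedSpace ℝ E]
  {M : Type*} [TopologicalSpace M] [ChartedSpace E M]

variable (E M) in
/-- (Not necessarily smooth) real differential `k`-forms on `M`. -/
abbrev DForm (k : ℕ) : Type _ :=
  (x : M) → TangentSpace 𝓘(ℝ, E) x [⋀^Fin k]→L[ℝ] ℝ

variable (E M) in
/-- (Not necessarily smooth) vector fields on `M`. -/
abbrev VField : Type _ := (x : M) → TangentSpace 𝓘(ℝ, E) x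

/-- Smoothness of a vector field on a set. -/
def VField.SmoothOn [IsManifold 𝓘(ℝ, E) ∞ M] (X : VField E M) (U : Set M) : Prop :=
  ContMDiffOn 𝓘(ℝ, E) 𝓘(ℝ, E).tangent ∞
    (fun x => (⟨x, X x⟩ : TangentBundle 𝓘(ℝ, E) M)) U

/-- The expression of a form in the preferred chart at `x₀`. -/
def chartForm {k : ℕ} (φ : DForm E M k) (x₀ : M) (y : E) : E [⋀^Fin k]→L[ℝ] ℝ :=
  (φ ((extChartAt 𝓘(ℝ, E) x₀).symm y)).compContinuousLinearMap
    (mfderiv 𝓘(ℝ, E) 𝓘(ℝ, E) (extChartAt 𝓘(ℝ, E) x₀).symm y)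

/-- Smoothness of a differential form. -/
def IsSmooth {k : ℕ} (φ : DForm E M k) : Prop :=
  ∀ x₀ : M, ContDiffOn ℝ ∞ (chartForm φ x₀) (extChartAt 𝓘(ℝ, E) x₀).target

/-- The exterior derivative. -/
def extD {k : ℕ} (φ : DForm E M k) : DForm E M (k + 1) := fun x =>
  (extDeriv (chartForm φ x) (extChartAt 𝓘(ℝ, E) x x)).compContinuousLinearMap
    (mfderiv 𝓘(ℝ, E) 𝓘(ℝ, E) (extChartAt 𝓘(ℝ, E) x) x)

/-- The contraction `i(X)φ` of a form with a vector field. -/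
def contract {k : ℕ} (X : VField E M) (φ : DForm E M (k + 1)) : DForm E M k :=
  fun x => interior (X x) (φ x)

/-- The Lie derivative `θ(X) = d i(X) + i(X) d`. -/
def lieD (X : VField E M) : {k : ℕ} → DForm E M k → DForm E M k
  | 0, φ => contract X (extD φ)
  | _ + 1, φ => extD (contract X φ) + contract X (extD φ)

/-! ### Foliations -/

variable [IsManifold 𝓘(ℝ, E) ∞ M]

variable (E M) in
/-- A smooth foliation with leaves of dimension `p`, given by its tangent distribution: around each
point there is a smooth chart in which the leaves are the affine subspaces parallel to a fixed
`p`-dimensional subspace `W`. -/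
structure Foliation (p : ℕ) where
  /-- the tangent space of the leaf through a point -/
  tangent : (x : M) → Submodule ℝ (TangentSpace 𝓘(ℝ, E) x)
  exists_flat_chart : ∀ x : M, ∃ e ∈ IsManifold.maximalAtlas 𝓘(ℝ, E) ∞ M, x ∈ e.source ∧
    ∃ W : Submodule ℝ E, Module.finrank ℝ W = p ∧
      ∀ y ∈ e.source, ∀ X : TangentSpace 𝓘(ℝ, E) y,
        X ∈ tangent y ↔ (mfderiv 𝓘(ℝ, E) 𝓘(ℝ, E) e y X : E) ∈ W

variable {p : ℕ}

/-- The basic forms of a foliation: smooth forms with `i(X)φ = θ(X)φ = 0` for all smooth vector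
fields `X` tangent to the leaves. (On functions, `i(X)φ = 0` by convention.) -/
structure IsBasic (F : Foliation E M p) {k : ℕ} (φ : DForm E M k) : Prop where
  smooth : IsSmooth φ
  contract_eq_zero : ∀ X : VField E M, X.SmoothOn Set.univ → (∀ x, X x ∈ F.tangent x) →
    ∀ (x : M) (Y : Fin k → TangentSpace 𝓘(ℝ, E) x), (∃ i, Y i = X x) → φ x Y = 0
  lieD_eq_zero : ∀ X : VField E M, X.SmoothOn Set.univ → (∀ x, X x ∈ F.tangent x) →
    lieD X φ = 0

/-- `Ω` is a transversely symplectic form of the foliation `F`. -/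
structure IsTransverselySymplectic (F : Foliation E M p) (Ω : DForm E M 2) : Prop where
  smooth : IsSmooth Ω
  closed : extD Ω = 0
  ker_eq : ∀ x, formKer (Ω x) = (F.tangent x : Set (TangentSpace 𝓘(ℝ, E) x))

/-! ### Mean curvature -/

variable (E M) in
/-- Smooth Riemannian metrics on `M`. -/
abbrev Metric : Type _ :=
  Bundle.ContMDiffRiemannianMetric 𝓘(ℝ, E) ∞ E (fun x : M => TangentSpace 𝓘(ℝ, E) x)

/-- `e₁, …, e_p` is a smooth orthonormal frame of the tangent bundle of the `p`-dimensional
foliation `F` over the open set `U`. -/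
structure IsLeafFrame (F : Foliation E M p) (g : Metric E M) (U : Set M)
    (e : Fin p → VField E M) : Prop where
  isOpen : IsOpen U
  smooth : ∀ i, (e i).SmoothOn U
  tangent : ∀ i, ∀ x ∈ U, e i x ∈ F.tangent x
  orthonormal : ∀ i j, ∀ x ∈ U, g.inner x (e i x) (e j x) = if i = j then 1 else 0

/-- The characteristic form `χ = α₁ ∧ ⋯ ∧ α_p` of a leaf frame, where `αᵢ = g(eᵢ, ·)`, so that
`αᵢ(eⱼ) = δᵢⱼ` and `αᵢ` vanishes on the orthogonal complement of the leaves. -/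
def charForm (g : Metric E M) (e : Fin p → VField E M) : DForm E M p :=
  fun x => wedgeOneForms fun i => g.inner x (e i x)

/-- The one-form `(-1)^(p+1) i(e_p) ⋯ i(e₁) dχ` at the point `x`. -/
def frameMeanCurvature (g : Metric E M) (e : Fin p → VField E M) (x : M) :
    TangentSpace 𝓘(ℝ, E) x [⋀^Fin 1]→L[ℝ] ℝ :=
  (-1 : ℝ) ^ (p + 1) •
    ContinuousAlternatingMap.ofSubsingleton ℝ (TangentSpace 𝓘(ℝ, E) x) ℝ (0 : Fin 1)
      ((extD (charForm g e) x).toContinuousLinearMap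
        (Fin.snoc (α := fun _ => TangentSpace 𝓘(ℝ, E) x) (fun i => e i x) 0) (Fin.last p))

open Classical in
/-- The mean curvature form `κ` of `F` with respect to `g`. Local leaf frames exist around every
point, and two of them give the same form (a change of orientation changes two signs). -/
def meanCurvature (F : Foliation E M p) (g : Metric E M) : DForm E M 1 := fun x =>
  if h : ∃ e : Fin p → VField E M, ∃ U : Set M, x ∈ U ∧ IsLeafFrame F g U e then
    frameMeanCurvature g h.choose x
  else 0

/-- `F` is isoparametric for the metric `g`: its mean curvature form is basic. -/
def IsIsoparametric (F : Foliation E M p) (g : Metric E M) : Prop :=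
  IsBasic F (meanCurvature F g)

/-! ### The modified operators -/

open Classical in
/-- The vector field `α^♯` in the bundle `Q` orthogonal to the leaves with `i(α^♯)Ω = α`. -/
def sharp (F : Foliation E M p) (g : Metric E M) (Ω : DForm E M 2) (α : DForm E M 1) :
    VField E M := fun x =>
  if h : ∃ X : TangentSpace 𝓘(ℝ, E) x, (∀ Y ∈ F.tangent x, g.inner x X Y = 0) ∧
      ∀ Z, Ω x ![X, Z] = α x ![Z] then
    h.choose
  else 0

/-- The exterior product `α ∧ φ` of a one-form with a form. -/
def oneWedge (α : DForm E M 1) {k : ℕ} (φ : DForm E M k) : DForm E M (k + 1) :=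
  fun x => castDeg (Nat.add_comm 1 k) (wedge (α x) (φ x))

/-- The operator `⋆` applied to forms on `M`. -/
def starForm (Ω : DForm E M 2) (n : ℕ) {k l : ℕ} (hkl : k + l = 2 * n) (φ : DForm E M k) :
    DForm E M l :=
  fun x => star (Ω x) n hkl (φ x)

/-- `δ_B φ = (-1)^r ⋆ (d - κ ∧) ⋆ φ` on forms of degree `r = k + 1 ≤ 2n`. (There are no nonzero
basic forms in degrees above `2n`.) -/
def deltaB (Ω : DForm E M 2) (n : ℕ) (κ : DForm E M 1) {k : ℕ} (φ : DForm E M (k + 1)) :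
    DForm E M k :=
  if h : k + 1 ≤ 2 * n then
    (-1 : ℝ) ^ (k + 1) •
      starForm Ω n (k := 2 * n - (k + 1) + 1) (l := k) (by omega)
        (extD (starForm Ω n (l := 2 * n - (k + 1)) (by omega) φ) -
          oneWedge κ (starForm Ω n (l := 2 * n - (k + 1)) (by omega) φ))
  else 0

/-- `d_κ = d_B - ½ κ ∧`. -/
def dKappa (κ : DForm E M 1) {k : ℕ} (φ : DForm E M k) : DForm E M (k + 1) :=
  extD φ - (1 / 2 : ℝ) • oneWedge κ φ

/-- `δ_κ = δ_B + ½ i(κ^♯)`; it vanishes on functions. -/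
def deltaKappa (F : Foliation E M p) (g : Metric E M) (Ω : DForm E M 2) (n : ℕ)
    (κ : DForm E M 1) : {k : ℕ} → DForm E M k → DForm E M (k - 1)
  | 0, _ => 0
  | _ + 1, φ => deltaB Ω n κ φ + (1 / 2 : ℝ) • contract (sharp F g Ω κ) φ

/-- The modified symplectic harmonic space in degree `k`: the basic `k`-forms `φ` with
`d_κ φ = δ_κ φ = 0`. -/
def modHarmonic (F : Foliation E M p) (g : Metric E M) (Ω : DForm E M 2) (n k : ℕ) :
    Set (DForm E M k) :=
  {φ | IsBasic F φ ∧ dKappa (meanCurvature F g) φ = 0 ∧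
    deltaKappa F g Ω n (meanCurvature F g) φ = 0}

/-- `L^r φ = Ω^r ∧ φ` as a map from forms of degree `n - r` to forms of degree `n + r`. -/
def lefschetz (Ω : DForm E M 2) (n r : ℕ) (hr : r ≤ n) (φ : DForm E M (n - r)) :
    DForm E M (n + r) :=
  fun x => castDeg (by omega) (lefPow (Ω x) (φ x) r)

end Manifold

end TransSymp

end

/-! The statement is reduced to linear algebra at one point. Near a point of `M` the leaves are the
fibres of a submersion onto an open piece of a `2n`-dimensional space, and the basic forms are
exactly the smooth forms pulled back along it (`exists_isTransverseChart`, `isBasic_of_copull`). The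
form `Ω` descends to a closed nondegenerate form there, and since it is closed, a quadratic change
of transverse coordinates makes its first derivative vanish at the chosen point
(`exists_adapted_map`, `exists_adapted_chart`). This first-order Darboux normalization suffices,
because both modified operators involve only one derivative.

In such coordinates put `T X = ∂_X φ - ½ κ(X) φ`. At the point, the star operator commutes with
differentiation and `⋆ (a ∧ ⋆ φ) = ± i(a^♯) φ`, so with a basis `e_t` and its dual basis `e^t` `d_κ
φ = ∑ e^t ∧ T e_t` and `δ_κ φ = ∑ i((e^t)^♯) (T e_t)` (`altSymbol_twistedDeriv`,
`coSymbol_twistedDeriv`). The coefficient one half is what makes the same `T` occur in both: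
conjugating `κ ∧` by the star gives a full `-i(κ^♯)`, and adding `½ i(κ^♯)` leaves minus one half.

Since `Ω` is parallel at the point, `L^r φ` has symbol `L^r T`. Exterior multiplication by a
covector commutes with `L`, while `[i(X), L]` is exterior multiplication by `i(X)Ω`. Hence the first
operator commutes with `L^r`, and the second satisfies `δ L^r = L^r δ + r L^(r-1) d`. So `L^r`
preserves the two equations. Conversely, if `L^r φ` satisfies them, then `L^(r+1) δφ = 0`, so `δφ =
0`, and then `L^(r-1) dφ = 0`, so `dφ = 0`; in degrees `n - r - 1` and `n - r + 1` these powers of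
`L` are still injective (`symbols_Lf_pow_iff`).

The injectivity is the linear hard Lefschetz theorem `eq_zero_of_Lf_pow`, a double induction based
on the `sl₂` relation `Lam_Lf`. Equality of dimensions in complementary degrees gives bijectivity at
each point, hence bijectivity of `L^r` on basic forms (`exists_lefForm_eq`); together with
`lefForm_mem_iff` this is the theorem. -/

noncomputable section

namespace TransSymp

/-! ### Exterior and interior products on one vector space, and their pullbacks. -/

section Topological

variable {V V' : Type*} [AddCommGroup V] [Module ℝ V] [TopologicalSpace V]
  [AddCommGroup V'] [Module ℝ V'] [TopologicalSpace V']

@[simp] theorem castDeg_apply {k l : ℕ} (h : k = l) (φ : V [⋀^Fin k]→L[ℝ] ℝ) (v : Fin l → V) :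
    castDeg h φ v = φ fun i => v (finCongr h i) := rfl

@[simp] theorem castDeg_rfl {k : ℕ} (φ : V [⋀^Fin k]→L[ℝ] ℝ) : castDeg rfl φ = φ := rfl

theorem castDeg_family (φ : (k : ℕ) → V [⋀^Fin k]→L[ℝ] ℝ) {k l : ℕ} (h : k = l) :
    castDeg h (φ k) = φ l := by subst h; rfl

theorem castDeg_castDeg {k l m : ℕ} (h : k = l) (h' : l = m) (φ : V [⋀^Fin k]→L[ℝ] ℝ) :
    castDeg h' (castDeg h φ) = castDeg (h.trans h') φ := by subst h h'; rfl

@[simp] theorem interior_apply {k : ℕ} (X : V) (φ : V [⋀^Fin (k + 1)]→L[ℝ] ℝ) (v : Fin k → V) :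
    interior X φ v = φ (Fin.cons X v) := rfl

theorem wedgeOneForms_apply {k : ℕ} (α : Fin k → V →L[ℝ] ℝ) (v : Fin k → V) :
    wedgeOneForms α v = Matrix.det (Matrix.of fun i j => α j (v i)) := rfl

theorem castDeg_wedgeOneForms {k l : ℕ} (h : k = l) (α : Fin k → V →L[ℝ] ℝ) :
    castDeg h (wedgeOneForms α) = wedgeOneForms fun i => α (finCongr h.symm i) := by
  subst h; rfl

/-- The determinant is the alternatization of the plain product of the covectors. In this form,
products of decomposable forms follow from the compatibility of alternatization with `domCoprod`. -/
theorem toAlternatingMap_wedgeOneForms {k : ℕ} (α : Fin k → V →L[ℝ] ℝ) :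
    (wedgeOneForms α).toAlternatingMap = MultilinearMap.alternatization
      ((MultilinearMap.mkPiAlgebra ℝ (Fin k) ℝ).compLinearMap fun i => (α i).toLinearMap) := by
  ext v
  rw [MultilinearMap.alternatization_apply]
  change Matrix.det (Matrix.of fun i j => α j (v i)) = _
  rw [Matrix.det_apply]
  rfl

/-- The exterior product as a bilinear map. -/
def wedgeLin (k l : ℕ) : (V [⋀^Fin k]→L[ℝ] ℝ) →ₗ[ℝ] (V [⋀^Fin l]→L[ℝ] ℝ) →ₗ[ℝ]
    (V [⋀^Fin (k + l)]→L[ℝ] ℝ) :=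
  LinearMap.mk₂ ℝ wedge
    (fun a b c => by
      ext v
      change LinearMap.mul' ℝ ℝ (AlternatingMap.domCoprod (a.toAlternatingMap + b.toAlternatingMap)
        c.toAlternatingMap _) = LinearMap.mul' ℝ ℝ (AlternatingMap.domCoprod a.toAlternatingMap
        c.toAlternatingMap _) + LinearMap.mul' ℝ ℝ (AlternatingMap.domCoprod b.toAlternatingMap
        c.toAlternatingMap _)
      rw [← map_add, ← AlternatingMap.domCoprod'_apply, TensorProduct.add_tmul, map_add]
      rfl)
    (fun r a c => by
      ext v
      change LinearMap.mul' ℝ ℝ (AlternatingMap.domCoprod (r • a.toAlternatingMap)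
        c.toAlternatingMap _) = r • LinearMap.mul' ℝ ℝ (AlternatingMap.domCoprod a.toAlternatingMap
        c.toAlternatingMap _)
      rw [← map_smul, ← AlternatingMap.domCoprod'_apply, ← TensorProduct.smul_tmul', map_smul]
      rfl)
    (fun c a b => by
      ext v
      change LinearMap.mul' ℝ ℝ (AlternatingMap.domCoprod c.toAlternatingMap
        (a.toAlternatingMap + b.toAlternatingMap) _) =
        LinearMap.mul' ℝ ℝ (AlternatingMap.domCoprod c.toAlternatingMap a.toAlternatingMap _) +
        LinearMap.mul' ℝ ℝ (AlternatingMap.domCoprod c.toAlternatingMap b.toAlternatingMap _)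
      rw [← map_add, ← AlternatingMap.domCoprod'_apply, TensorProduct.tmul_add, map_add]
      rfl)
    (fun r c a => by
      ext v
      change LinearMap.mul' ℝ ℝ (AlternatingMap.domCoprod c.toAlternatingMap
        (r • a.toAlternatingMap) _) =
        r • LinearMap.mul' ℝ ℝ (AlternatingMap.domCoprod c.toAlternatingMap a.toAlternatingMap _)
      rw [← map_smul, ← AlternatingMap.domCoprod'_apply, TensorProduct.tmul_smul, map_smul]
      rfl)

@[simp] theorem wedgeLin_apply {k l : ℕ} (φ : V [⋀^Fin k]→L[ℝ] ℝ) (ψ : V [⋀^Fin l]→L[ℝ] ℝ) :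
    wedgeLin k l φ ψ = wedge φ ψ := rfl

/-- `castDeg` as a linear map. -/
def castDegLin {k l : ℕ} (h : k = l) : (V [⋀^Fin k]→L[ℝ] ℝ) →ₗ[ℝ] (V [⋀^Fin l]→L[ℝ] ℝ) where
  toFun := castDeg h
  map_add' _ _ := rfl
  map_smul' _ _ := rfl

@[simp] theorem castDegLin_apply {k l : ℕ} (h : k = l) (φ : V [⋀^Fin k]→L[ℝ] ℝ) :
    castDegLin h φ = castDeg h φ := rfl

/-- The interior product as a bilinear map. -/
def interiorLin (k : ℕ) : V →ₗ[ℝ] (V [⋀^Fin (k + 1)]→L[ℝ] ℝ) →ₗ[ℝ] (V [⋀^Fin k]→L[ℝ] ℝ) :=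
  LinearMap.mk₂ ℝ interior
    (fun X Y φ => by
      ext v
      exact DFunLike.congr_fun (φ.toAlternatingMap.curryLeft.map_add X Y) v)
    (fun r X φ => by
      ext v
      exact DFunLike.congr_fun (φ.toAlternatingMap.curryLeft.map_smul r X) v)
    (fun _ _ _ => rfl) (fun _ _ _ => rfl)

@[simp] theorem interiorLin_apply {k : ℕ} (X : V) (φ : V [⋀^Fin (k + 1)]→L[ℝ] ℝ) :
    interiorLin k X φ = interior X φ := rfl

/-- The exterior product of decomposable forms. -/
theorem wedge_wedgeOneForms {k l : ℕ} (α : Fin k → V →L[ℝ] ℝ) (β : Fin l → V →L[ℝ] ℝ) :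
    wedge (wedgeOneForms α) (wedgeOneForms β) = wedgeOneForms (Fin.append α β) := by
  ext v
  change LinearMap.mul' ℝ ℝ (AlternatingMap.domCoprod (wedgeOneForms α).toAlternatingMap
    (wedgeOneForms β).toAlternatingMap fun i => v (finSumFinEquiv i)) = _
  rw [toAlternatingMap_wedgeOneForms, toAlternatingMap_wedgeOneForms,
    ← MultilinearMap.domCoprod_alternization, MultilinearMap.alternatization_apply, map_sum,
    wedgeOneForms_apply, ← Matrix.det_submatrix_equiv_self finSumFinEquiv, Matrix.det_apply]
  refine Finset.sum_congr rfl fun σ _ => ?_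
  rw [Units.smul_def, Units.smul_def, map_zsmul]
  congr 1
  simp [MultilinearMap.domCoprod_apply, Fintype.prod_sum_type]

/-- Pullback of forms. -/
theorem compContinuousLinearMap_wedge {k l : ℕ} (φ : V [⋀^Fin k]→L[ℝ] ℝ)
    (ψ : V [⋀^Fin l]→L[ℝ] ℝ) (f : V' →L[ℝ] V) :
    (wedge φ ψ).compContinuousLinearMap f =
      wedge (φ.compContinuousLinearMap f) (ψ.compContinuousLinearMap f) := by
  ext v
  change LinearMap.mul' ℝ ℝ ((∑ σ : Equiv.Perm.ModSumCongr (Fin k) (Fin l),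
      AlternatingMap.domCoprod.summand φ.toAlternatingMap ψ.toAlternatingMap σ)
        fun i => f (v (finSumFinEquiv i))) =
    LinearMap.mul' ℝ ℝ ((∑ σ : Equiv.Perm.ModSumCongr (Fin k) (Fin l),
      AlternatingMap.domCoprod.summand (φ.compContinuousLinearMap f).toAlternatingMap
        (ψ.compContinuousLinearMap f).toAlternatingMap σ) fun i => v (finSumFinEquiv i))
  simp only [sum_apply, map_sum]
  refine Finset.sum_congr rfl fun σ _ => ?_
  induction σ using Quotient.inductionOn' with
  | h σ => rfl

theorem compContinuousLinearMap_castDeg {k l : ℕ} (h : k = l) (φ : V [⋀^Fin k]→L[ℝ] ℝ)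
    (f : V' →L[ℝ] V) :
    (castDeg h φ).compContinuousLinearMap f = castDeg h (φ.compContinuousLinearMap f) := rfl

theorem compContinuousLinearMap_lef {k : ℕ} (Ω : V [⋀^Fin 2]→L[ℝ] ℝ) (φ : V [⋀^Fin k]→L[ℝ] ℝ)
    (f : V' →L[ℝ] V) :
    (lef Ω φ).compContinuousLinearMap f =
      lef (Ω.compContinuousLinearMap f) (φ.compContinuousLinearMap f) := by
  rw [lef, compContinuousLinearMap_castDeg, compContinuousLinearMap_wedge]; rfl

theorem compContinuousLinearMap_lefPow {k : ℕ} (Ω : V [⋀^Fin 2]→L[ℝ] ℝ)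
    (φ : V [⋀^Fin k]→L[ℝ] ℝ) (f : V' →L[ℝ] V) (r : ℕ) :
    (lefPow Ω φ r).compContinuousLinearMap f =
      lefPow (Ω.compContinuousLinearMap f) (φ.compContinuousLinearMap f) r := by
  induction r with
  | zero => rfl
  | succ r ih => rw [lefPow, compContinuousLinearMap_lef, ih]; rfl

theorem compContinuousLinearMap_transVol (Ω : V [⋀^Fin 2]→L[ℝ] ℝ) (n : ℕ) (f : V' →L[ℝ] V) :
    (transVol Ω n).compContinuousLinearMap f = transVol (Ω.compContinuousLinearMap f) n := by
  change (n.factorial : ℝ)⁻¹ • (castDeg _ (lefPow Ω _ n)).compContinuousLinearMap f = _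
  rw [compContinuousLinearMap_castDeg, compContinuousLinearMap_lefPow]
  rfl

theorem compContinuousLinearMap_interior {k : ℕ} (φ : V [⋀^Fin (k + 1)]→L[ℝ] ℝ)
    (f : V' →L[ℝ] V) (X : V') :
    interior X (φ.compContinuousLinearMap f) = (interior (f X) φ).compContinuousLinearMap f := by
  ext v
  change φ _ = φ _
  congr 1
  ext i
  refine Fin.cases rfl (fun j => rfl) i

end Topological

/-! ### Exterior multiplication by a covector and decomposable forms. -/

section Normed

variable {N : Type*} [NormedAddCommGroup N] [NormedSpace ℝ N]

/-- The exterior product `a ∧ φ` with a covector `a`. -/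
def ext {k : ℕ} (a : N →L[ℝ] ℝ) (φ : N [⋀^Fin k]→L[ℝ] ℝ) : N [⋀^Fin (k + 1)]→L[ℝ] ℝ :=
  ContinuousAlternatingMap.alternatizeUncurryFin (a.smulRight φ)

theorem ext_apply {k : ℕ} (a : N →L[ℝ] ℝ) (φ : N [⋀^Fin k]→L[ℝ] ℝ) (v : Fin (k + 1) → N) :
    ext a φ v = ∑ i : Fin (k + 1), (-1) ^ (i : ℕ) * (a (v i) * φ (i.removeNth v)) := by
  simp [ext, ContinuousAlternatingMap.alternatizeUncurryFin_apply]

/-- The exterior product with a covector as a bilinear map. -/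
def extLin (k : ℕ) : (N →L[ℝ] ℝ) →ₗ[ℝ] (N [⋀^Fin k]→L[ℝ] ℝ) →ₗ[ℝ] (N [⋀^Fin (k + 1)]→L[ℝ] ℝ) :=
  LinearMap.mk₂ ℝ ext
    (fun a b φ => by
      ext v
      simp only [ext_apply, ContinuousAlternatingMap.add_apply, add_apply, ← Finset.sum_add_distrib]
      exact Finset.sum_congr rfl fun i _ => by ring)
    (fun r a φ => by
      ext v
      simp only [ext_apply, ContinuousAlternatingMap.smul_apply, smul_apply, smul_eq_mul,
        Finset.mul_sum]
      exact Finset.sum_congr rfl fun i _ => by ring)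
    (fun a φ ψ => by
      ext v
      simp only [ext_apply, ContinuousAlternatingMap.add_apply, ← Finset.sum_add_distrib]
      exact Finset.sum_congr rfl fun i _ => by ring)
    (fun r a φ => by
      ext v
      simp only [ext_apply, ContinuousAlternatingMap.smul_apply, smul_eq_mul, Finset.mul_sum]
      exact Finset.sum_congr rfl fun i _ => by ring)

@[simp] theorem extLin_apply {k : ℕ} (a : N →L[ℝ] ℝ) (φ : N [⋀^Fin k]→L[ℝ] ℝ) :
    extLin k a φ = ext a φ := rfl

/-- The term of the alternating sum in which `a` receives the slot of `X` gives `a X • φ`; in every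
other term `X` is the first argument of `φ`, and the shift of index produces the sign. -/
theorem interior_ext {k : ℕ} (X : N) (a : N →L[ℝ] ℝ) (φ : N [⋀^Fin (k + 1)]→L[ℝ] ℝ) :
    interior X (ext a φ) = a X • φ - ext a (interior X φ) := by
  ext v
  have h : ∀ i : Fin (k + 1), (Fin.succ i).removeNth (Fin.cons X v : Fin (k + 2) → N) =
      Fin.cons X (i.removeNth v) := by
    intro i
    ext j
    refine Fin.cases ?_ (fun j => ?_) j
    · simp [Fin.removeNth]
    · simp [Fin.removeNth]
  simp only [interior_apply, ext_apply, ContinuousAlternatingMap.sub_apply,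
    ContinuousAlternatingMap.smul_apply, smul_eq_mul]
  rw [Fin.sum_univ_succ]
  simp only [Fin.val_zero, pow_zero, Fin.cons_zero, one_mul, Fin.val_succ, Fin.cons_succ, h]
  rw [show (0 : Fin (k + 2)).removeNth (Fin.cons X v : Fin (k + 2) → N) = v from by
    ext j; simp [Fin.removeNth], sub_eq_add_neg, ← Finset.sum_neg_distrib]
  congr 1
  exact Finset.sum_congr rfl fun i _ => by ring

theorem interior_ext_zero (X : N) (a : N →L[ℝ] ℝ) (φ : N [⋀^Fin 0]→L[ℝ] ℝ) :
    interior X (ext a φ) = a X • φ := by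
  ext v
  simp only [interior_apply, ext_apply, ContinuousAlternatingMap.smul_apply, smul_eq_mul]
  rw [Fin.sum_univ_succ]
  simp only [Fin.val_zero, pow_zero, Fin.cons_zero, one_mul, Finset.univ_eq_empty,
    Finset.sum_empty, add_zero]
  congr 2

/-- This is the Laplace expansion of the determinant along its first column. -/
theorem ext_wedgeOneForms {k : ℕ} (a : N →L[ℝ] ℝ) (β : Fin k → N →L[ℝ] ℝ) :
    ext a (wedgeOneForms β) = wedgeOneForms (Fin.cons a β : Fin (k + 1) → N →L[ℝ] ℝ) := by
  ext v
  rw [ext_apply, wedgeOneForms_apply, Matrix.det_succ_column_zero]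
  refine Finset.sum_congr rfl fun i _ => ?_
  rw [← mul_assoc]
  rfl

variable [FiniteDimensional ℝ N]

instance (k : ℕ) : FiniteDimensional ℝ (N [⋀^Fin k]→L[ℝ] ℝ) := by
  let b := Module.finBasis ℝ N
  let f : (N [⋀^Fin k]→L[ℝ] ℝ) →ₗ[ℝ] ((Fin k → Fin (Module.finrank ℝ N)) → ℝ) :=
    { toFun := fun φ s => φ fun i => b (s i)
      map_add' := fun _ _ => rfl
      map_smul' := fun _ _ => rfl }
  refine FiniteDimensional.of_injective f fun φ ψ h => ?_
  have : φ.toAlternatingMap = ψ.toAlternatingMap :=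
    b.ext_alternating fun s _ => congrFun h s
  ext v
  exact congrArg (fun χ : N [⋀^Fin k]→ₗ[ℝ] ℝ => χ v) this

/-- The coordinate covectors of a basis. -/
def coordL {ι : Type*} (b : Module.Basis ι ℝ N) (t : ι) : N →L[ℝ] ℝ :=
  LinearMap.toContinuousLinearMap (b.coord t)

theorem coordL_apply {ι : Type*} (b : Module.Basis ι ℝ N) (t : ι) (X : N) :
    coordL b t X = b.repr X t := rfl

theorem sum_coordL {ι : Type*} [Fintype ι] (b : Module.Basis ι ℝ N) (X : N) :
    ∑ t, coordL b t X • b t = X := b.sum_repr X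

/-- Every form is a combination of products of one-forms. -/
theorem eq_sum_wedgeOneForms {ι : Type*} [Fintype ι] (b : Module.Basis ι ℝ N) {k : ℕ}
    (φ : N [⋀^Fin k]→L[ℝ] ℝ) :
    φ = (k.factorial : ℝ)⁻¹ • ∑ s : Fin k → ι,
      φ (fun i => b (s i)) • wedgeOneForms fun i => coordL b (s i) := by
  classical
  have hfac : (k.factorial : ℝ) ≠ 0 := Nat.cast_ne_zero.mpr (Nat.factorial_ne_zero k)
  ext v
  rw [ContinuousAlternatingMap.smul_apply, smul_eq_mul, eq_inv_mul_iff_mul_eq₀ hfac,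
    ContinuousAlternatingMap.sum_apply]
  simp only [ContinuousAlternatingMap.smul_apply, smul_eq_mul, wedgeOneForms_apply,
    Matrix.det_apply', Finset.mul_sum, Matrix.of_apply]
  rw [Finset.sum_comm]
  have hσ : ∀ σ : Equiv.Perm (Fin k), ∑ s : Fin k → ι, φ (fun i => b (s i)) *
      (((Equiv.Perm.sign σ : ℤ) : ℝ) * ∏ i, coordL b (s i) (v (σ i))) = φ v := by
    intro σ
    have h1 : φ (v ∘ σ) = ((Equiv.Perm.sign σ : ℤ) : ℝ) * φ v := by
      have := φ.toAlternatingMap.map_perm v σ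
      rw [Units.smul_def, zsmul_eq_mul] at this
      exact this
    have h2 : φ (v ∘ σ) = ∑ s : Fin k → ι, (∏ i, coordL b (s i) (v (σ i))) *
        φ (fun i => b (s i)) := by
      have e : (v ∘ σ) = fun i => ∑ t, coordL b t (v (σ i)) • b t :=
        funext fun i => (sum_coordL b _).symm
      rw [e]
      refine (φ.toMultilinearMap.map_sum (fun i t => coordL b t (v (σ i)) • b t)).trans ?_
      exact Finset.sum_congr rfl fun s _ =>
        φ.toMultilinearMap.map_smul_univ (fun i => coordL b (s i) (v (σ i))) fun i => b (s i)
    have h3 : ((Equiv.Perm.sign σ : ℤ) : ℝ) * ((Equiv.Perm.sign σ : ℤ) : ℝ) = 1 := by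
      rw [← Int.cast_mul, Int.units_coe_mul_self]
      simp
    calc _ = ((Equiv.Perm.sign σ : ℤ) : ℝ) * φ (v ∘ σ) := by
          rw [h2, Finset.mul_sum]
          exact Finset.sum_congr rfl fun s _ => by ring
      _ = φ v := by rw [h1, ← mul_assoc, h3, one_mul]
  rw [Finset.sum_congr rfl fun σ _ => hσ σ]
  simp [Fintype.card_perm]

/-- Linear maps which agree on products of one-forms are equal. -/
theorem linearMap_ext_wedgeOneForms {G : Type*} [AddCommGroup G] [Module ℝ G] {k : ℕ}
    {f g : (N [⋀^Fin k]→L[ℝ] ℝ) →ₗ[ℝ] G} (h : ∀ α, f (wedgeOneForms α) = g (wedgeOneForms α)) :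
    f = g := by
  refine LinearMap.ext fun φ => ?_
  rw [eq_sum_wedgeOneForms (Module.finBasis ℝ N) φ]
  simp only [map_smul, map_sum, h]

/-- A covector as a one-form. -/
def toOne (a : N →L[ℝ] ℝ) : N [⋀^Fin 1]→L[ℝ] ℝ := wedgeOneForms fun _ => a

/-- Both sides are linear in `φ`, so decomposable `φ` suffice. This replaces the sum over shuffles
by the explicit alternating sum of `ext`. -/
theorem wedge_toOne {k : ℕ} (a : N →L[ℝ] ℝ) (φ : N [⋀^Fin k]→L[ℝ] ℝ) :
    castDeg (Nat.add_comm 1 k) (wedge (toOne a) φ) = ext a φ := by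
  have : castDegLin (Nat.add_comm 1 k) ∘ₗ wedgeLin 1 k (toOne a) = extLin k a := by
    refine linearMap_ext_wedgeOneForms fun β => ?_
    simp only [LinearMap.comp_apply, wedgeLin_apply, castDegLin_apply, extLin_apply, toOne]
    rw [wedge_wedgeOneForms, castDeg_wedgeOneForms, ext_wedgeOneForms]
    congr 1
    ext i : 1
    refine Fin.cases ?_ (fun j => ?_) i
    · rw [Fin.cons_zero]
      exact Fin.append_left (fun _ : Fin 1 => a) β 0
    · rw [Fin.cons_succ]
      have : finCongr (Nat.add_comm 1 k).symm j.succ = Fin.natAdd 1 j := by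
        ext; simp [Nat.add_comm]
      rw [this, Fin.append_right]
  exact LinearMap.congr_fun this φ

theorem wedge_cons {k l : ℕ} (α : Fin (k + 1) → N →L[ℝ] ℝ) (φ : N [⋀^Fin l]→L[ℝ] ℝ) :
    castDeg (Nat.add_right_comm k 1 l) (wedge (wedgeOneForms α) φ) =
      ext (α 0) (wedge (wedgeOneForms (Fin.tail α)) φ) := by
  have : castDegLin (Nat.add_right_comm k 1 l) ∘ₗ wedgeLin (k + 1) l (wedgeOneForms α) =
      extLin (k + l) (α 0) ∘ₗ wedgeLin k l (wedgeOneForms (Fin.tail α)) := by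
    refine linearMap_ext_wedgeOneForms fun β => ?_
    simp only [LinearMap.comp_apply, wedgeLin_apply, castDegLin_apply, extLin_apply]
    rw [wedge_wedgeOneForms, wedge_wedgeOneForms, castDeg_wedgeOneForms, ext_wedgeOneForms]
    congr 1
    conv_lhs => rw [← Fin.cons_self_tail α, Fin.append_cons]
    ext i : 1
    simp only [Function.comp_apply]
    congr 1
  exact LinearMap.congr_fun this φ

theorem wedge_zeroDeg {l : ℕ} (α : Fin 0 → N →L[ℝ] ℝ) (φ : N [⋀^Fin l]→L[ℝ] ℝ) :
    castDeg (Nat.zero_add l) (wedge (wedgeOneForms α) φ) = φ := by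
  have : castDegLin (Nat.zero_add l) ∘ₗ wedgeLin 0 l (wedgeOneForms α) = LinearMap.id := by
    refine linearMap_ext_wedgeOneForms fun β => ?_
    simp only [LinearMap.comp_apply, wedgeLin_apply, castDegLin_apply, LinearMap.id_apply]
    rw [wedge_wedgeOneForms, castDeg_wedgeOneForms]
    congr 1
    ext i : 1
    have : finCongr (Nat.zero_add l).symm i = Fin.natAdd 0 i := by
      ext; simp
    rw [this, Fin.append_right]
  exact LinearMap.congr_fun this φ

end Normed

/-! ### The operator algebra generated by exterior and interior multiplication. -/

section Algebra

variable {N : Type*} [NormedAddCommGroup N] [NormedSpace ℝ N]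

variable (N) in
/-- Families of forms, one in each degree. -/
def Forms : Type _ := (k : ℕ) → N [⋀^Fin k]→L[ℝ] ℝ

instance : AddCommGroup (Forms N) :=
  inferInstanceAs (AddCommGroup ((k : ℕ) → N [⋀^Fin k]→L[ℝ] ℝ))

instance : Module ℝ (Forms N) :=
  inferInstanceAs (Module ℝ ((k : ℕ) → N [⋀^Fin k]→L[ℝ] ℝ))

namespace Forms

/-- The component of degree `k`. -/
def deg (φ : Forms N) (k : ℕ) : N [⋀^Fin k]→L[ℝ] ℝ := φ k

@[ext] theorem ext {φ ψ : Forms N} (h : ∀ k, φ.deg k = ψ.deg k) : φ = ψ := funext h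

@[simp] theorem deg_zero (k : ℕ) : (0 : Forms N).deg k = 0 := rfl
@[simp] theorem deg_add (φ ψ : Forms N) (k : ℕ) : (φ + ψ).deg k = φ.deg k + ψ.deg k := rfl
@[simp] theorem deg_sub (φ ψ : Forms N) (k : ℕ) : (φ - ψ).deg k = φ.deg k - ψ.deg k := rfl
@[simp] theorem deg_neg (φ : Forms N) (k : ℕ) : (-φ).deg k = -φ.deg k := rfl
@[simp] theorem deg_smul (c : ℝ) (φ : Forms N) (k : ℕ) : (c • φ).deg k = c • φ.deg k := rfl

@[simp] theorem deg_sum {ι : Type*} (s : Finset ι) (φ : ι → Forms N) (k : ℕ) :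
    (∑ i ∈ s, φ i).deg k = ∑ i ∈ s, (φ i).deg k :=
  map_sum (AddMonoidHom.mk' (fun φ : Forms N => φ.deg k) fun _ _ => rfl) φ s

/-- The component of degree `j` of the family whose only nonzero component is `φ`. -/
def singleAux {k : ℕ} (φ : N [⋀^Fin k]→L[ℝ] ℝ) (j : ℕ) : N [⋀^Fin j]→L[ℝ] ℝ :=
  if h : k = j then castDeg h φ else 0

/-- The family with a single nonzero component. -/
def single (k : ℕ) : (N [⋀^Fin k]→L[ℝ] ℝ) →ₗ[ℝ] Forms N where
  toFun := singleAux
  map_add' φ ψ := by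
    ext1 j
    change singleAux (φ + ψ) j = singleAux φ j + singleAux ψ j
    by_cases h : k = j
    · subst h; simp [singleAux]
    · simp [singleAux, h]
  map_smul' c φ := by
    ext1 j
    change singleAux (c • φ) j = c • singleAux φ j
    by_cases h : k = j
    · subst h; simp [singleAux]
    · simp [singleAux, h]

@[simp] theorem single_deg (k : ℕ) (φ : N [⋀^Fin k]→L[ℝ] ℝ) : (single k φ).deg k = φ := by
  change singleAux φ k = φ
  simp [singleAux]

theorem single_deg_of_ne {k j : ℕ} (h : j ≠ k) (φ : N [⋀^Fin k]→L[ℝ] ℝ) :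
    (single k φ).deg j = 0 := by
  change singleAux φ j = 0
  simp [singleAux, h.symm]

end Forms

/-- A family of forms concentrated in one degree. -/
def IsHom (φ : Forms N) (k : ℕ) : Prop := ∀ j, j ≠ k → φ.deg j = 0

theorem IsHom.ext {φ ψ : Forms N} {k : ℕ} (hφ : IsHom φ k) (hψ : IsHom ψ k)
    (h : φ.deg k = ψ.deg k) : φ = ψ := by
  ext1 j
  by_cases hj : j = k
  · rw [hj, h]
  · rw [hφ j hj, hψ j hj]

theorem isHom_single {k : ℕ} (φ : N [⋀^Fin k]→L[ℝ] ℝ) : IsHom (Forms.single k φ) k :=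
  fun _ hj => Forms.single_deg_of_ne hj φ

theorem IsHom.sum {ι : Type*} {s : Finset ι} {φ : ι → Forms N} {k : ℕ}
    (h : ∀ i ∈ s, IsHom (φ i) k) : IsHom (∑ i ∈ s, φ i) k := fun j hj => by
  rw [Forms.deg_sum]
  exact Finset.sum_eq_zero fun i hi => h i hi j hj

theorem IsHom.smul {φ : Forms N} {k : ℕ} (h : IsHom φ k) (c : ℝ) : IsHom (c • φ) k :=
  fun j hj => by rw [Forms.deg_smul, h j hj, smul_zero]

/-- Exterior multiplication with a covector, on families of forms. -/
def E : (N →L[ℝ] ℝ) →ₗ[ℝ] Module.End ℝ (Forms N) :=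
  LinearMap.mk₂ ℝ (fun a φ => (fun k => match k with
      | 0 => 0
      | k + 1 => TransSymp.ext a (φ k) : Forms N))
    (fun a b φ => by
      funext k
      rcases k with _ | k
      · exact (add_zero (0 : N [⋀^Fin 0]→L[ℝ] ℝ)).symm
      · exact LinearMap.map_add₂ (extLin k) a b (φ k))
    (fun r a φ => by
      funext k
      rcases k with _ | k
      · exact (smul_zero (A := N [⋀^Fin 0]→L[ℝ] ℝ) r).symm
      · exact LinearMap.map_smul₂ (extLin k) r a (φ k))
    (fun a φ ψ => by
      funext k
      rcases k with _ | k
      · exact (add_zero (0 : N [⋀^Fin 0]→L[ℝ] ℝ)).symm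
      · exact map_add (extLin k a) (φ k) (ψ k))
    (fun r a φ => by
      funext k
      rcases k with _ | k
      · exact (smul_zero (A := N [⋀^Fin 0]→L[ℝ] ℝ) r).symm
      · exact map_smul (extLin k a) r (φ k))

@[simp] theorem E_zero (a : N →L[ℝ] ℝ) (φ : Forms N) : (E a φ).deg 0 = 0 := rfl
@[simp] theorem E_succ (a : N →L[ℝ] ℝ) (φ : Forms N) (k : ℕ) : (E a φ).deg (k + 1) = ext a (φ.deg k) := rfl

/-- The interior product with a vector, on families of forms. -/
def I : N →ₗ[ℝ] Module.End ℝ (Forms N) :=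
  LinearMap.mk₂ ℝ (fun X φ => (fun k => interior X (φ (k + 1)) : Forms N))
    (fun X Y φ => funext fun k => LinearMap.map_add₂ (interiorLin k) X Y (φ (k + 1)))
    (fun r X φ => funext fun k => LinearMap.map_smul₂ (interiorLin k) r X (φ (k + 1)))
    (fun X φ ψ => funext fun k => map_add (interiorLin k X) (φ (k + 1)) (ψ (k + 1)))
    (fun r X φ => funext fun k => map_smul (interiorLin k X) r (φ (k + 1)))

@[simp] theorem I_apply (X : N) (φ : Forms N) (k : ℕ) : (I X φ).deg k = interior X (φ.deg (k + 1)) := rfl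

/-- The Lefschetz operator on families of forms. -/
def Lf (Ω : N [⋀^Fin 2]→L[ℝ] ℝ) : Module.End ℝ (Forms N) where
  toFun φ := (fun k => match k with
    | 0 => 0
    | 1 => 0
    | k + 2 => lef Ω (φ k) : Forms N)
  map_add' φ ψ := by
    funext k
    rcases k with _ | _ | k
    · exact (add_zero (0 : N [⋀^Fin 0]→L[ℝ] ℝ)).symm
    · exact (add_zero (0 : N [⋀^Fin 1]→L[ℝ] ℝ)).symm
    · exact map_add (castDegLin (Nat.add_comm 2 k) ∘ₗ wedgeLin 2 k Ω) (φ k) (ψ k)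
  map_smul' r φ := by
    funext k
    rcases k with _ | _ | k
    · exact (smul_zero (A := N [⋀^Fin 0]→L[ℝ] ℝ) r).symm
    · exact (smul_zero (A := N [⋀^Fin 1]→L[ℝ] ℝ) r).symm
    · exact map_smul (castDegLin (Nat.add_comm 2 k) ∘ₗ wedgeLin 2 k Ω) r (φ k)

@[simp] theorem Lf_zero (Ω : N [⋀^Fin 2]→L[ℝ] ℝ) (φ : Forms N) : (Lf Ω φ).deg 0 = 0 := rfl
@[simp] theorem Lf_one (Ω : N [⋀^Fin 2]→L[ℝ] ℝ) (φ : Forms N) : (Lf Ω φ).deg 1 = 0 := rfl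
@[simp] theorem Lf_add_two (Ω : N [⋀^Fin 2]→L[ℝ] ℝ) (φ : Forms N) (k : ℕ) :
    (Lf Ω φ).deg (k + 2) = lef Ω (φ.deg k) := rfl

theorem Lf_pow_apply (Ω : N [⋀^Fin 2]→L[ℝ] ℝ) (φ : Forms N) (k r : ℕ) :
    ((Lf Ω ^ r) φ).deg (k + 2 * r) = lefPow Ω (φ.deg k) r := by
  induction r with
  | zero => rfl
  | succ r ih =>
    rw [pow_succ', Module.End.mul_apply, lefPow, ← ih]
    rfl

theorem IsHom.E {φ : Forms N} {k : ℕ} (h : IsHom φ k) (a : N →L[ℝ] ℝ) :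
    IsHom (E a φ) (k + 1) := fun j hj => by
  rcases j with _ | j
  · rfl
  · rw [E_succ, h j (by omega)]
    exact map_zero (extLin j a)

theorem IsHom.I {φ : Forms N} {k : ℕ} (h : IsHom φ (k + 1)) (X : N) :
    IsHom (I X φ) k := fun j hj => by
  rw [I_apply, h (j + 1) (by omega)]
  exact map_zero (interiorLin j X)

theorem IsHom.I_eq_zero {φ : Forms N} (h : IsHom φ 0) (X : N) : TransSymp.I X φ = 0 := by
  ext1 j
  rw [I_apply, h (j + 1) (by omega)]
  exact map_zero (interiorLin j X)

theorem IsHom.Lf {φ : Forms N} {k : ℕ} (h : IsHom φ k) (Ω : N [⋀^Fin 2]→L[ℝ] ℝ) :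
    IsHom (Lf Ω φ) (k + 2) := fun j hj => by
  rcases j with _ | _ | j
  · rfl
  · rfl
  · rw [Lf_add_two, h j (by omega)]
    exact map_zero (castDegLin (Nat.add_comm 2 j) ∘ₗ wedgeLin 2 j Ω)

theorem IsHom.Lf_pow {φ : Forms N} {k : ℕ} (h : IsHom φ k) (Ω : N [⋀^Fin 2]→L[ℝ] ℝ) (r : ℕ) :
    IsHom ((TransSymp.Lf Ω ^ r) φ) (k + 2 * r) := by
  induction r with
  | zero => exact h
  | succ r ih => rw [pow_succ', Module.End.mul_apply]; exact ih.Lf Ω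

/-- The Clifford-type relation from which all later commutators are computed. Working with families
of forms in all degrees makes it an identity of endomorphisms, without changes of degree. -/
theorem I_mul_E (X : N) (a : N →L[ℝ] ℝ) : I X * E a = a X • 1 - E a * I X := by
  refine LinearMap.ext fun φ => Forms.ext fun k => ?_
  rcases k with _ | k
  · exact (interior_ext_zero X a (φ.deg 0)).trans (sub_zero _).symm
  · exact interior_ext X a (φ.deg (k + 1))

/-- An operator which vanishes on functions and commutes with contractions is zero. -/
theorem end_eq_zero {S : Module.End ℝ (Forms N)} (h0 : ∀ φ, (S φ).deg 0 = 0)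
    (h : ∀ X, I X * S = S * I X) : S = 0 := by
  have : ∀ k φ, (S φ).deg k = 0 := by
    intro k
    induction k with
    | zero => exact h0
    | succ k ih =>
      intro φ
      ext v
      have := congrArg (fun χ : Forms N => χ.deg k (Fin.tail v)) (LinearMap.congr_fun (h (v 0)) φ)
      simp only [Module.End.mul_apply, ih] at this
      simp only [I_apply, interior_apply, Fin.cons_self_tail] at this
      exact this
  exact LinearMap.ext fun φ => Forms.ext fun k => this k φ

/-- The anticommutator vanishes in degree zero and commutes with every contraction by `I_mul_E`, so
`end_eq_zero` applies. -/
theorem E_mul_E (a b : N →L[ℝ] ℝ) : E a * E b = -(E b * E a) := by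
  rw [eq_neg_iff_add_eq_zero]
  refine end_eq_zero (fun φ => add_zero _) fun X => ?_
  have h := fun c : N →L[ℝ] ℝ => I_mul_E X c
  rw [mul_add, ← mul_assoc, ← mul_assoc, h a, h b, sub_mul, sub_mul, mul_assoc, mul_assoc, h a,
    h b, mul_sub, mul_sub, add_mul]
  simp only [smul_mul_assoc, mul_smul_comm, one_mul, mul_one, mul_assoc]
  abel

/-- The operator `a₁ ∧ ⋯ ∧ a_k ∧`. -/
def chain : {k : ℕ} → (Fin k → N →L[ℝ] ℝ) → Module.End ℝ (Forms N)
  | 0, _ => 1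
  | _ + 1, α => E (α 0) * chain (Fin.tail α)

theorem chain_mul_E {k : ℕ} (α : Fin k → N →L[ℝ] ℝ) (a : N →L[ℝ] ℝ) :
    chain α * E a = (-1 : ℝ) ^ k • (E a * chain α) := by
  induction k with
  | zero => simp [chain]
  | succ k ih =>
    rw [chain, mul_assoc, ih, mul_smul_comm, ← mul_assoc, E_mul_E (α 0), pow_succ, mul_smul,
      neg_mul, mul_assoc, neg_one_smul]

theorem two_form_swap (Ω : N [⋀^Fin 2]→L[ℝ] ℝ) (X Y : N) : Ω ![X, Y] = - Ω ![Y, X] := by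
  have := Ω.toAlternatingMap.map_swap ![Y, X] (i := 0) (j := 1) (by decide)
  have e : (![Y, X] ∘ (Equiv.swap (0 : Fin 2) 1)) = ![X, Y] := by
    ext i
    fin_cases i <;> simp
  rw [e] at this
  exact this

/-- Euler's identity. -/
theorem sum_E_I {ι : Type*} [Fintype ι] {c : ι → N →L[ℝ] ℝ} {f : ι → N}
    (h : ∀ X, ∑ t, c t X • f t = X) (φ : Forms N) (k : ℕ) :
    ((∑ t, E (c t) * I (f t)) φ).deg k = (k : ℝ) • φ.deg k := by
  rw [LinearMap.sum_apply, Forms.deg_sum]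
  rcases k with _ | k
  · simp
  · ext v
    simp only [Module.End.mul_apply, E_succ, I_apply, ContinuousAlternatingMap.sum_apply,
      ext_apply, interior_apply, ContinuousAlternatingMap.smul_apply]
    rw [Finset.sum_comm]
    have : ∀ i : Fin (k + 1), ∑ t, (-1 : ℝ) ^ (i : ℕ) * (c t (v i) *
        φ.deg (k + 1) (Fin.cons (f t) (i.removeNth v))) = φ.deg (k + 1) v := by
      intro i
      have h1 : ∑ t, c t (v i) * φ.deg (k + 1) (Fin.cons (f t) (i.removeNth v)) =
          φ.deg (k + 1) (Fin.cons (v i) (i.removeNth v)) := by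
        have h2 := map_sum ((interiorLin k).flip (φ.deg (k + 1))) (fun t => c t (v i) • f t)
          Finset.univ
        rw [h (v i)] at h2
        have h3 := DFunLike.congr_fun h2 (i.removeNth v)
        rw [ContinuousAlternatingMap.sum_apply] at h3
        refine Eq.trans ?_ h3.symm
        refine Finset.sum_congr rfl fun t _ => ?_
        rw [map_smul]
        rfl
      rw [← Finset.mul_sum, h1]
      have h4 := (φ.deg (k + 1)).neg_one_pow_smul_map_insertNth i (v i) (i.removeNth v)
      rw [Fin.insertNth_self_removeNth] at h4
      have h5 : (-1 : ℝ) ^ (i : ℕ) * (-1 : ℝ) ^ (i : ℕ) = 1 := by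
        rw [← mul_pow]; simp
      have h6 : (-1 : ℝ) ^ (i : ℕ) * φ.deg (k + 1) v = φ.deg (k + 1) (Matrix.vecCons (v i) (i.removeNth v)) := by
        simpa using h4
      change _ * φ.deg (k + 1) (Matrix.vecCons (v i) (i.removeNth v)) = _
      rw [← h6, ← mul_assoc, h5, one_mul]
    rw [Finset.sum_congr rfl fun i _ => this i]
    simp

variable [FiniteDimensional ℝ N]

/-- Peeling off one covector at a time identifies the shuffle product by a decomposable form with a
composition of operators `E`. -/
theorem chain_apply {k : ℕ} (α : Fin k → N →L[ℝ] ℝ) (φ : Forms N) (l : ℕ) :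
    (chain α φ).deg (k + l) = wedge (wedgeOneForms α) (φ.deg l) := by
  induction k with
  | zero =>
    rw [← castDeg_rfl (wedge (wedgeOneForms α) (φ.deg l)),
      ← castDeg_castDeg (Nat.zero_add l) (Nat.zero_add l).symm, wedge_zeroDeg,
      castDeg_family φ.deg]
    rfl
  | succ k ih =>
    rw [← castDeg_rfl (wedge (wedgeOneForms α) (φ.deg l)),
      ← castDeg_castDeg (Nat.add_right_comm k 1 l) (Nat.add_right_comm k 1 l).symm, wedge_cons,
      ← ih]
    exact (castDeg_family (chain α φ).deg (Nat.add_right_comm k 1 l).symm).symm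

/-- Writing `L` as a quadratic expression in the operators `E` reduces its commutators to `I_mul_E`
and `E_mul_E`. -/
theorem Lf_eq_sum {ι : Type*} [Fintype ι] (b : Module.Basis ι ℝ N) (Ω : N [⋀^Fin 2]→L[ℝ] ℝ) :
    Lf Ω = (2 : ℝ)⁻¹ • ∑ s : Fin 2 → ι, Ω (fun i => b (s i)) •
      (E (coordL b (s 0)) * E (coordL b (s 1))) := by
  have key : ∀ (s : Fin 2 → ι) (φ : Forms N) (k : ℕ),
      lef (wedgeOneForms fun i => coordL b (s i)) (φ.deg k) =
        ext (coordL b (s 0)) (ext (coordL b (s 1)) (φ.deg k)) := by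
    intro s φ k
    rw [lef, ← chain_apply, castDeg_family (chain _ φ).deg]
    rfl
  refine LinearMap.ext fun φ => Forms.ext fun k => ?_
  rw [LinearMap.smul_apply, LinearMap.sum_apply, Forms.deg_smul, Forms.deg_sum]
  simp only [LinearMap.smul_apply, Forms.deg_smul]
  rcases k with _ | _ | k
  · exact (Finset.smul_sum.trans (Finset.sum_eq_zero fun s _ => by
      rw [show ((E (coordL b (s 0)) * E (coordL b (s 1))) φ).deg 0 = 0 from rfl, smul_zero,
        smul_zero])).symm
  · refine (Finset.smul_sum.trans (Finset.sum_eq_zero fun s _ => ?_)).symm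
    rw [show ((E (coordL b (s 0)) * E (coordL b (s 1))) φ).deg 1 = 0 from
      map_zero (extLin 0 _), smul_zero, smul_zero]
  · rw [Lf_add_two]
    conv_lhs => rw [eq_sum_wedgeOneForms b Ω]
    change ((castDegLin (Nat.add_comm 2 k) ∘ₗ (wedgeLin 2 k).flip (φ.deg k)) _) = _
    rw [map_smul, map_sum]
    refine congrArg₂ _ (by simp) (Finset.sum_congr rfl fun s _ => ?_)
    rw [map_smul]
    exact congrArg _ (key s φ k)

/-- The covector `i(X)Ω`, as a linear function of `X`. -/
def flat (Ω : N [⋀^Fin 2]→L[ℝ] ℝ) : N →L[ℝ] N →L[ℝ] ℝ :=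
  LinearMap.toContinuousLinearMap
    { toFun := fun X => (ContinuousAlternatingMap.ofSubsingleton ℝ N ℝ (0 : Fin 1)).symm
        (interior X Ω)
      map_add' := fun X Y => by
        rw [← interiorLin_apply, map_add]
        rfl
      map_smul' := fun c X => by
        rw [← interiorLin_apply, map_smul]
        rfl }

theorem flat_apply (Ω : N [⋀^Fin 2]→L[ℝ] ℝ) (X Y : N) : flat Ω X Y = Ω ![X, Y] := by
  change Ω _ = Ω _
  congr 1
  ext i
  fin_cases i <;> rfl

theorem flat_swap (Ω : N [⋀^Fin 2]→L[ℝ] ℝ) (X Y : N) : flat Ω X Y = - flat Ω Y X := by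
  rw [flat_apply, flat_apply, two_form_swap]

/-- Moving `I X` past the two factors of each quadratic term leaves two single factors `E`, and
these add up to the covector `i(X)Ω`. -/
theorem I_mul_Lf (Ω : N [⋀^Fin 2]→L[ℝ] ℝ) (X : N) :
    I X * Lf Ω = Lf Ω * I X + E (flat Ω X) := by
  let b := Module.finBasis ℝ N
  have hflat : flat Ω X = (2 : ℝ)⁻¹ • ∑ s : Fin 2 → Fin (Module.finrank ℝ N),
      Ω (fun i => b (s i)) • (coordL b (s 0) X • coordL b (s 1) -
        coordL b (s 1) X • coordL b (s 0)) := by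
    ext Y
    rw [flat_apply]
    conv_lhs => rw [eq_sum_wedgeOneForms b Ω]
    simp only [ContinuousAlternatingMap.smul_apply, ContinuousAlternatingMap.sum_apply,
      smul_apply, sum_apply, sub_apply, wedgeOneForms_apply, Matrix.det_fin_two, smul_eq_mul]
    congr 1
  rw [hflat, Lf_eq_sum b]
  simp only [map_smul, map_sum, map_sub, mul_smul_comm, smul_mul_assoc, Finset.mul_sum,
    Finset.sum_mul, ← smul_add, ← Finset.sum_add_distrib]
  congr 1
  refine Finset.sum_congr rfl fun s _ => ?_
  congr 1
  rw [← mul_assoc, I_mul_E, sub_mul, mul_assoc _ (I X), I_mul_E, mul_sub, smul_mul_assoc,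
    mul_smul_comm, one_mul, mul_one, mul_assoc]
  abel

theorem E_mul_Lf (Ω : N [⋀^Fin 2]→L[ℝ] ℝ) (a : N →L[ℝ] ℝ) : E a * Lf Ω = Lf Ω * E a := by
  rw [Lf_eq_sum (Module.finBasis ℝ N)]
  simp only [mul_smul_comm, smul_mul_assoc, Finset.mul_sum, Finset.sum_mul]
  congr 1
  refine Finset.sum_congr rfl fun s _ => ?_
  congr 1
  rw [← mul_assoc, E_mul_E a, neg_mul, mul_assoc, E_mul_E a, mul_neg, neg_neg, mul_assoc]

theorem E_mul_Lf_pow (Ω : N [⋀^Fin 2]→L[ℝ] ℝ) (a : N →L[ℝ] ℝ) (r : ℕ) :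
    E a * Lf Ω ^ r = Lf Ω ^ r * E a := Commute.pow_right (E_mul_Lf Ω a) r

/-- Each of the `r + 1` factors `L` contributes one commutator, and `E` commutes with `L`, so all
contributions coincide. -/
theorem I_mul_Lf_pow (Ω : N [⋀^Fin 2]→L[ℝ] ℝ) (X : N) (r : ℕ) :
    I X * Lf Ω ^ (r + 1) = Lf Ω ^ (r + 1) * I X + ((r : ℝ) + 1) • (Lf Ω ^ r * E (flat Ω X)) := by
  induction r with
  | zero => simpa using I_mul_Lf Ω X
  | succ r ih =>
    rw [pow_succ _ (r + 1), ← mul_assoc, ih, add_mul, mul_assoc, I_mul_Lf, mul_add, ← mul_assoc,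
      smul_mul_assoc, mul_assoc _ (E _), E_mul_Lf, ← mul_assoc, ← pow_succ, ← pow_succ]
    push_cast
    rw [add_assoc, add_smul ((r : ℝ) + 1), one_smul, add_comm (_ • _)]

end Algebra

/-! ### The dual Lefschetz operator and hard Lefschetz injectivity. -/

section Frame

variable {N : Type*} [NormedAddCommGroup N] [NormedSpace ℝ N]
  {Ω : N [⋀^Fin 2]→L[ℝ] ℝ} {n : ℕ} {v w : Fin n → N}

/-- The contraction with the Poisson bivector in a frame. -/
def Lam (v w : Fin n → N) : Module.End ℝ (Forms N) := ∑ a, I (w a) * I (v a)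

theorem IsHom.Lam {φ : Forms N} {k : ℕ} (h : IsHom φ (k + 2)) :
    IsHom (TransSymp.Lam v w φ) k := by
  rw [TransSymp.Lam, LinearMap.sum_apply]
  exact IsHom.sum fun a _ => (h.I _).I _

theorem Lam_eq_zero {φ : Forms N} {k : ℕ} (h : IsHom φ k) (hk : k < 2) :
    Lam v w φ = 0 := by
  rw [Lam, LinearMap.sum_apply]
  refine Finset.sum_eq_zero fun a _ => ?_
  rw [Module.End.mul_apply]
  rcases k with _ | k
  · rw [h.I_eq_zero, map_zero]
  · obtain rfl : k = 0 := by omega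
    exact (h.I _).I_eq_zero _

variable [FiniteDimensional ℝ N]

/-- Nondegeneracy of a two-form. -/
def Nondeg (Ω : N [⋀^Fin 2]→L[ℝ] ℝ) : Prop := ∀ X, flat Ω X = 0 → X = 0

theorem Nondeg.eq_zero_of_mem (h : Nondeg Ω) {X : N} (hX : X ∈ formKer Ω) : X = 0 :=
  h X (ContinuousLinearMap.ext fun Y => (flat_apply Ω X Y).trans (hX Y))

theorem Nondeg.expand (h : Nondeg Ω) (hf : IsSymplecticFrame Ω v w) (X : N) :
    ∑ a, (Ω ![X, w a] • v a - Ω ![X, v a] • w a) = X :=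
  (sub_eq_zero.1 (h.eq_zero_of_mem (hf.expand X))).symm

/-- For each pair `v a`, `w a`, moving the two contractions past `L` leaves the identity minus the
two Euler terms of that pair. Summed over the frame this is `n` minus the Euler operator, which acts
on degree `k` as multiplication by `k`. -/
theorem Lam_Lf (h : Nondeg Ω) (hf : IsSymplecticFrame Ω v w) {φ : Forms N} {k : ℕ}
    (hφ : IsHom φ k) : Lam v w (Lf Ω φ) = Lf Ω (Lam v w φ) + ((n : ℝ) - k) • φ := by
  -- The coframe dual to `v`, `w`, read off from the expansion of a vector in the symplectic frame.
  let c : Fin n ⊕ Fin n → N →L[ℝ] ℝ := Sum.elim (fun a => -flat Ω (w a)) fun a => flat Ω (v a)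
  have hc : ∀ X, ∑ t, c t X • Sum.elim v w t = X := by
    intro X
    rw [Fintype.sum_sum_type, ← Finset.sum_add_distrib]
    refine (Finset.sum_congr rfl fun a _ => ?_).trans (h.expand hf X)
    simp only [c, Sum.elim_inl, Sum.elim_inr, neg_apply, flat_apply, two_form_swap Ω _ X]
    rw [neg_neg, neg_smul, sub_eq_add_neg]
  have hE : (∑ t, E (c t) * I (Sum.elim v w t)) φ = (k : ℝ) • φ := by
    ext1 j
    rw [sum_E_I hc, Forms.deg_smul]
    by_cases hj : j = k
    · rw [hj]
    · rw [hφ j hj, smul_zero, smul_zero]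
  have hop : Lam v w * Lf Ω = Lf Ω * Lam v w + (n : ℝ) • 1 - ∑ t, E (c t) * I (Sum.elim v w t) := by
    rw [Fintype.sum_sum_type, ← Finset.sum_add_distrib, Lam, Finset.sum_mul, Finset.mul_sum]
    have : (n : ℝ) • (1 : Module.End ℝ (Forms N)) = ∑ _ : Fin n, (1 : Module.End ℝ (Forms N)) := by
      simp [Nat.cast_smul_eq_nsmul]
    rw [this, ← Finset.sum_add_distrib, ← Finset.sum_sub_distrib]
    refine Finset.sum_congr rfl fun a _ => ?_
    have h1 : flat Ω (v a) (w a) = 1 := by rw [flat_apply, hf.vw, if_pos rfl]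
    rw [mul_assoc, I_mul_Lf, mul_add, I_mul_E, ← mul_assoc, I_mul_Lf, add_mul, h1, one_smul]
    simp only [c, Sum.elim_inl, Sum.elim_inr, map_neg, neg_mul, mul_assoc]
    abel
  have := LinearMap.congr_fun hop φ
  rw [LinearMap.sub_apply, hE] at this
  rw [← Module.End.mul_apply, this, LinearMap.add_apply, LinearMap.smul_apply, sub_smul,
    Module.End.mul_apply, Module.End.one_apply]
  abel

/-- The coefficient is the sum of `n - k - 2i` over `i = 0, …, r`, one term of `Lam_Lf` for each
factor `L`. -/
theorem Lam_Lf_pow (h : Nondeg Ω) (hf : IsSymplecticFrame Ω v w) {φ : Forms N} {k : ℕ}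
    (hφ : IsHom φ k) (r : ℕ) : Lam v w ((Lf Ω ^ (r + 1)) φ) =
      (Lf Ω ^ (r + 1)) (Lam v w φ) + (((r : ℝ) + 1) * (n - k - r)) • (Lf Ω ^ r) φ := by
  induction r with
  | zero => simpa using Lam_Lf h hf hφ
  | succ r ih =>
    rw [pow_succ' _ (r + 1), Module.End.mul_apply, Lam_Lf h hf (hφ.Lf_pow Ω (r + 1)), ih, map_add,
      map_smul, ← Module.End.mul_apply (Lf Ω), ← Module.End.mul_apply (Lf Ω), ← pow_succ',
      ← pow_succ', add_assoc, ← add_smul]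
    congr 2
    push_cast
    ring

/-- The injectivity half of the hard Lefschetz theorem in linear algebra. -/
theorem eq_zero_of_Lf_pow (h : Nondeg Ω) (hf : IsSymplecticFrame Ω v w) :
    ∀ (k : ℕ) {φ : Forms N}, IsHom φ k → ∀ r, k + r ≤ n → (Lf Ω ^ r) φ = 0 → φ = 0 := by
  intro k
  induction k using Nat.strong_induction_on with
  | _ k ihk =>
    intro φ hφ r
    induction r with
    | zero => exact fun _ h0 => h0
    | succ r ihr =>
      intro hr h0
      have h1 := Lam_Lf_pow h hf hφ r
      rw [h0, map_zero] at h1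
      -- Applying `L` once more to the commutator relation removes its last term. The degree drops
      -- by two and the exponent is now `r + 2`, so the bound by `n` needed for the induction on the
      -- degree still holds.
      have h2 : (Lf Ω ^ (r + 2)) (Lam v w φ) = 0 := by
        have := congrArg (Lf Ω) h1
        rw [map_zero, map_add, map_smul, ← Module.End.mul_apply (Lf Ω),
          ← Module.End.mul_apply (Lf Ω), ← pow_succ', ← pow_succ', h0, smul_zero, add_zero] at this
        exact this.symm
      have h3 : Lam v w φ = 0 := by
        by_cases hk : k < 2
        · exact Lam_eq_zero hφ hk
        · obtain ⟨m, rfl⟩ := Nat.exists_eq_add_of_le' (not_lt.1 hk)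
          exact ihk m (by omega) hφ.Lam (r + 2) (by omega) h2
      rw [h3, map_zero, zero_add, eq_comm, smul_eq_zero] at h1
      -- With the `Lam` term gone, a multiple of `L^r φ` vanishes; the factor `n - k - r` is at
      -- least one, so the exponent can be lowered.
      refine ihr (by omega) (h1.resolve_left (mul_ne_zero (by positivity) ?_))
      have : (k : ℝ) + r + 1 ≤ n := by exact_mod_cast hr
      intro h4
      linarith

end Frame

/-! ### Existence of symplectic bases and the inverse of `flat`. -/

section SymplecticBasis

variable {N : Type*} [NormedAddCommGroup N] [NormedSpace ℝ N] [FiniteDimensional ℝ N]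
  {Ω : N [⋀^Fin 2]→L[ℝ] ℝ} {n : ℕ}

/-- The relations of a symplectic frame, without the spanning condition. -/
structure IsPartialFrame (Ω : N [⋀^Fin 2]→L[ℝ] ℝ) {m : ℕ} (v w : Fin m → N) : Prop where
  vv : ∀ a b, flat Ω (v a) (v b) = 0
  ww : ∀ a b, flat Ω (w a) (w b) = 0
  vw : ∀ a b, flat Ω (v a) (w b) = if a = b then 1 else 0

/-- The component of a vector orthogonal to a partial frame. -/
def residual (Ω : N [⋀^Fin 2]→L[ℝ] ℝ) {m : ℕ} (v w : Fin m → N) (X : N) : N :=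
  X - ∑ a, (flat Ω X (w a) • v a - flat Ω X (v a) • w a)

namespace IsPartialFrame

variable {m : ℕ} {v w : Fin m → N}

theorem wv (h : IsPartialFrame Ω v w) (a b : Fin m) :
    flat Ω (w a) (v b) = if a = b then -1 else 0 := by
  rw [flat_swap, h.vw]
  by_cases hab : a = b
  · simp [hab]
  · simp [hab, Ne.symm hab]

theorem residual_v (h : IsPartialFrame Ω v w) (X : N) (b : Fin m) :
    flat Ω (residual Ω v w X) (v b) = 0 := by
  simp [residual, map_sub, map_sum, h.vv, h.wv, sub_apply, smul_apply, sum_apply]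

theorem residual_w (h : IsPartialFrame Ω v w) (X : N) (b : Fin m) :
    flat Ω (residual Ω v w X) (w b) = 0 := by
  simp [residual, map_sub, map_sum, h.vw, h.ww, sub_apply, smul_apply, sum_apply]

theorem linearIndependent (h : IsPartialFrame Ω v w) : LinearIndependent ℝ (Sum.elim v w) := by
  rw [Fintype.linearIndependent_iff]
  intro c hc
  rw [Fintype.sum_sum_type] at hc
  simp only [Sum.elim_inl, Sum.elim_inr] at hc
  rintro (b | b)
  · have := congrArg (fun X => flat Ω X (w b)) hc
    simpa [map_add, map_sum, h.vw, h.ww, add_apply, smul_apply, sum_apply] using this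
  · have := congrArg (fun X => flat Ω X (v b)) hc
    simpa [map_add, map_sum, h.vv, h.wv, add_apply, smul_apply, sum_apply] using this

/-- The symplectic Gram–Schmidt step: the nonzero residual `x` pairs nontrivially with some `Y`, and
passing to the residual of `Y` does not change this pairing, because `x` is orthogonal to the frame
already built. Rescaling normalizes it. -/
theorem exists_succ (h : IsPartialFrame Ω v w) (hΩ : Nondeg Ω) {X : N}
    (hX : residual Ω v w X ≠ 0) :
    ∃ v' w' : Fin (m + 1) → N, IsPartialFrame Ω v' w' := by
  set x := residual Ω v w X with hx
  have h1 : flat Ω x ≠ 0 := fun h0 => hX (hΩ x h0)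
  obtain ⟨Y, hY⟩ : ∃ Y, flat Ω x Y ≠ 0 := by
    by_contra! h0
    exact h1 (ContinuousLinearMap.ext h0)
  have hxv := h.residual_v X
  have hxw := h.residual_w X
  rw [← hx] at hxv hxw
  set y := (flat Ω x Y)⁻¹ • residual Ω v w Y with hy
  have hyv : ∀ b, flat Ω y (v b) = 0 := fun b => by
    rw [hy, map_smul, smul_apply, h.residual_v, smul_zero]
  have hyw : ∀ b, flat Ω y (w b) = 0 := fun b => by
    rw [hy, map_smul, smul_apply, h.residual_w, smul_zero]
  have hxy : flat Ω x y = 1 := by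
    rw [hy, map_smul, residual, map_sub, map_sum]
    simp only [map_sub, map_smul, hxv, hxw, smul_zero, sub_zero, Finset.sum_const_zero]
    exact inv_mul_cancel₀ hY
  have hself : ∀ Z, flat Ω Z Z = 0 := fun Z => by
    have := flat_swap Ω Z Z
    linarith
  refine ⟨Fin.cons x v, Fin.cons y w, ⟨?_, ?_, ?_⟩⟩
  · intro a b
    refine Fin.cases ?_ (fun a => ?_) a <;> refine Fin.cases ?_ (fun b => ?_) b
    · simp [hself]
    · simp [hxv]
    · simp only [Fin.cons_zero, Fin.cons_succ]
      rw [flat_swap, hxv, neg_zero]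
    · simp [h.vv]
  · intro a b
    refine Fin.cases ?_ (fun a => ?_) a <;> refine Fin.cases ?_ (fun b => ?_) b
    · simp [hself]
    · simp [hyw]
    · simp only [Fin.cons_zero, Fin.cons_succ]
      rw [flat_swap, hyw, neg_zero]
    · simp [h.ww]
  · intro a b
    refine Fin.cases ?_ (fun a => ?_) a <;> refine Fin.cases ?_ (fun b => ?_) b
    · simp [hxy]
    · simp [hxw, (Fin.succ_ne_zero b).symm]
    · simp only [Fin.cons_zero, Fin.cons_succ]
      rw [flat_swap, hyv, neg_zero, if_neg (Fin.succ_ne_zero a)]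
    · simp [h.vw]

end IsPartialFrame

/-- As long as fewer than `n` pairs have been found, their vectors cannot span the space, so some
residual is nonzero and `exists_succ` applies. -/
theorem exists_isPartialFrame (hn : Module.finrank ℝ N = 2 * n) (hΩ : Nondeg Ω) :
    ∀ m ≤ n, ∃ v w : Fin m → N, IsPartialFrame Ω v w := by
  intro m
  induction m with
  | zero => exact fun _ => ⟨0, 0, ⟨fun a => a.elim0, fun a => a.elim0, fun a => a.elim0⟩⟩
  | succ m ih =>
    intro hm
    obtain ⟨v, w, h⟩ := ih (by omega)
    obtain ⟨X, hX⟩ : ∃ X, residual Ω v w X ≠ 0 := by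
      by_contra! h0
      have hspan : ⊤ ≤ Submodule.span ℝ (Set.range (Sum.elim v w)) := fun X _ => by
        rw [sub_eq_zero.1 (h0 X)]
        refine Submodule.sum_mem _ fun a _ => Submodule.sub_mem _
          (Submodule.smul_mem _ _ (Submodule.subset_span ⟨Sum.inl a, rfl⟩))
          (Submodule.smul_mem _ _ (Submodule.subset_span ⟨Sum.inr a, rfl⟩))
      have := finrank_range_le_card (R := ℝ) (Sum.elim v w)
      rw [Set.finrank, top_le_iff.1 hspan, finrank_top, hn] at this
      simp at this
      omega
    exact h.exists_succ hΩ hX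

/-- Existence of symplectic bases. -/
theorem exists_isSymplecticFrame (hn : Module.finrank ℝ N = 2 * n) (hΩ : Nondeg Ω) :
    ∃ v w : Fin n → N, IsSymplecticFrame Ω v w := by
  obtain ⟨v, w, h⟩ := exists_isPartialFrame hn hΩ n le_rfl
  refine ⟨v, w, ⟨fun a b => ?_, fun a b => ?_, fun a b => ?_, fun X => ?_⟩⟩
  · rw [← flat_apply, h.vv]
  · rw [← flat_apply, h.ww]
  · rw [← flat_apply, h.vw]
  · intro Y
    -- The `2n` independent vectors form a basis, and the residual is orthogonal to each of them,
    -- hence to everything.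
    let b := basisOfLinearIndependentOfCardEqFinrank' (Sum.elim v w) h.linearIndependent
      (by simp [hn, two_mul])
    have h0 : (flat Ω (residual Ω v w X)).toLinearMap = 0 := by
      refine b.ext fun t => ?_
      rw [coe_basisOfLinearIndependentOfCardEqFinrank']
      rcases t with a | a
      · exact h.residual_v X a
      · exact h.residual_w X a
    have : flat Ω (residual Ω v w X) Y = 0 := LinearMap.congr_fun h0 Y
    rw [← flat_apply]
    simpa only [residual, flat_apply Ω X] using this

/-- The inverse of `flat`. -/
def sharpL (Ω : N [⋀^Fin 2]→L[ℝ] ℝ) : (N →L[ℝ] ℝ) →L[ℝ] N := (flat Ω).inverse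

theorem Nondeg.exists_equiv (hΩ : Nondeg Ω) :
    ∃ e : N ≃L[ℝ] (N →L[ℝ] ℝ), (e : N →L[ℝ] (N →L[ℝ] ℝ)) = flat Ω := by
  have hdim : Module.finrank ℝ N = Module.finrank ℝ (N →L[ℝ] ℝ) := by
    rw [← Subspace.dual_finrank_eq (K := ℝ) (V := N)]
    exact LinearEquiv.finrank_eq LinearMap.toContinuousLinearMap
  let e := LinearEquiv.ofInjectiveOfFinrankEq (flat Ω).toLinearMap
    ((injective_iff_map_eq_zero _).2 hΩ) hdim
  exact ⟨e.toContinuousLinearEquiv, by ext X : 1; rfl⟩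

theorem Nondeg.flat_sharpL (hΩ : Nondeg Ω) (a : N →L[ℝ] ℝ) : flat Ω (sharpL Ω a) = a := by
  obtain ⟨e, he⟩ := hΩ.exists_equiv
  rw [sharpL, ← he, ContinuousLinearMap.inverse_equiv]
  exact e.apply_symm_apply a

theorem Nondeg.sharpL_flat (hΩ : Nondeg Ω) (X : N) : sharpL Ω (flat Ω X) = X := by
  obtain ⟨e, he⟩ := hΩ.exists_equiv
  rw [sharpL, ← he, ContinuousLinearMap.inverse_equiv]
  exact e.symm_apply_apply X

theorem Nondeg.apply_sharpL_swap (hΩ : Nondeg Ω) (a b : N →L[ℝ] ℝ) :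
    a (sharpL Ω b) = - b (sharpL Ω a) := by
  have h1 : flat Ω (sharpL Ω a) (sharpL Ω b) = a (sharpL Ω b) := by rw [hΩ.flat_sharpL]
  have h2 : flat Ω (sharpL Ω b) (sharpL Ω a) = b (sharpL Ω a) := by rw [hΩ.flat_sharpL]
  rw [← h1, flat_swap, h2]

end SymplecticBasis

/-! ### Frame independence of the symplectic pairing of forms. -/

section Pairing

/-- Reindexing the multi-indices shows that all `k!` permutations in the determinant contribute the
same amount, which cancels the normalizing factor. -/
theorem framePairing_wedgeOneForms_left {V : Type*} [AddCommGroup V] [Module ℝ V]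
    [TopologicalSpace V] {n : ℕ} (v w : Fin n → V) {k : ℕ} (α : Fin k → V →L[ℝ] ℝ)
    (ψ : V [⋀^Fin k]→L[ℝ] ℝ) :
    framePairing v w (wedgeOneForms α) ψ = ψ fun i => ∑ t, α i (Sum.elim v w t) •
      Sum.elim w (fun a => -v a) t := by
  have hfac : (k.factorial : ℝ) ≠ 0 := Nat.cast_ne_zero.mpr (Nat.factorial_ne_zero k)
  have e1 : (ψ fun i => ∑ t, α i (Sum.elim v w t) • Sum.elim w (fun a => -v a) t) =
      ∑ s : Fin k → Fin n ⊕ Fin n, (∏ i, α i (Sum.elim v w (s i))) *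
        ψ fun i => Sum.elim w (fun a => -v a) (s i) := by
    refine (ψ.toMultilinearMap.map_sum
      (fun i t => α i (Sum.elim v w t) • Sum.elim w (fun a => -v a) t)).trans ?_
    exact Finset.sum_congr rfl fun s _ =>
      ψ.toMultilinearMap.map_smul_univ (fun i => α i (Sum.elim v w (s i)))
        fun i => Sum.elim w (fun a => -v a) (s i)
  rw [framePairing, inv_mul_eq_iff_eq_mul₀ hfac]
  simp only [wedgeOneForms_apply, Matrix.det_apply', Finset.sum_mul, Matrix.of_apply]
  rw [Finset.sum_comm]
  have e3 : ∀ σ : Equiv.Perm (Fin k), ∑ s : Fin k → Fin n ⊕ Fin n,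
      ((Equiv.Perm.sign σ : ℤ) : ℝ) * (∏ i, α i (Sum.elim v w (s (σ i)))) *
        ψ (fun i => Sum.elim w (fun a => -v a) (s i)) =
      ψ fun i => ∑ t, α i (Sum.elim v w t) • Sum.elim w (fun a => -v a) t := by
    intro σ
    rw [e1, ← (Equiv.arrowCongr σ (Equiv.refl (Fin n ⊕ Fin n))).sum_comp]
    refine Finset.sum_congr rfl fun s _ => ?_
    have e5 := ψ.toAlternatingMap.map_perm (fun i => Sum.elim w (fun a => -v a) (s i)) σ⁻¹
    rw [Units.smul_def, zsmul_eq_mul, Equiv.Perm.sign_inv] at e5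
    have e6 : ((Equiv.Perm.sign σ : ℤ) : ℝ) * ((Equiv.Perm.sign σ : ℤ) : ℝ) = 1 := by
      rw [← Int.cast_mul, Int.units_coe_mul_self]
      simp
    have e7 : ψ (fun i => Sum.elim w (fun a => -v a)
        ((Equiv.arrowCongr σ (Equiv.refl (Fin n ⊕ Fin n))) s i)) =
        ((Equiv.Perm.sign σ : ℤ) : ℝ) * ψ fun i => Sum.elim w (fun a => -v a) (s i) := e5
    rw [e7]
    simp only [Equiv.arrowCongr_apply, Function.comp_apply, Equiv.symm_apply_apply,
      Equiv.refl_apply]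
    linear_combination ((∏ i, α i (Sum.elim v w (s i))) *
      ψ (fun i => Sum.elim w (fun a => -v a) (s i))) * e6
  rw [Finset.sum_congr rfl fun σ _ => e3 σ]
  simp [Fintype.card_perm]

variable {N : Type*} [NormedAddCommGroup N] [NormedSpace ℝ N] [FiniteDimensional ℝ N]
  {Ω : N [⋀^Fin 2]→L[ℝ] ℝ} {n : ℕ}

/-- In the frame, the vector attached to a covector `α i` is its sharp with the opposite sign,
whence the factor `(-1)^k`. The right-hand side no longer mentions the frame. -/
theorem framePairing_eq (hΩ : Nondeg Ω) {v w : Fin n → N} (hf : IsSymplecticFrame Ω v w) {k : ℕ}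
    (α : Fin k → N →L[ℝ] ℝ) (ψ : N [⋀^Fin k]→L[ℝ] ℝ) :
    framePairing v w (wedgeOneForms α) ψ = (-1) ^ k * ψ fun i => sharpL Ω (α i) := by
  have : (fun i => ∑ t, α i (Sum.elim v w t) • Sum.elim w (fun a => -v a) t) =
      fun i => (-1 : ℝ) • sharpL Ω (α i) := by
    funext i
    rw [← hΩ.expand hf (sharpL Ω (α i)), Fintype.sum_sum_type, ← Finset.sum_add_distrib,
      Finset.smul_sum]
    refine Finset.sum_congr rfl fun a _ => ?_
    simp only [Sum.elim_inl, Sum.elim_inr, ← flat_apply, hΩ.flat_sharpL]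
    module
  rw [framePairing_wedgeOneForms_left, this]
  refine (ψ.toMultilinearMap.map_smul_univ (fun _ => (-1 : ℝ)) fun i => sharpL Ω (α i)).trans ?_
  simp

/-- The pairing in a frame as a linear form in the first variable. -/
def framePairingLin (v w : Fin n → N) {k : ℕ} (ψ : N [⋀^Fin k]→L[ℝ] ℝ) :
    (N [⋀^Fin k]→L[ℝ] ℝ) →ₗ[ℝ] ℝ where
  toFun φ := framePairing v w φ ψ
  map_add' φ φ' := by
    simp only [framePairing, ContinuousAlternatingMap.add_apply, add_mul, Finset.sum_add_distrib,
      mul_add]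
  map_smul' c φ := by
    simp only [framePairing, ContinuousAlternatingMap.smul_apply, smul_eq_mul, mul_assoc,
      ← Finset.mul_sum, RingHom.id_apply]
    ring

theorem framePairing_frame_indep (hΩ : Nondeg Ω) {v w v' w' : Fin n → N}
    (hf : IsSymplecticFrame Ω v w) (hf' : IsSymplecticFrame Ω v' w') {k : ℕ}
    (φ ψ : N [⋀^Fin k]→L[ℝ] ℝ) : framePairing v w φ ψ = framePairing v' w' φ ψ := by
  have : framePairingLin v w ψ = framePairingLin v' w' ψ :=
    linearMap_ext_wedgeOneForms fun α =>
      (framePairing_eq hΩ hf α ψ).trans (framePairing_eq hΩ hf' α ψ).symm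
  exact LinearMap.congr_fun this φ

/-- The value is the same in all symplectic frames, so the frame selected by choice in the
definition may be replaced by any given one. -/
theorem pairing_eq (hΩ : Nondeg Ω) {v w : Fin n → N} (hf : IsSymplecticFrame Ω v w) {k : ℕ}
    (φ ψ : N [⋀^Fin k]→L[ℝ] ℝ) : pairing Ω n φ ψ = framePairing v w φ ψ := by
  have h : ∃ e : (Fin n → N) × (Fin n → N), IsSymplecticFrame Ω e.1 e.2 := ⟨(v, w), hf⟩
  rw [pairing, dif_pos h]
  exact framePairing_frame_indep hΩ h.choose_spec hf φ ψ

end Pairing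

/-! ### Perfect duality of complementary degrees and the star operator. -/

section Star

variable {N : Type*} [NormedAddCommGroup N] [NormedSpace ℝ N]

theorem IsHom.chain {φ : Forms N} {l k : ℕ} (h : IsHom φ l) (α : Fin k → N →L[ℝ] ℝ) :
    IsHom (TransSymp.chain α φ) (l + k) := by
  induction k with
  | zero => exact h
  | succ k ih => exact (ih (Fin.tail α)).E (α 0)

theorem E_single {k : ℕ} (a : N →L[ℝ] ℝ) (φ : N [⋀^Fin k]→L[ℝ] ℝ) :
    E a (Forms.single k φ) = Forms.single (k + 1) (ext a φ) :=
  ((isHom_single φ).E a).ext (isHom_single _) (by simp)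

theorem I_single {k : ℕ} (X : N) (φ : N [⋀^Fin (k + 1)]→L[ℝ] ℝ) :
    I X (Forms.single (k + 1) φ) = Forms.single k (interior X φ) :=
  ((isHom_single φ).I X).ext (isHom_single _) (by simp)

theorem isTransverse_of_ker {Ω : N [⋀^Fin 2]→L[ℝ] ℝ} (h : ∀ X ∈ formKer Ω, X = 0) {k : ℕ}
    (φ : N [⋀^Fin k]→L[ℝ] ℝ) : IsTransverse Ω φ := by
  rintro X ⟨i, hi⟩
  exact φ.map_coord_zero i (h _ hi)

variable (N) in
/-- The constant function `1`. -/
def oneForm : N [⋀^Fin 0]→L[ℝ] ℝ := ContinuousAlternatingMap.constOfIsEmpty ℝ N (Fin 0) (1 : ℝ)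

theorem eq_smul_oneForm (φ : N [⋀^Fin 0]→L[ℝ] ℝ) : φ = φ 0 • oneForm N := by
  ext v
  rw [Subsingleton.elim v 0]
  simp [oneForm]

variable [FiniteDimensional ℝ N] {Ω : N [⋀^Fin 2]→L[ℝ] ℝ} {n : ℕ}

theorem Nondeg.isTransverse (hΩ : Nondeg Ω) {k : ℕ} (φ : N [⋀^Fin k]→L[ℝ] ℝ) :
    IsTransverse Ω φ := isTransverse_of_ker (fun _ => hΩ.eq_zero_of_mem) φ

/-- The sum of `i(b_t) ∘ (b^t ∧)` over a basis equals `2n` minus the Euler operator, so it acts on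
degree `l` by the nonzero scalar `2n - l`. -/
theorem eq_zero_of_E (hn : Module.finrank ℝ N = 2 * n) {φ : Forms N} {l : ℕ} (hφ : IsHom φ l)
    (hl : l < 2 * n) (h : ∀ a, E a φ = 0) : φ = 0 := by
  let b := Module.finBasis ℝ N
  have h1 : ∑ t, (I (b t) * E (coordL b t)) φ = 0 :=
    Finset.sum_eq_zero fun t _ => by rw [Module.End.mul_apply, h, map_zero]
  have h2 : ∑ t, (I (b t) * E (coordL b t)) φ =
      ((2 * n : ℕ) : ℝ) • φ - (∑ t, E (coordL b t) * I (b t)) φ := by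
    rw [LinearMap.sum_apply, eq_sub_iff_add_eq, ← Finset.sum_add_distrib]
    have : ∀ t, (I (b t) * E (coordL b t)) φ + (E (coordL b t) * I (b t)) φ = φ := by
      intro t
      rw [I_mul_E, LinearMap.sub_apply, sub_add_cancel, coordL_apply, Module.Basis.repr_self,
        Finsupp.single_eq_same, one_smul, Module.End.one_apply]
    rw [Finset.sum_congr rfl fun t _ => this t]
    simp [hn, ← Nat.cast_smul_eq_nsmul ℝ]
  rw [h1] at h2
  have h3 : ((2 * n : ℕ) - l : ℝ) • φ = 0 := by
    refine Eq.trans ?_ h2.symm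
    rw [sub_smul]
    congr 1
    ext1 j
    rw [sum_E_I (sum_coordL b), Forms.deg_smul]
    by_cases hj : j = l
    · rw [hj]
    · rw [hφ j hj, smul_zero, smul_zero]
  refine (smul_eq_zero.1 h3).resolve_left (sub_ne_zero.2 ?_)
  exact_mod_cast hl.ne'

/-- The exterior product is a perfect pairing in complementary degrees. -/
theorem eq_zero_of_chain (hn : Module.finrank ℝ N = 2 * n) {k : ℕ} :
    ∀ {l : ℕ} {φ : Forms N}, IsHom φ l → k + l = 2 * n →
      (∀ α : Fin k → N →L[ℝ] ℝ, chain α φ = 0) → φ = 0 := by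
  induction k with
  | zero => exact fun _ _ h => h 0
  | succ k ih =>
    intro l φ hφ hkl h
    -- Products of `k` covectors kill `a ∧ φ` because, up to sign, `a` can be moved to the front to
    -- form a product of `k + 1` covectors.
    refine eq_zero_of_E hn hφ (by omega) fun a => ih (hφ.E a) (by omega) fun α => ?_
    rw [← Module.End.mul_apply, chain_mul_E, LinearMap.smul_apply]
    exact (congrArg _ (h (Fin.cons a α))).trans (smul_zero _)

theorem form_eq_zero_of_lt (hn : Module.finrank ℝ N = 2 * n) {k : ℕ} (hk : 2 * n < k)
    (φ : N [⋀^Fin k]→L[ℝ] ℝ) : φ = 0 := by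
  ext v
  refine φ.toAlternatingMap.map_linearDependent v fun h => ?_
  have := h.fintype_card_le_finrank
  rw [hn, Fintype.card_fin] at this
  omega

omit [FiniteDimensional ℝ N] in
theorem Lf_pow_one (Ω : N [⋀^Fin 2]→L[ℝ] ℝ) (n : ℕ) :
    (Lf Ω ^ n) (Forms.single 0 (oneForm N)) =
      (n.factorial : ℝ) • Forms.single (2 * n) (transVol Ω n) := by
  have hfac : (n.factorial : ℝ) ≠ 0 := Nat.cast_ne_zero.mpr (Nat.factorial_ne_zero n)
  have h0 : IsHom ((Lf Ω ^ n) (Forms.single 0 (oneForm N))) (2 * n) := by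
    have := (isHom_single (oneForm N)).Lf_pow Ω n
    rwa [Nat.zero_add] at this
  refine h0.ext ((isHom_single _).smul _) ?_
  rw [Forms.deg_smul, Forms.single_deg, transVol, smul_smul, mul_inv_cancel₀ hfac, one_smul]
  refine (castDeg_family (Forms.deg _) (Nat.zero_add (2 * n))).symm.trans (congrArg _ ?_)
  exact (Lf_pow_apply Ω _ 0 n).trans (by rw [Forms.single_deg]; rfl)

/-- Up to a factorial the volume form is `L^n` applied to the constant `1`, and `L^n` is injective
on functions. -/
theorem transVol_ne_zero (hn : Module.finrank ℝ N = 2 * n) (hΩ : Nondeg Ω) :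
    transVol Ω n ≠ 0 := by
  intro h
  obtain ⟨v, w, hf⟩ := exists_isSymplecticFrame hn hΩ
  have h1 := Lf_pow_one Ω n
  rw [h, map_zero, smul_zero] at h1
  have h2 := eq_zero_of_Lf_pow hΩ hf 0 (isHom_single (oneForm N)) n (by omega) h1
  have h3 := congrArg (fun φ : Forms N => φ.deg 0 0) h2
  simp [oneForm] at h3

/-- Top degree forms are multiples of the volume form. -/
theorem exists_coeff (hn : Module.finrank ℝ N = 2 * n) (hΩ : Nondeg Ω) :
    ∃ c : (N [⋀^Fin (2 * n)]→L[ℝ] ℝ) →ₗ[ℝ] ℝ, ∀ ξ, ξ = c ξ • transVol Ω n := by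
  let b := Module.finBasisOfFinrankEq ℝ N hn
  have h : ∀ (ξ : N [⋀^Fin (2 * n)]→L[ℝ] ℝ) v, ξ v = ξ b * b.det v := fun ξ v =>
    DFunLike.congr_fun (ξ.toAlternatingMap.eq_smul_basis_det b) v
  have h0 : transVol Ω n b ≠ 0 := by
    intro h1
    refine transVol_ne_zero hn hΩ ?_
    ext v
    rw [h, h1, zero_mul]
    rfl
  refine ⟨{ toFun := fun ξ => ξ b / transVol Ω n b
            map_add' := fun ξ ξ' => add_div _ _ _
            map_smul' := fun c ξ => mul_div_assoc _ _ _ }, fun ξ => ?_⟩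
  ext v
  change ξ v = ξ b / transVol Ω n b * transVol Ω n v
  rw [h ξ, h (transVol Ω n) v, ← mul_assoc, div_mul_cancel₀ _ h0]

theorem chain_single {k l : ℕ} (hkl : k + l = 2 * n) (α : Fin k → N →L[ℝ] ℝ)
    (η : N [⋀^Fin l]→L[ℝ] ℝ) : chain α (Forms.single l η) =
      Forms.single (2 * n) (castDeg hkl (wedge (wedgeOneForms α) η)) := by
  have h0 : IsHom (chain α (Forms.single l η)) (2 * n) := by
    have := (isHom_single η).chain α
    rwa [Nat.add_comm, hkl] at this
  refine h0.ext (isHom_single _) ?_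
  rw [Forms.single_deg]
  refine (castDeg_family (Forms.deg _) hkl).symm.trans (congrArg _ ?_)
  exact (chain_apply α _ l).trans (by rw [Forms.single_deg])

/-- The map `η ↦ (φ ↦ φ ∧ η)` into top degree, followed by a linear form. -/
def wedgeDual {k l : ℕ} (hkl : k + l = 2 * n) (c : (N [⋀^Fin (2 * n)]→L[ℝ] ℝ) →ₗ[ℝ] ℝ) :
    (N [⋀^Fin l]→L[ℝ] ℝ) →ₗ[ℝ] Module.Dual ℝ (N [⋀^Fin k]→L[ℝ] ℝ) :=
  (wedgeLin k l).flip.compr₂ (c ∘ₗ castDegLin hkl)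

theorem wedgeDual_injective (hn : Module.finrank ℝ N = 2 * n)
    {c : (N [⋀^Fin (2 * n)]→L[ℝ] ℝ) →ₗ[ℝ] ℝ} (hc : ∀ ξ, ξ = c ξ • transVol Ω n) {k l : ℕ}
    (hkl : k + l = 2 * n) : Function.Injective (wedgeDual (N := N) hkl c) := by
  rw [injective_iff_map_eq_zero]
  intro η hη
  have : Forms.single l η = 0 := eq_zero_of_chain hn (isHom_single η) hkl fun α => by
    rw [chain_single hkl, hc (castDeg hkl _)]
    have : c (castDeg hkl (wedge (wedgeOneForms α) η)) = 0 :=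
      LinearMap.congr_fun hη (wedgeOneForms α)
    rw [this, zero_smul, map_zero]
  rw [← Forms.single_deg l η, this, Forms.deg_zero]

/-- The wedge pairing embeds each of the two spaces into the dual of the other. -/
theorem finrank_forms_eq (hn : Module.finrank ℝ N = 2 * n) (hΩ : Nondeg Ω) {k l : ℕ}
    (hkl : k + l = 2 * n) :
    Module.finrank ℝ (N [⋀^Fin l]→L[ℝ] ℝ) = Module.finrank ℝ (N [⋀^Fin k]→L[ℝ] ℝ) := by
  obtain ⟨c, hc⟩ := exists_coeff hn hΩ
  refine le_antisymm ?_ ?_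
  · rw [← Subspace.dual_finrank_eq (V := N [⋀^Fin k]→L[ℝ] ℝ)]
    exact LinearMap.finrank_le_finrank_of_injective (wedgeDual_injective hn hc hkl)
  · rw [← Subspace.dual_finrank_eq (V := N [⋀^Fin l]→L[ℝ] ℝ)]
    exact LinearMap.finrank_le_finrank_of_injective
      (wedgeDual_injective hn hc ((Nat.add_comm l k).trans hkl))

/-- The map `wedgeDual` is injective between spaces of equal dimension, so the functional given by
pairing with `ψ` is attained. -/
theorem star_exists (hn : Module.finrank ℝ N = 2 * n) (hΩ : Nondeg Ω) {k l : ℕ}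
    (hkl : k + l = 2 * n) (ψ : N [⋀^Fin k]→L[ℝ] ℝ) :
    ∃ η : N [⋀^Fin l]→L[ℝ] ℝ, IsTransverse Ω η ∧
      ∀ φ : N [⋀^Fin k]→L[ℝ] ℝ, IsTransverse Ω φ →
        castDeg hkl (wedge φ η) = pairing Ω n φ ψ • transVol Ω n := by
  obtain ⟨c, hc⟩ := exists_coeff hn hΩ
  obtain ⟨v, w, hf⟩ := exists_isSymplecticFrame hn hΩ
  have hsurj : Function.Surjective (wedgeDual (N := N) hkl c) :=
    (LinearMap.injective_iff_surjective_of_finrank_eq_finrank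
      ((finrank_forms_eq hn hΩ hkl).trans (Subspace.dual_finrank_eq (K := ℝ)).symm)).1
      (wedgeDual_injective hn hc hkl)
  obtain ⟨η, hη⟩ := hsurj (framePairingLin v w ψ)
  refine ⟨η, hΩ.isTransverse η, fun φ _ => ?_⟩
  rw [pairing_eq hΩ hf, hc (castDeg hkl _)]
  congr 1
  exact LinearMap.congr_fun hη φ

theorem castDeg_wedge_star (hn : Module.finrank ℝ N = 2 * n) (hΩ : Nondeg Ω) {k l : ℕ}
    (hkl : k + l = 2 * n) (φ ψ : N [⋀^Fin k]→L[ℝ] ℝ) :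
    castDeg hkl (wedge φ (star Ω n hkl ψ)) = pairing Ω n φ ψ • transVol Ω n := by
  rw [star, dif_pos (star_exists hn hΩ hkl ψ)]
  exact (star_exists hn hΩ hkl ψ).choose_spec.2 φ (hΩ.isTransverse φ)

/-- The working description of the star: it tests against products of covectors only and contains no
frame. By `eq_star` these values determine the star, which is how it is recognized later. -/
theorem chain_star (hn : Module.finrank ℝ N = 2 * n) (hΩ : Nondeg Ω) {k l : ℕ}
    (hkl : k + l = 2 * n) (ψ : N [⋀^Fin k]→L[ℝ] ℝ) (α : Fin k → N →L[ℝ] ℝ) :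
    chain α (Forms.single l (star Ω n hkl ψ)) =
      ((-1) ^ k * ψ fun i => sharpL Ω (α i)) • Forms.single (2 * n) (transVol Ω n) := by
  obtain ⟨v, w, hf⟩ := exists_isSymplecticFrame hn hΩ
  rw [chain_single hkl, castDeg_wedge_star hn hΩ, pairing_eq hΩ hf, framePairing_eq hΩ hf,
    map_smul]

theorem eq_of_chain (hn : Module.finrank ℝ N = 2 * n) {k l : ℕ}
    (hkl : k + l = 2 * n) {η η' : N [⋀^Fin l]→L[ℝ] ℝ}
    (h : ∀ α : Fin k → N →L[ℝ] ℝ, chain α (Forms.single l η) = chain α (Forms.single l η')) :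
    η = η' := by
  have := eq_zero_of_chain hn (isHom_single (η - η')) hkl fun α => by
    rw [map_sub, map_sub, h, sub_self]
  rw [map_sub, sub_eq_zero] at this
  rw [← Forms.single_deg l η, this, Forms.single_deg]

theorem eq_star (hn : Module.finrank ℝ N = 2 * n) (hΩ : Nondeg Ω) {k l : ℕ}
    (hkl : k + l = 2 * n) {ψ : N [⋀^Fin k]→L[ℝ] ℝ} {η : N [⋀^Fin l]→L[ℝ] ℝ}
    (h : ∀ α : Fin k → N →L[ℝ] ℝ, chain α (Forms.single l η) =
      ((-1) ^ k * ψ fun i => sharpL Ω (α i)) • Forms.single (2 * n) (transVol Ω n)) :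
    η = star Ω n hkl ψ :=
  eq_of_chain hn hkl fun α => by rw [h, chain_star hn hΩ]

/-- The star operator as a linear map. -/
def starLin (hn : Module.finrank ℝ N = 2 * n) (hΩ : Nondeg Ω) {k l : ℕ}
    (hkl : k + l = 2 * n) : (N [⋀^Fin k]→L[ℝ] ℝ) →ₗ[ℝ] (N [⋀^Fin l]→L[ℝ] ℝ) where
  toFun := star Ω n hkl
  map_add' φ ψ := (eq_star hn hΩ hkl fun α => by
    rw [map_add, map_add, chain_star hn hΩ, chain_star hn hΩ, ContinuousAlternatingMap.add_apply,
      mul_add, add_smul]).symm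
  map_smul' c φ := (eq_star hn hΩ hkl fun α => by
    rw [map_smul, map_smul, chain_star hn hΩ, ContinuousAlternatingMap.smul_apply,
      smul_smul, smul_eq_mul]
    congr 1
    simp only [RingHom.id_apply]
    ring).symm

@[simp] theorem starLin_apply (hn : Module.finrank ℝ N = 2 * n) (hΩ : Nondeg Ω) {k l : ℕ}
    (hkl : k + l = 2 * n) (φ : N [⋀^Fin k]→L[ℝ] ℝ) :
    starLin hn hΩ hkl φ = star Ω n hkl φ := rfl

end Star

/-! ### How the star exchanges exterior and interior multiplication, and why it is an involution. -/

section StarIdentities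

variable {N : Type*} [NormedAddCommGroup N] [NormedSpace ℝ N] [FiniteDimensional ℝ N]
  {Ω : N [⋀^Fin 2]→L[ℝ] ℝ} {n : ℕ}

theorem neg_one_pow_mul_self (k : ℕ) : (-1 : ℝ) ^ k * (-1 : ℝ) ^ k = 1 := by
  rw [← mul_pow]; simp

theorem eq_of_ext (hn : Module.finrank ℝ N = 2 * n) {l : ℕ} (hl : l < 2 * n)
    {η η' : N [⋀^Fin l]→L[ℝ] ℝ} (h : ∀ a, ext a η = ext a η') : η = η' := by
  have := eq_zero_of_E hn (isHom_single (η - η')) hl fun a => by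
    rw [E_single, ← extLin_apply, map_sub, extLin_apply, extLin_apply, h, sub_self, map_zero]
  rw [map_sub, sub_eq_zero] at this
  rw [← Forms.single_deg l η, this, Forms.single_deg]

omit [FiniteDimensional ℝ N] in
theorem eq_of_interior {k : ℕ} {η η' : N [⋀^Fin (k + 1)]→L[ℝ] ℝ}
    (h : ∀ X, interior X η = interior X η') : η = η' := by
  ext v
  have := congrArg (fun φ => φ (Fin.tail v)) (h (v 0))
  simpa only [interior_apply, Fin.cons_self_tail] using this

/-- `a ∧ ⋆ψ = (-1)^deg ψ ⋆ i(a^♯)ψ`. -/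
theorem ext_star (hn : Module.finrank ℝ N = 2 * n) (hΩ : Nondeg Ω) {k l : ℕ}
    (hkl : k + 1 + l = 2 * n) (hkl' : k + (l + 1) = 2 * n) (a : N →L[ℝ] ℝ)
    (ψ : N [⋀^Fin (k + 1)]→L[ℝ] ℝ) :
    ext a (star Ω n hkl ψ) = (-1 : ℝ) ^ (k + 1) • star Ω n hkl' (interior (sharpL Ω a) ψ) := by
  refine eq_of_chain hn hkl' fun α => ?_
  have h1 : chain α (E a (Forms.single l (star Ω n hkl ψ))) =
      (-1 : ℝ) ^ k • chain (Fin.cons a α) (Forms.single l (star Ω n hkl ψ)) := by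
    rw [← Module.End.mul_apply, chain_mul_E]
    rfl
  rw [← E_single, h1, chain_star hn hΩ hkl, map_smul, map_smul, chain_star hn hΩ hkl', smul_smul,
    smul_smul, interior_apply]
  congr 1
  have : (fun i => sharpL Ω ((Fin.cons a α : Fin (k + 1) → N →L[ℝ] ℝ) i)) =
      Fin.cons (sharpL Ω a) fun i => sharpL Ω (α i) := by
    funext i
    refine Fin.cases rfl (fun j => rfl) i
  rw [this]
  ring

/-- `⋆(a ∧ ψ) = (-1)^deg ψ i(a^♯) ⋆ψ`. -/
theorem star_ext (hn : Module.finrank ℝ N = 2 * n) (hΩ : Nondeg Ω) (a : N →L[ℝ] ℝ) {k : ℕ} :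
    ∀ {l : ℕ} (hkl : k + 1 + l = 2 * n) (hkl' : k + (l + 1) = 2 * n)
      (ψ : N [⋀^Fin k]→L[ℝ] ℝ), star Ω n hkl (ext a ψ) =
        (-1 : ℝ) ^ k • interior (sharpL Ω a) (star Ω n hkl' ψ) := by
  induction k with
  | zero =>
    intro l hkl hkl' ψ
    -- Below top degree a form is determined by its products with covectors. Here the product on the
    -- left is governed by `ext_star`, and the one on the right vanishes for degree reasons up to
    -- the antiderivation term.
    refine eq_of_ext hn (by omega) fun b => ?_
    have h0 : ext b (star Ω n hkl' ψ) = 0 := form_eq_zero_of_lt hn (by omega) _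
    have h1 := interior_ext (sharpL Ω a) b (star Ω n hkl' ψ)
    rw [h0, ← interiorLin_apply, map_zero, eq_comm, sub_eq_zero] at h1
    rw [ext_star hn hΩ hkl hkl', interior_ext_zero, ← starLin_apply hn hΩ, map_smul,
      starLin_apply, pow_zero, one_smul, ← h1, hΩ.apply_sharpL_swap a b]
    module
  | succ k ih =>
    intro l hkl hkl' ψ
    refine eq_of_ext hn (by omega) fun b => ?_
    have h1 := interior_ext (sharpL Ω a) b (star Ω n hkl' ψ)
    rw [ext_star hn hΩ hkl' (by omega), ← interiorLin_apply, map_smul, interiorLin_apply] at h1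
    have h2 := ih (l := l + 1) (by omega) (by omega) (interior (sharpL Ω b) ψ)
    have h3 : ext b ((-1 : ℝ) ^ (k + 1) • interior (sharpL Ω a) (star Ω n hkl' ψ)) =
        (-1 : ℝ) ^ (k + 1) • ext b (interior (sharpL Ω a) (star Ω n hkl' ψ)) :=
      map_smul (extLin _ b) _ _
    rw [ext_star hn hΩ hkl hkl', interior_ext, ← starLin_apply hn hΩ, map_sub, map_smul,
      starLin_apply, starLin_apply, h2, h3, ← sub_sub_cancel (b (sharpL Ω a) • star Ω n hkl' ψ)
        (ext b (interior (sharpL Ω a) (star Ω n hkl' ψ))), ← h1, hΩ.apply_sharpL_swap a b,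
      pow_succ (-1 : ℝ) (k + 1), pow_succ (-1 : ℝ) k]
    have := neg_one_pow_mul_self k
    module

/-- Both operators vanish on functions in degree zero and have the same commutator with every
contraction, so `end_eq_zero` identifies them. -/
theorem Lf_eq_frame (hΩ : Nondeg Ω) {v w : Fin n → N} (hf : IsSymplecticFrame Ω v w) :
    Lf Ω = -∑ a, E (flat Ω (w a)) * E (flat Ω (v a)) := by
  rw [eq_neg_iff_add_eq_zero]
  refine end_eq_zero (fun φ => ?_) fun X => ?_
  · rw [LinearMap.add_apply, Forms.deg_add, LinearMap.sum_apply, Forms.deg_sum]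
    simp
  · have h1 : E (flat Ω X) = ∑ a, (flat Ω X (w a) • E (flat Ω (v a)) -
        flat Ω X (v a) • E (flat Ω (w a))) := by
      conv_lhs => rw [← hΩ.expand hf X]
      simp only [map_sum, map_sub, map_smul, flat_apply Ω X]
    rw [mul_add, add_mul, I_mul_Lf, h1, add_assoc, Finset.mul_sum, Finset.sum_mul,
      ← Finset.sum_add_distrib]
    congr 1
    refine Finset.sum_congr rfl fun a _ => ?_
    rw [← mul_assoc, I_mul_E, sub_mul, mul_assoc _ (I X), I_mul_E, mul_sub, smul_mul_assoc,
      mul_smul_comm, one_mul, mul_one, flat_swap Ω X (w a), flat_swap Ω X (v a), ← mul_assoc]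
    module

/-- The star intertwines `L` with `Lam`: write `L` in a symplectic frame and apply `star_ext` twice.
The two degree signs differ by one step, which cancels the minus sign of `Lf_eq_frame`. -/
theorem star_lef (hn : Module.finrank ℝ N = 2 * n) (hΩ : Nondeg Ω) {v w : Fin n → N}
    (hf : IsSymplecticFrame Ω v w) {k l : ℕ} (hkl : k + 2 + l = 2 * n)
    (hkl' : k + (l + 2) = 2 * n) (ψ : N [⋀^Fin k]→L[ℝ] ℝ) :
    star Ω n hkl (lef Ω ψ) =
      (Lam v w (Forms.single (l + 2) (star Ω n hkl' ψ))).deg l := by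
  have h1 : lef Ω ψ = -∑ a, ext (flat Ω (w a)) (ext (flat Ω (v a)) ψ) := by
    have := congrArg (fun φ : Forms N => φ.deg (k + 2))
      (LinearMap.congr_fun (Lf_eq_frame hΩ hf) (Forms.single k ψ))
    simpa [LinearMap.neg_apply, LinearMap.sum_apply] using this
  have h2 : ∀ a, star Ω n hkl (ext (flat Ω (w a)) (ext (flat Ω (v a)) ψ)) =
      -interior (w a) (interior (v a) (star Ω n hkl' ψ)) := by
    intro a
    rw [star_ext hn hΩ _ hkl (by omega), star_ext hn hΩ _ (by omega) hkl', hΩ.sharpL_flat,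
      hΩ.sharpL_flat, ← interiorLin_apply (w a), map_smul, interiorLin_apply, smul_smul, pow_succ,
      mul_right_comm, neg_one_pow_mul_self, one_mul]
    module
  rw [h1, ← starLin_apply hn hΩ, map_neg, map_sum, Lam, LinearMap.sum_apply, Forms.deg_sum,
    ← Finset.sum_neg_distrib]
  refine Finset.sum_congr rfl fun a _ => ?_
  rw [starLin_apply, h2, neg_neg, Module.End.mul_apply, I_apply, I_apply, Forms.single_deg]

theorem star_lefPow_one (hn : Module.finrank ℝ N = 2 * n) (hΩ : Nondeg Ω) {v w : Fin n → N}
    (hf : IsSymplecticFrame Ω v w) (r : ℕ) : ∀ {l : ℕ} (hkl : 0 + 2 * r + l = 2 * n),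
    star Ω n hkl (lefPow Ω (oneForm N) r) =
      ((Lam v w ^ r) (Forms.single (2 * n) (transVol Ω n))).deg l := by
  induction r with
  | zero =>
    intro l hkl
    obtain rfl : l = 2 * n := by omega
    rw [pow_zero, Module.End.one_apply, Forms.single_deg]
    refine (eq_star hn hΩ hkl fun α => ?_).symm
    rw [pow_zero, one_mul]
    change Forms.single (2 * n) (transVol Ω n) = (1 : ℝ) • _
    rw [one_smul]
  | succ r ih =>
    intro l hkl
    have h1 := star_lef hn hΩ hf (k := 0 + 2 * r) hkl (by omega) (lefPow Ω (oneForm N) r)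
    refine h1.trans ?_
    rw [ih, pow_succ', Module.End.mul_apply, Lam, LinearMap.sum_apply, LinearMap.sum_apply,
      Forms.deg_sum, Forms.deg_sum]
    simp only [Module.End.mul_apply, I_apply, Forms.single_deg]

theorem Lam_pow_Lf_pow_one (hΩ : Nondeg Ω) {v w : Fin n → N}
    (hf : IsSymplecticFrame Ω v w) (r : ℕ) :
    (Lam v w ^ r) ((Lf Ω ^ r) (Forms.single 0 (oneForm N))) =
      (∏ i ∈ Finset.range r, (((i : ℝ) + 1) * (n - i))) • Forms.single 0 (oneForm N) := by
  induction r with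
  | zero => simp
  | succ r ih =>
    rw [pow_succ (Lam v w), Module.End.mul_apply, Lam_Lf_pow hΩ hf (isHom_single (oneForm N)),
      Lam_eq_zero (isHom_single (oneForm N)) (by omega), map_zero, zero_add, map_smul, ih,
      smul_smul, Finset.prod_range_succ, mul_comm]
    simp

theorem prod_range_factorial_sq (n : ℕ) :
    ∏ i ∈ Finset.range n, (((i : ℝ) + 1) * (n - i)) = (n.factorial : ℝ) * n.factorial := by
  have h1 : ∏ i ∈ Finset.range n, ((i : ℝ) + 1) = n.factorial := by
    rw [← Finset.prod_range_add_one_eq_factorial]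
    push_cast
    rfl
  rw [Finset.prod_mul_distrib, h1, ← h1, ← Finset.prod_range_reflect (fun i => (i : ℝ) + 1)]
  congr 1
  refine Finset.prod_congr rfl fun i hi => ?_
  have : i + 1 ≤ n := Finset.mem_range.1 hi
  rw [Nat.sub_sub, add_comm 1 i, Nat.cast_sub this]
  push_cast
  ring

/-- The star of `1` is the volume form `L^n 1 / n!`, whose star is `Lam^n ν / n!`. Since `Lam^n L^n
1` is `(n!)²` times `1`, the factorials cancel. -/
theorem star_star_oneForm (hn : Module.finrank ℝ N = 2 * n) (hΩ : Nondeg Ω)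
    (hkl : 0 + 2 * n = 2 * n) (hlk : 2 * n + 0 = 2 * n) :
    star Ω n hlk (star Ω n hkl (oneForm N)) = oneForm N := by
  obtain ⟨v, w, hf⟩ := exists_isSymplecticFrame hn hΩ
  have hfac : (n.factorial : ℝ) ≠ 0 := Nat.cast_ne_zero.mpr (Nat.factorial_ne_zero n)
  have h1 : star Ω n hkl (oneForm N) = transVol Ω n := by
    have := star_lefPow_one hn hΩ hf 0 (l := 2 * n) (by omega)
    simpa [lefPow] using this
  have h2 : star Ω n hlk (castDeg (Nat.zero_add (2 * n)) (lefPow Ω (oneForm N) n)) =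
      ((Lam v w ^ n) (Forms.single (2 * n) (transVol Ω n))).deg 0 := by
    rw [← star_lefPow_one hn hΩ hf n (l := 0) (by omega)]
    generalize lefPow Ω (oneForm N) n = ξ
    have : ∀ {m : ℕ} (h : m = 2 * n) (h' : m + 0 = 2 * n) (ξ : N [⋀^Fin m]→L[ℝ] ℝ),
        star Ω n hlk (castDeg h ξ) = star Ω n h' ξ := by
      intro m h h' ξ
      subst h
      rfl
    exact this _ _ ξ
  have h3 : (Lam v w ^ n) (Forms.single (2 * n) (transVol Ω n)) =
      (n.factorial : ℝ) • Forms.single 0 (oneForm N) := by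
    have h4 := Lam_pow_Lf_pow_one hΩ hf n
    rw [Lf_pow_one, map_smul, prod_range_factorial_sq, mul_smul] at h4
    exact smul_right_injective _ hfac h4
  rw [h1, transVol]
  change starLin hn hΩ hlk ((n.factorial : ℝ)⁻¹ •
    castDeg (Nat.zero_add (2 * n)) (lefPow Ω (oneForm N) n)) = _
  rw [map_smul, starLin_apply, h2, h3, Forms.deg_smul, Forms.single_deg, smul_smul,
    inv_mul_cancel₀ hfac, one_smul]

/-- The symplectic star operator is an involution. -/
theorem star_star (hn : Module.finrank ℝ N = 2 * n) (hΩ : Nondeg Ω) {k : ℕ} :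
    ∀ {l : ℕ} (hkl : k + l = 2 * n) (hlk : l + k = 2 * n) (ψ : N [⋀^Fin k]→L[ℝ] ℝ),
      star Ω n hlk (star Ω n hkl ψ) = ψ := by
  induction k with
  | zero =>
    intro l hkl hlk ψ
    obtain rfl : l = 2 * n := by omega
    have := star_star_oneForm hn hΩ hkl hlk
    rw [eq_smul_oneForm ψ, ← starLin_apply hn hΩ hkl, map_smul, ← starLin_apply hn hΩ hlk, map_smul,
      starLin_apply, starLin_apply, this]
  | succ k ih =>
    intro l hkl hlk ψ
    refine eq_of_interior fun X => ?_
    rw [← hΩ.sharpL_flat X]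
    set a := flat Ω X
    -- The form `⋆(a ∧ ⋆ψ)` is evaluated in two ways: by `star_ext`, which produces `i(a^♯) ⋆⋆ψ`,
    -- and by `ext_star` with the induction hypothesis, which produces `i(a^♯) ψ`. The signs agree
    -- because the complementary degrees add up to an even number.
    have h1 := star_ext hn hΩ a (k := l) (l := k) (by omega) hlk (star Ω n hkl ψ)
    rw [ext_star hn hΩ hkl (by omega), ← starLin_apply hn hΩ, map_smul, starLin_apply,
      ih (l := l + 1)] at h1
    have h2 := congrArg (fun x => (-1 : ℝ) ^ l • x) h1
    simp only [smul_smul, neg_one_pow_mul_self, one_smul] at h2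
    rw [← h2, ← pow_add, Even.neg_one_pow ⟨n, by omega⟩, one_smul]

/-- `⋆(a ∧ ⋆φ) = (-1)^deg φ i(a^♯)φ`. -/
theorem star_ext_star (hn : Module.finrank ℝ N = 2 * n) (hΩ : Nondeg Ω) {k l : ℕ}
    (hkl : k + 1 + l = 2 * n) (hlk : l + 1 + k = 2 * n) (a : N →L[ℝ] ℝ)
    (φ : N [⋀^Fin (k + 1)]→L[ℝ] ℝ) :
    star Ω n hlk (ext a (star Ω n hkl φ)) = (-1 : ℝ) ^ (k + 1) • interior (sharpL Ω a) φ := by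
  rw [ext_star hn hΩ hkl (by omega), ← starLin_apply hn hΩ, map_smul, starLin_apply,
    star_star hn hΩ]

end StarIdentities

/-! ### Hard Lefschetz in linear algebra and the symbol equations. -/

section Lefschetz

variable {N : Type*} [NormedAddCommGroup N] [NormedSpace ℝ N] [FiniteDimensional ℝ N]
  {Ω : N [⋀^Fin 2]→L[ℝ] ℝ} {n : ℕ}

/-- `L^r` as a linear map between two given degrees. -/
def lefPowLin (Ω : N [⋀^Fin 2]→L[ℝ] ℝ) {k l : ℕ} (r : ℕ) (h : k + 2 * r = l) :
    (N [⋀^Fin k]→L[ℝ] ℝ) →ₗ[ℝ] (N [⋀^Fin l]→L[ℝ] ℝ) where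
  toFun φ := castDeg h (lefPow Ω φ r)
  map_add' φ ψ := by
    have : ∀ φ : N [⋀^Fin k]→L[ℝ] ℝ, lefPow Ω φ r =
        ((Lf Ω ^ r) (Forms.single k φ)).deg (k + 2 * r) := fun φ => by
      rw [Lf_pow_apply, Forms.single_deg]
    rw [this, this, this, map_add, map_add, Forms.deg_add, ← castDegLin_apply, map_add]
    rfl
  map_smul' c φ := by
    have : ∀ φ : N [⋀^Fin k]→L[ℝ] ℝ, lefPow Ω φ r =
        ((Lf Ω ^ r) (Forms.single k φ)).deg (k + 2 * r) := fun φ => by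
      rw [Lf_pow_apply, Forms.single_deg]
    rw [this, this, map_smul, map_smul, Forms.deg_smul, ← castDegLin_apply, map_smul]
    rfl

omit [FiniteDimensional ℝ N] in
theorem single_lefPowLin {k l : ℕ} (r : ℕ) (h : k + 2 * r = l) (φ : N [⋀^Fin k]→L[ℝ] ℝ) :
    Forms.single l (lefPowLin Ω r h φ) = (Lf Ω ^ r) (Forms.single k φ) := by
  subst h
  refine (isHom_single _).ext ((isHom_single φ).Lf_pow Ω r) ?_
  rw [Lf_pow_apply, Forms.single_deg, Forms.single_deg]
  rfl

theorem lefPowLin_injective (hn : Module.finrank ℝ N = 2 * n) (hΩ : Nondeg Ω) {k l r : ℕ}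
    (h : k + 2 * r = l) (hk : k + r ≤ n) : Function.Injective (lefPowLin (N := N) Ω r h) := by
  rw [injective_iff_map_eq_zero]
  intro φ hφ
  obtain ⟨v, w, hf⟩ := exists_isSymplecticFrame hn hΩ
  have := eq_zero_of_Lf_pow hΩ hf k (isHom_single φ) r hk (by
    rw [← single_lefPowLin r h, hφ, map_zero])
  rw [← Forms.single_deg k φ, this, Forms.deg_zero]

/-- The hard Lefschetz theorem in linear algebra. -/
theorem lefPowLin_bijective (hn : Module.finrank ℝ N = 2 * n) (hΩ : Nondeg Ω) {k l r : ℕ}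
    (h : k + 2 * r = l) (hk : k + r = n) : Function.Bijective (lefPowLin (N := N) Ω r h) := by
  have hinj := lefPowLin_injective hn hΩ h hk.le
  exact ⟨hinj, (LinearMap.injective_iff_surjective_of_finrank_eq_finrank
    (finrank_forms_eq hn hΩ (by omega))).1 hinj⟩

/-- The symbol of the exterior derivative. -/
def altSymbol (T : N →ₗ[ℝ] Forms N) : Forms N :=
  ∑ t, E (coordL (Module.finBasis ℝ N) t) (T (Module.finBasis ℝ N t))

/-- The symbol of the symplectic codifferential. -/
def coSymbol (Ω : N [⋀^Fin 2]→L[ℝ] ℝ) (T : N →ₗ[ℝ] Forms N) : Forms N :=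
  ∑ t, I (sharpL Ω (coordL (Module.finBasis ℝ N) t)) (T (Module.finBasis ℝ N t))

theorem altSymbol_Lf_pow (T : N →ₗ[ℝ] Forms N) (r : ℕ) :
    altSymbol ((Lf Ω ^ r) ∘ₗ T) = (Lf Ω ^ r) (altSymbol T) := by
  rw [altSymbol, altSymbol, map_sum]
  refine Finset.sum_congr rfl fun t _ => ?_
  rw [LinearMap.comp_apply, ← Module.End.mul_apply, E_mul_Lf_pow, Module.End.mul_apply]

/-- The commutator of `i(a^♯)` with a power of `L` is a multiple of `a ∧`, because `flat` undoes the
sharp. Summing over the dual basis turns this into `altSymbol`: it is the identity `[δ, L] = d` on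
the level of symbols. -/
theorem coSymbol_Lf_pow (hΩ : Nondeg Ω) (T : N →ₗ[ℝ] Forms N) (r : ℕ) :
    coSymbol Ω ((Lf Ω ^ (r + 1)) ∘ₗ T) =
      (Lf Ω ^ (r + 1)) (coSymbol Ω T) + ((r : ℝ) + 1) • (Lf Ω ^ r) (altSymbol T) := by
  rw [altSymbol, coSymbol, coSymbol, map_sum, map_sum, Finset.smul_sum, ← Finset.sum_add_distrib]
  refine Finset.sum_congr rfl fun t _ => ?_
  rw [LinearMap.comp_apply, ← Module.End.mul_apply, I_mul_Lf_pow, hΩ.flat_sharpL]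
  rfl

/-- The equations `d = δ = 0` for symbols are preserved and reflected by `L^r`. -/
theorem symbols_Lf_pow_iff (hn : Module.finrank ℝ N = 2 * n) (hΩ : Nondeg Ω) {k r : ℕ}
    (hkr : k + r = n) {T : N →ₗ[ℝ] Forms N} (hT : ∀ X, IsHom (T X) k) :
    (altSymbol ((Lf Ω ^ r) ∘ₗ T) = 0 ∧ coSymbol Ω ((Lf Ω ^ r) ∘ₗ T) = 0) ↔
      (altSymbol T = 0 ∧ coSymbol Ω T = 0) := by
  obtain ⟨v, w, hf⟩ := exists_isSymplecticFrame hn hΩ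
  rcases r with _ | r
  · rw [pow_zero, Module.End.one_eq_id, LinearMap.id_comp]
  rw [altSymbol_Lf_pow, coSymbol_Lf_pow hΩ]
  refine ⟨fun ⟨h1, h2⟩ => ?_, fun ⟨h1, h2⟩ => by simp [h1, h2]⟩
  -- Multiplying the second equation by `L` turns its `altSymbol` term into a multiple of the first
  -- equation.
  have h3 : (Lf Ω ^ (r + 2)) (coSymbol Ω T) = 0 := by
    have := congrArg (Lf Ω) h2
    rw [map_zero, map_add, map_smul, ← Module.End.mul_apply (Lf Ω),
      ← Module.End.mul_apply (Lf Ω), ← pow_succ', ← pow_succ', h1, smul_zero, add_zero] at this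
    exact this
  -- The cosymbol has degree one less than the forms, so the exponent `r + 2` is exactly the largest
  -- for which injectivity holds; on functions there is nothing to contract.
  have h4 : coSymbol Ω T = 0 := by
    rcases k with _ | k
    · exact Finset.sum_eq_zero fun t _ => (hT _).I_eq_zero _
    · exact eq_zero_of_Lf_pow hΩ hf k (IsHom.sum fun t _ => (hT _).I _) (r + 2) (by omega) h3
  rw [h4, map_zero, zero_add, smul_eq_zero] at h2
  have hr : (r : ℝ) + 1 ≠ 0 := by positivity
  -- The other symbol has degree one higher, while only `L^r` has to be cancelled. This is again the
  -- borderline case of injectivity.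
  exact ⟨eq_zero_of_Lf_pow hΩ hf (k + 1) (IsHom.sum fun t _ => (hT _).E _) r (by omega)
    (h2.resolve_left hr), h4⟩

end Lefschetz

/-! ### Degenerate forms as pullbacks of nondegenerate ones. -/

section Pullback

variable {V : Type*} [AddCommGroup V] [Module ℝ V] [TopologicalSpace V]
  {N : Type*} [NormedAddCommGroup N] [NormedSpace ℝ N] {Ω : N [⋀^Fin 2]→L[ℝ] ℝ} {n : ℕ}
  {g : V →L[ℝ] N}

/-- A form which vanishes as soon as one argument lies in a subspace descends to the quotient. -/
theorem apply_eq_of_sub_mem {k : ℕ} {φ : V [⋀^Fin k]→L[ℝ] ℝ} {K : Submodule ℝ V}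
    (hφ : ∀ X : Fin k → V, (∃ i, X i ∈ K) → φ X = 0) {X Y : Fin k → V}
    (h : ∀ i, X i - Y i ∈ K) : φ X = φ Y := by
  classical
  -- Expand `φ (Y + (X - Y))` over subsets of the slots; every term with at least one slot `X - Y`
  -- vanishes.
  have h1 := φ.toAlternatingMap.toMultilinearMap.map_add_univ Y (X - Y)
  rw [add_sub_cancel, Finset.sum_eq_single Finset.univ] at h1
  · simpa using h1
  · intro s _ hs
    obtain ⟨i, hi⟩ : ∃ i, i ∉ s := by
      by_contra! h2
      exact hs (Finset.eq_univ_iff_forall.2 h2)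
    refine hφ _ ⟨i, ?_⟩
    rw [Finset.piecewise_eq_of_notMem _ _ _ hi]
    exact h i
  · simp

theorem comp_injective (hg : Function.Surjective g) {k : ℕ} {φ ψ : N [⋀^Fin k]→L[ℝ] ℝ}
    (h : φ.compContinuousLinearMap g = ψ.compContinuousLinearMap g) : φ = ψ := by
  ext v
  choose w hw using fun i => hg (v i)
  have := DFunLike.congr_fun h w
  obtain rfl : (fun i => g (w i)) = v := funext hw
  exact this

variable [FiniteDimensional ℝ N]

theorem mem_formKer_comp (hΩ : Nondeg Ω) (hg : Function.Surjective g) (X : V) :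
    X ∈ formKer (Ω.compContinuousLinearMap g) ↔ g X = 0 := by
  have h : ∀ Y, Ω.compContinuousLinearMap g ![X, Y] = Ω ![g X, g Y] := fun Y => by
    rw [ContinuousAlternatingMap.compContinuousLinearMap_apply]
    congr 1
    ext i
    fin_cases i <;> rfl
  constructor
  · intro hX
    refine hΩ.eq_zero_of_mem fun Y => ?_
    obtain ⟨Z, rfl⟩ := hg Y
    rw [← h]
    exact hX Z
  · intro hX Y
    rw [h, hX]
    exact Ω.map_coord_zero 0 rfl

theorem isTransverse_comp (hΩ : Nondeg Ω) (hg : Function.Surjective g) {k : ℕ}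
    (φ : N [⋀^Fin k]→L[ℝ] ℝ) :
    IsTransverse (Ω.compContinuousLinearMap g) (φ.compContinuousLinearMap g) := by
  rintro X ⟨i, hi⟩
  exact φ.map_coord_zero i ((mem_formKer_comp hΩ hg _).1 hi)

theorem isSymplecticFrame_comp_iff (hΩ : Nondeg Ω) (hg : Function.Surjective g)
    {v w : Fin n → V} : IsSymplecticFrame (Ω.compContinuousLinearMap g) v w ↔
      IsSymplecticFrame Ω (fun a => g (v a)) (fun a => g (w a)) := by
  have h : ∀ X Y, Ω.compContinuousLinearMap g ![X, Y] = Ω ![g X, g Y] := fun X Y => by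
    rw [ContinuousAlternatingMap.compContinuousLinearMap_apply]
    congr 1
    ext i
    fin_cases i <;> rfl
  constructor
  · intro hf
    refine ⟨fun a b => (h _ _).symm.trans (hf.vv a b), fun a b => (h _ _).symm.trans (hf.ww a b),
      fun a b => (h _ _).symm.trans (hf.vw a b), fun X => ?_⟩
    obtain ⟨X, rfl⟩ := hg X
    have := (mem_formKer_comp hΩ hg _).1 (hf.expand X)
    simp only [map_sub, map_sum, map_smul, h] at this
    rw [this]
    exact fun Y => Ω.map_coord_zero 0 rfl
  · intro hf
    refine ⟨fun a b => (h _ _).trans (hf.vv a b), fun a b => (h _ _).trans (hf.ww a b),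
      fun a b => (h _ _).trans (hf.vw a b), fun X => ?_⟩
    rw [mem_formKer_comp hΩ hg]
    simp only [map_sub, map_sum, map_smul, h]
    exact hΩ.eq_zero_of_mem (hf.expand (g X))

/-- Symplectic frames downstairs lift along the surjection and frames upstairs project, and the
frame sum sees only the projections. -/
theorem pairing_comp (hn : Module.finrank ℝ N = 2 * n) (hΩ : Nondeg Ω)
    (hg : Function.Surjective g) {k : ℕ} (φ ψ : N [⋀^Fin k]→L[ℝ] ℝ) :
    pairing (Ω.compContinuousLinearMap g) n (φ.compContinuousLinearMap g)
      (ψ.compContinuousLinearMap g) = pairing Ω n φ ψ := by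
  obtain ⟨v, w, hf⟩ := exists_isSymplecticFrame hn hΩ
  choose v' hv using fun a => hg (v a)
  choose w' hw using fun a => hg (w a)
  obtain rfl : (fun a => g (v' a)) = v := funext hv
  obtain rfl : (fun a => g (w' a)) = w := funext hw
  have h : ∃ e : (Fin n → V) × (Fin n → V),
      IsSymplecticFrame (Ω.compContinuousLinearMap g) e.1 e.2 :=
    ⟨(v', w'), (isSymplecticFrame_comp_iff hΩ hg).2 hf⟩
  rw [pairing, dif_pos h,
    pairing_eq hΩ ((isSymplecticFrame_comp_iff hΩ hg).1 h.choose_spec)]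
  refine congrArg _ (Finset.sum_congr rfl fun s _ => ?_)
  simp only [ContinuousAlternatingMap.compContinuousLinearMap_apply]
  congr 2 <;> ext i <;> rcases h : s i with a | a <;> simp [h]

variable [IsTopologicalAddGroup V] [ContinuousSMul ℝ V]

theorem exists_section (hg : Function.Surjective g) :
    ∃ j : N →L[ℝ] V, ∀ X, g (j X) = X := by
  obtain ⟨j, hj⟩ := g.toLinearMap.exists_rightInverse_of_surjective
    (LinearMap.range_eq_top.2 hg)
  exact ⟨LinearMap.toContinuousLinearMap j, fun X => LinearMap.congr_fun hj X⟩

theorem exists_eq_comp (hg : Function.Surjective g) {k : ℕ} {φ : V [⋀^Fin k]→L[ℝ] ℝ}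
    (hφ : ∀ X : Fin k → V, (∃ i, g (X i) = 0) → φ X = 0) :
    ∃ φ' : N [⋀^Fin k]→L[ℝ] ℝ, φ = φ'.compContinuousLinearMap g := by
  obtain ⟨j, hj⟩ := exists_section hg
  refine ⟨φ.compContinuousLinearMap j, ?_⟩
  ext X
  refine apply_eq_of_sub_mem (K := LinearMap.ker g.toLinearMap) (fun X hX => hφ X hX) fun i => ?_
  rw [LinearMap.mem_ker]
  change g (X i - j (g (X i))) = 0
  rw [map_sub, hj, sub_self]

theorem IsTransverse.exists_eq_comp (hΩ : Nondeg Ω) (hg : Function.Surjective g) {k : ℕ}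
    {φ : V [⋀^Fin k]→L[ℝ] ℝ} (hφ : IsTransverse (Ω.compContinuousLinearMap g) φ) :
    ∃ φ' : N [⋀^Fin k]→L[ℝ] ℝ, φ = φ'.compContinuousLinearMap g :=
  TransSymp.exists_eq_comp hg fun X ⟨i, hi⟩ => hφ X ⟨i, (mem_formKer_comp hΩ hg _).2 hi⟩

/-- A transverse form upstairs is the pullback of a unique form downstairs, so the equation defining
the star upstairs is the pullback of the one downstairs. This also makes the choice in `star`
irrelevant. -/
theorem star_comp (hn : Module.finrank ℝ N = 2 * n) (hΩ : Nondeg Ω)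
    (hg : Function.Surjective g) {k l : ℕ} (hkl : k + l = 2 * n) (ψ : N [⋀^Fin k]→L[ℝ] ℝ) :
    star (Ω.compContinuousLinearMap g) n hkl (ψ.compContinuousLinearMap g) =
      (star Ω n hkl ψ).compContinuousLinearMap g := by
  have h : ∃ η : V [⋀^Fin l]→L[ℝ] ℝ, IsTransverse (Ω.compContinuousLinearMap g) η ∧
      ∀ φ : V [⋀^Fin k]→L[ℝ] ℝ, IsTransverse (Ω.compContinuousLinearMap g) φ →
        castDeg hkl (wedge φ η) = pairing (Ω.compContinuousLinearMap g) n φ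
          (ψ.compContinuousLinearMap g) • transVol (Ω.compContinuousLinearMap g) n := by
    refine ⟨_, isTransverse_comp hΩ hg (star Ω n hkl ψ), fun φ hφ => ?_⟩
    obtain ⟨φ', rfl⟩ := hφ.exists_eq_comp hΩ hg
    rw [pairing_comp hn hΩ hg, ← compContinuousLinearMap_transVol,
      ← compContinuousLinearMap_wedge, ← compContinuousLinearMap_castDeg,
      castDeg_wedge_star hn hΩ]
    rfl
  rw [star, dif_pos h]
  obtain ⟨h1, h2⟩ := h.choose_spec
  obtain ⟨η', hη⟩ := h1.exists_eq_comp hΩ hg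
  rw [hη] at h2 ⊢
  congr 1
  refine eq_of_chain hn hkl fun α => ?_
  have h3 := h2 _ (isTransverse_comp hΩ hg (wedgeOneForms α))
  rw [pairing_comp hn hΩ hg, ← compContinuousLinearMap_transVol,
    ← compContinuousLinearMap_wedge, ← compContinuousLinearMap_castDeg] at h3
  rw [chain_single hkl, chain_single hkl, castDeg_wedge_star hn hΩ]
  exact congrArg _ (comp_injective hg h3)

end Pullback

/-! ### Smooth dependence of the algebraic operations on their arguments. -/

section FormCalculus

variable {Z : Type*} [NormedAddCommGroup Z] [NormedSpace ℝ Z] {z : Z} {m : WithTop ℕ∞}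

/-- Smoothness can be tested after an injective linear map of finite-dimensional spaces. -/
theorem contDiffAt_of_injective {A B : Type*} [NormedAddCommGroup A] [NormedSpace ℝ A]
    [FiniteDimensional ℝ A] [NormedAddCommGroup B] [NormedSpace ℝ B] [FiniteDimensional ℝ B]
    {L : A →ₗ[ℝ] B} (hL : Function.Injective L) {f : Z → A}
    (h : ContDiffAt ℝ m (fun y => L (f y)) z) : ContDiffAt ℝ m f z := by
  obtain ⟨q, hq⟩ := L.exists_leftInverse_of_injective (LinearMap.ker_eq_bot.2 hL)
  have := (LinearMap.toContinuousLinearMap q).contDiff.contDiffAt.comp z h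
  refine this.congr_of_eventuallyEq (Filter.Eventually.of_forall fun y => ?_)
  exact (LinearMap.congr_fun hq (f y)).symm

/-- Smoothness of the value of a linear map between finite-dimensional spaces. -/
theorem contDiffAt_linearMap {A B : Type*} [NormedAddCommGroup A] [NormedSpace ℝ A]
    [FiniteDimensional ℝ A] [NormedAddCommGroup B] [NormedSpace ℝ B]
    (L : A →ₗ[ℝ] B) {f : Z → A} (h : ContDiffAt ℝ m f z) :
    ContDiffAt ℝ m (fun y => L (f y)) z :=
  (LinearMap.toContinuousLinearMap L).contDiff.contDiffAt.comp z h

theorem contDiffAt_bilinearMap {A B C : Type*} [NormedAddCommGroup A] [NormedSpace ℝ A]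
    [FiniteDimensional ℝ A] [NormedAddCommGroup B] [NormedSpace ℝ B] [FiniteDimensional ℝ B]
    [NormedAddCommGroup C] [NormedSpace ℝ C] (L : A →ₗ[ℝ] B →ₗ[ℝ] C) {f : Z → A} {g : Z → B}
    (hf : ContDiffAt ℝ m f z) (hg : ContDiffAt ℝ m g z) :
    ContDiffAt ℝ m (fun y => L (f y) (g y)) z :=
  (contDiffAt_linearMap ((LinearMap.toContinuousLinearMap (𝕜 := ℝ) (E := B) (F' := C)).toLinearMap
    ∘ₗ L) hf).clm_apply hg

theorem contDiffAt_clm {A B : Type*} [NormedAddCommGroup A] [NormedSpace ℝ A]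
    [FiniteDimensional ℝ A] [NormedAddCommGroup B] [NormedSpace ℝ B] [FiniteDimensional ℝ B]
    {f : Z → A →L[ℝ] B} (h : ∀ a, ContDiffAt ℝ m (fun y => f y a) z) : ContDiffAt ℝ m f z := by
  let b := Module.finBasis ℝ A
  let L : (A →L[ℝ] B) →ₗ[ℝ] (Fin (Module.finrank ℝ A) → B) :=
    { toFun := fun T i => T (b i)
      map_add' := fun _ _ => rfl
      map_smul' := fun _ _ => rfl }
  refine contDiffAt_of_injective (L := L) (fun S T hST => ?_) (contDiffAt_pi.2 fun i => h (b i))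
  exact ContinuousLinearMap.coe_injective (b.ext fun i => congrFun hST i)

variable {N : Type*} [NormedAddCommGroup N] [NormedSpace ℝ N]

theorem form_ext_basis {ι : Type*} (b : Module.Basis ι ℝ N) {k : ℕ} {φ ψ : N [⋀^Fin k]→L[ℝ] ℝ}
    (h : ∀ s : Fin k → ι, φ (fun i => b (s i)) = ψ (fun i => b (s i))) : φ = ψ :=
  ContinuousAlternatingMap.toAlternatingMap_injective
    (Module.Basis.ext_alternating b fun s _ => h s)

variable [FiniteDimensional ℝ N]

theorem contDiffAt_form {k : ℕ} {f : Z → N [⋀^Fin k]→L[ℝ] ℝ}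
    (h : ∀ v, ContDiffAt ℝ m (fun y => f y v) z) : ContDiffAt ℝ m f z := by
  let b := Module.finBasis ℝ N
  let L : (N [⋀^Fin k]→L[ℝ] ℝ) →ₗ[ℝ] ((Fin k → Fin (Module.finrank ℝ N)) → ℝ) :=
    { toFun := fun φ s => φ fun i => b (s i)
      map_add' := fun _ _ => rfl
      map_smul' := fun _ _ => rfl }
  exact contDiffAt_of_injective (L := L) (fun φ ψ hφ => form_ext_basis b fun s => congrFun hφ s)
    (contDiffAt_pi.2 fun s => h _)

/-- Evaluation of a form as a linear map. -/
def evalLin {k : ℕ} (v : Fin k → N) : (N [⋀^Fin k]→L[ℝ] ℝ) →ₗ[ℝ] ℝ where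
  toFun φ := φ v
  map_add' _ _ := rfl
  map_smul' _ _ := rfl

/-- In a basis the value is a polynomial in the coefficients of the form and the coordinates of the
vectors. -/
theorem contDiffAt_eval {k : ℕ} {f : Z → N [⋀^Fin k]→L[ℝ] ℝ} {w : Fin k → Z → N}
    (hf : ContDiffAt ℝ m f z) (hw : ∀ i, ContDiffAt ℝ m (w i) z) :
    ContDiffAt ℝ m (fun y => f y fun i => w i y) z := by
  let b := Module.finBasis ℝ N
  have h : ∀ y, (f y fun i => w i y) = (k.factorial : ℝ)⁻¹ *
      ∑ s : Fin k → Fin (Module.finrank ℝ N), f y (fun i => b (s i)) *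
        ∑ σ : Equiv.Perm (Fin k), ((Equiv.Perm.sign σ : ℤ) : ℝ) *
          ∏ i, coordL b (s i) (w (σ i) y) := fun y => by
    conv_lhs => rw [eq_sum_wedgeOneForms b (f y)]
    rw [ContinuousAlternatingMap.smul_apply, ContinuousAlternatingMap.sum_apply, smul_eq_mul]
    simp only [ContinuousAlternatingMap.smul_apply, wedgeOneForms_apply, Matrix.det_apply',
      smul_eq_mul, Matrix.of_apply]
  refine ContDiffAt.congr_of_eventuallyEq ?_ (Filter.Eventually.of_forall h)
  refine contDiffAt_const.mul (ContDiffAt.sum fun s _ =>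
    (contDiffAt_linearMap (evalLin fun i => b (s i)) hf).mul (ContDiffAt.sum fun σ _ =>
      contDiffAt_const.mul (contDiffAt_prod fun i _ => ?_)))
  exact contDiffAt_linearMap (coordL b (s i)).toLinearMap (hw _)

theorem contDiffAt_comp {P : Type*} [NormedAddCommGroup P] [NormedSpace ℝ P]
    [FiniteDimensional ℝ P] {k : ℕ} {f : Z → N [⋀^Fin k]→L[ℝ] ℝ} {A : Z → P →L[ℝ] N}
    (hf : ContDiffAt ℝ m f z) (hA : ContDiffAt ℝ m A z) :
    ContDiffAt ℝ m (fun y => (f y).compContinuousLinearMap (A y)) z :=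
  contDiffAt_form fun v => contDiffAt_eval (w := fun i y => A y (v i)) hf
    fun _ => hA.clm_apply contDiffAt_const

theorem contDiffAt_lefPow {k : ℕ} {Ω : Z → N [⋀^Fin 2]→L[ℝ] ℝ} {φ : Z → N [⋀^Fin k]→L[ℝ] ℝ}
    (hΩ : ContDiffAt ℝ m Ω z) (hφ : ContDiffAt ℝ m φ z) (r : ℕ) :
    ContDiffAt ℝ m (fun y => lefPow (Ω y) (φ y) r) z := by
  induction r with
  | zero => exact hφ
  | succ r ih =>
    exact contDiffAt_linearMap (castDegLin _) (contDiffAt_bilinearMap (wedgeLin 2 _) hΩ ih)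

theorem contDiffAt_flat {Ω : Z → N [⋀^Fin 2]→L[ℝ] ℝ} (hΩ : ContDiffAt ℝ m Ω z) :
    ContDiffAt ℝ m (fun y => flat (Ω y)) z := by
  refine contDiffAt_clm fun X => contDiffAt_clm fun Y => ?_
  simp only [flat_apply]
  exact contDiffAt_linearMap (evalLin ![X, Y]) hΩ

theorem Nondeg.isInvertible {Ω : N [⋀^Fin 2]→L[ℝ] ℝ} (hΩ : Nondeg Ω) :
    (flat Ω).IsInvertible := hΩ.exists_equiv

theorem nondeg_of_isInvertible {Ω : N [⋀^Fin 2]→L[ℝ] ℝ} (h : (flat Ω).IsInvertible) :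
    Nondeg Ω := by
  obtain ⟨e, he⟩ := h
  intro X hX
  rw [← he] at hX
  exact e.map_eq_zero_iff.1 hX

/-- Nondegeneracy means invertibility of `flat`, which is an open condition and depends continuously
on the form. -/
theorem Nondeg.eventually {Ω : N [⋀^Fin 2]→L[ℝ] ℝ} (hΩ : Nondeg Ω) :
    ∀ᶠ Ω' in 𝓝 Ω, Nondeg Ω' := by
  have h1 : ContinuousAt (fun Ω' : N [⋀^Fin 2]→L[ℝ] ℝ => flat Ω') Ω :=
    (contDiffAt_flat (m := 0) contDiffAt_id).continuousAt
  obtain ⟨e, he⟩ := hΩ.exists_equiv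
  have h2 := e.nhds
  rw [he] at h2
  filter_upwards [h1.eventually_mem h2] with Ω' hΩ'
  exact nondeg_of_isInvertible hΩ'

theorem contDiffAt_sharpL {Ω : Z → N [⋀^Fin 2]→L[ℝ] ℝ} (hΩ : ContDiffAt ℝ m Ω z)
    (h : Nondeg (Ω z)) : ContDiffAt ℝ m (fun y => sharpL (Ω y)) z :=
  h.isInvertible.contDiffAt_map_inverse.comp z (contDiffAt_flat hΩ)

/-- Wedging with all products of basis covectors is an injective linear map, and on the star it
gives explicit smooth expressions in `Ω`, its inverse and `φ`. Thus smoothness can be read off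
without a smooth choice of frame. -/
theorem contDiffAt_star {n : ℕ} (hn : Module.finrank ℝ N = 2 * n) {k l : ℕ}
    (hkl : k + l = 2 * n) {Ω : Z → N [⋀^Fin 2]→L[ℝ] ℝ} {φ : Z → N [⋀^Fin k]→L[ℝ] ℝ}
    (hΩ : ContDiffAt ℝ m Ω z) (hφ : ContDiffAt ℝ m φ z) (h : Nondeg (Ω z)) :
    ContDiffAt ℝ m (fun y => star (Ω y) n hkl (φ y)) z := by
  let b := Module.finBasis ℝ N
  let L : (N [⋀^Fin l]→L[ℝ] ℝ) →ₗ[ℝ]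
      ((Fin k → Fin (Module.finrank ℝ N)) → N [⋀^Fin (2 * n)]→L[ℝ] ℝ) :=
    LinearMap.pi fun s => castDegLin hkl ∘ₗ wedgeLin k l (wedgeOneForms fun i => coordL b (s i))
  have hL : Function.Injective L := by
    intro η η' hη
    refine eq_of_chain hn hkl fun α => ?_
    rw [chain_single hkl, chain_single hkl]
    have h1 : castDegLin hkl ∘ₗ (wedgeLin k l).flip η =
        castDegLin hkl ∘ₗ (wedgeLin k l).flip η' := by
      refine LinearMap.ext fun θ => ?_
      rw [eq_sum_wedgeOneForms b θ, map_smul, map_smul, map_sum, map_sum]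
      refine congrArg _ (Finset.sum_congr rfl fun s _ => ?_)
      rw [map_smul, map_smul]
      exact congrArg _ (congrFun hη s)
    exact congrArg _ (LinearMap.congr_fun h1 (wedgeOneForms α))
  refine contDiffAt_of_injective hL (contDiffAt_pi.2 fun s => ?_)
  have h2 : ContDiffAt ℝ m (fun y => ((-1) ^ k * φ y fun i => sharpL (Ω y) (coordL b (s i))) •
      transVol (Ω y) n) z := by
    refine (contDiffAt_const.mul (contDiffAt_eval hφ fun i =>
      (contDiffAt_sharpL hΩ h).clm_apply contDiffAt_const)).smul ?_
    exact contDiffAt_linearMap ((n.factorial : ℝ)⁻¹ • castDegLin (V := N) (Nat.zero_add (2 * n)))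
      (contDiffAt_lefPow hΩ contDiffAt_const n)
  refine h2.congr_of_eventuallyEq ?_
  filter_upwards [hΩ.continuousAt.eventually h.eventually] with y hy
  obtain ⟨v, w, hf⟩ := exists_isSymplecticFrame hn hy
  change castDeg hkl (wedge _ _) = _
  rw [castDeg_wedge_star hn hy, pairing_eq hy hf, framePairing_eq hy hf]

end FormCalculus

/-! ### First-order operators as symbols at a point where the form is parallel. -/

section Symbols

variable {N : Type*} [NormedAddCommGroup N] [NormedSpace ℝ N] {n : ℕ}

/-- The covariant derivative `X ↦ ∂_X φ - c κ(X) φ` of a form at a point. -/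
def twistedDeriv {k : ℕ} (c : ℝ) (κ : N →L[ℝ] ℝ) (φ : N → N [⋀^Fin k]→L[ℝ] ℝ) (z : N) :
    N →ₗ[ℝ] Forms N :=
  Forms.single k ∘ₗ ((fderiv ℝ φ z).toLinearMap - c • κ.toLinearMap.smulRight (φ z))

theorem twistedDeriv_apply {k : ℕ} (c : ℝ) (κ : N →L[ℝ] ℝ) (φ : N → N [⋀^Fin k]→L[ℝ] ℝ)
    (z X : N) : twistedDeriv c κ φ z X =
      Forms.single k (fderiv ℝ φ z X - (c * κ X) • φ z) := by
  rw [mul_smul]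
  rfl

variable [FiniteDimensional ℝ N]

/-- The chain rule for an operation which is linear in its second argument, at a point where the
first argument is parallel. -/
theorem fderiv_of_parallel {Z A B C : Type*} [NormedAddCommGroup Z] [NormedSpace ℝ Z]
    [NormedAddCommGroup A] [NormedSpace ℝ A] [NormedAddCommGroup B] [NormedSpace ℝ B]
    [FiniteDimensional ℝ B] [NormedAddCommGroup C] [NormedSpace ℝ C] {G : A → B → C}
    {a : Z → A} {b : Z → B} {z : Z} {L : B →ₗ[ℝ] C}
    (hG : DifferentiableAt ℝ (fun q : A × B => G q.1 q.2) (a z, b z)) (hL : ∀ y, G (a z) y = L y)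
    (ha : HasFDerivAt a (0 : Z →L[ℝ] A) z) (hb : DifferentiableAt ℝ b z) (X : Z) :
    fderiv ℝ (fun y => G (a y) (b y)) z X = L (fderiv ℝ b z X) := by
  have h1 : HasFDerivAt (fun y => (a y, b y)) ((0 : Z →L[ℝ] A).prod (fderiv ℝ b z)) z :=
    ha.prodMk hb.hasFDerivAt
  have h2 := HasFDerivAt.comp (g := fun q : A × B => G q.1 q.2) z hG.hasFDerivAt h1
  have h3 : HasFDerivAt (fun y => (a z, y)) ((0 : B →L[ℝ] A).prod (.id ℝ B)) (b z) :=
    (hasFDerivAt_const _ _).prodMk (hasFDerivAt_id _)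
  have h4 := HasFDerivAt.comp (g := fun q : A × B => G q.1 q.2) (b z) hG.hasFDerivAt h3
  have h5 : HasFDerivAt (fun y => G (a z) y) (LinearMap.toContinuousLinearMap L) (b z) := by
    simp only [hL]
    exact (LinearMap.toContinuousLinearMap L).hasFDerivAt
  have h6 := DFunLike.congr_fun (h4.unique h5) (fderiv ℝ b z X)
  have h7 : fderiv ℝ (fun y => G (a y) (b y)) z = _ := h2.fderiv
  rw [h7]
  exact h6

/-- The star depends smoothly on `Ω` and linearly on the form; where the derivative of `Ω` vanishes,
only the linear dependence contributes. -/
theorem fderiv_star {Z : Type*} [NormedAddCommGroup Z] [NormedSpace ℝ Z]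
    (hn : Module.finrank ℝ N = 2 * n) {k l : ℕ} (hkl : k + l = 2 * n)
    {Ω : Z → N [⋀^Fin 2]→L[ℝ] ℝ} {φ : Z → N [⋀^Fin k]→L[ℝ] ℝ} {z : Z} (h : Nondeg (Ω z))
    (hΩ : HasFDerivAt Ω (0 : Z →L[ℝ] _) z) (hφ : DifferentiableAt ℝ φ z) (X : Z) :
    fderiv ℝ (fun y => star (Ω y) n hkl (φ y)) z X = star (Ω z) n hkl (fderiv ℝ φ z X) := by
  rw [fderiv_of_parallel (G := fun Ω φ => star Ω n hkl φ) (L := starLin hn h hkl) ?_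
    (fun _ => rfl) hΩ hφ, starLin_apply]
  have := contDiffAt_star (m := 1) hn hkl (z := (Ω z, φ z)) (Ω := Prod.fst) (φ := Prod.snd)
    contDiffAt_fst contDiffAt_snd h
  exact this.differentiableAt one_ne_zero

theorem contDiffAt_lefPowLin {Z : Type*} [NormedAddCommGroup Z] [NormedSpace ℝ Z] {k l r : ℕ}
    (h : k + 2 * r = l) {m : WithTop ℕ∞}
    {Ω : Z → N [⋀^Fin 2]→L[ℝ] ℝ} {φ : Z → N [⋀^Fin k]→L[ℝ] ℝ} {z : Z}
    (hΩ : ContDiffAt ℝ m Ω z) (hφ : ContDiffAt ℝ m φ z) :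
    ContDiffAt ℝ m (fun y => lefPowLin (Ω y) r h (φ y)) z :=
  contDiffAt_linearMap (castDegLin h) (contDiffAt_lefPow hΩ hφ r)

theorem fderiv_lefPowLin {Z : Type*} [NormedAddCommGroup Z] [NormedSpace ℝ Z] {k l r : ℕ}
    (h : k + 2 * r = l)
    {Ω : Z → N [⋀^Fin 2]→L[ℝ] ℝ} {φ : Z → N [⋀^Fin k]→L[ℝ] ℝ} {z : Z}
    (hΩ : HasFDerivAt Ω (0 : Z →L[ℝ] _) z) (hφ : DifferentiableAt ℝ φ z) (X : Z) :
    fderiv ℝ (fun y => lefPowLin (Ω y) r h (φ y)) z X =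
      lefPowLin (Ω z) r h (fderiv ℝ φ z X) :=
  fderiv_of_parallel (G := fun Ω φ => lefPowLin Ω r h φ)
    ((contDiffAt_lefPowLin (m := 1) h contDiffAt_fst contDiffAt_snd).differentiableAt one_ne_zero)
    (fun _ => rfl) hΩ hφ X

/-- The inverse of `L^r`. -/
def lefInv (Ω : N [⋀^Fin 2]→L[ℝ] ℝ) {k l : ℕ} (r : ℕ) (h : k + 2 * r = l) :
    (N [⋀^Fin l]→L[ℝ] ℝ) →L[ℝ] (N [⋀^Fin k]→L[ℝ] ℝ) :=
  (LinearMap.toContinuousLinearMap (lefPowLin Ω r h)).inverse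

theorem isInvertible_lefPowLin (hn : Module.finrank ℝ N = 2 * n) {Ω : N [⋀^Fin 2]→L[ℝ] ℝ}
    (hΩ : Nondeg Ω) {k l r : ℕ} (h : k + 2 * r = l) (hk : k + r = n) :
    (LinearMap.toContinuousLinearMap (lefPowLin Ω r h)).IsInvertible :=
  ⟨(LinearEquiv.ofBijective _ (lefPowLin_bijective hn hΩ h hk)).toContinuousLinearEquiv, rfl⟩

theorem lefPowLin_lefInv (hn : Module.finrank ℝ N = 2 * n) {Ω : N [⋀^Fin 2]→L[ℝ] ℝ}
    (hΩ : Nondeg Ω) {k l r : ℕ} (h : k + 2 * r = l) (hk : k + r = n) (ψ : N [⋀^Fin l]→L[ℝ] ℝ) :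
    lefPowLin Ω r h (lefInv Ω r h ψ) = ψ := by
  obtain ⟨e, he⟩ := isInvertible_lefPowLin hn hΩ h hk
  have h1 : ∀ φ, lefPowLin Ω r h φ = e φ := fun φ => by
    rw [← ContinuousLinearEquiv.coe_coe, he]; rfl
  rw [lefInv, ← he, ContinuousLinearMap.inverse_equiv, h1]
  exact e.apply_symm_apply ψ

theorem contDiffAt_lefInv {Z : Type*} [NormedAddCommGroup Z] [NormedSpace ℝ Z]
    (hn : Module.finrank ℝ N = 2 * n) {k l r : ℕ}
    (h : k + 2 * r = l) (hk : k + r = n) {m : WithTop ℕ∞}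
    {Ω : Z → N [⋀^Fin 2]→L[ℝ] ℝ} {ψ : Z → N [⋀^Fin l]→L[ℝ] ℝ} {z : Z}
    (hΩ : ContDiffAt ℝ m Ω z) (hψ : ContDiffAt ℝ m ψ z) (hz : Nondeg (Ω z)) :
    ContDiffAt ℝ m (fun y => lefInv (Ω y) r h (ψ y)) z := by
  refine ContDiffAt.clm_apply ?_ hψ
  refine ContDiffAt.comp (g := ContinuousLinearMap.inverse) z
    (isInvertible_lefPowLin hn hz h hk).contDiffAt_map_inverse ?_
  exact contDiffAt_clm fun φ => contDiffAt_lefPowLin h hΩ contDiffAt_const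

theorem extDeriv_eq_sum {k : ℕ} (φ : N → N [⋀^Fin k]→L[ℝ] ℝ) (z : N) :
    extDeriv φ z = ∑ t, ext (coordL (Module.finBasis ℝ N) t)
      (fderiv ℝ φ z (Module.finBasis ℝ N t)) := by
  have h : fderiv ℝ φ z = ∑ t, (coordL (Module.finBasis ℝ N) t).smulRight
      (fderiv ℝ φ z (Module.finBasis ℝ N t)) := by
    ext1 X
    conv_lhs => rw [← sum_coordL (Module.finBasis ℝ N) X, map_sum]
    rw [sum_apply]
    exact Finset.sum_congr rfl fun t _ => by rw [map_smul]; rfl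
  rw [extDeriv]
  conv_lhs => rw [h]
  exact map_sum (ContinuousAlternatingMap.alternatizeUncurryFinCLM ℝ N ℝ) _ _

theorem sum_coordL_smul (κ : N →L[ℝ] ℝ) :
    ∑ t, κ (Module.finBasis ℝ N t) • coordL (Module.finBasis ℝ N) t = κ := by
  ext X
  conv_rhs => rw [← sum_coordL (Module.finBasis ℝ N) X, map_sum]
  rw [sum_apply]
  exact Finset.sum_congr rfl fun t _ => by rw [map_smul, smul_eq_mul, mul_comm]; rfl

theorem altSymbol_twistedDeriv {k : ℕ} (c : ℝ) (κ : N →L[ℝ] ℝ) (φ : N → N [⋀^Fin k]→L[ℝ] ℝ)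
    (z : N) : altSymbol (twistedDeriv c κ φ z) =
      Forms.single (k + 1) (extDeriv φ z - c • ext κ (φ z)) := by
  have h : ext κ (φ z) = ∑ t, ext (coordL (Module.finBasis ℝ N) t)
      (κ (Module.finBasis ℝ N t) • φ z) := by
    conv_lhs => rw [← sum_coordL_smul κ, ← extLin_apply, map_sum, LinearMap.sum_apply]
    exact Finset.sum_congr rfl fun t _ => by
      rw [map_smul, LinearMap.smul_apply, ← extLin_apply, map_smul]
  rw [extDeriv_eq_sum, h, Finset.smul_sum, ← Finset.sum_sub_distrib, map_sum, altSymbol]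
  refine Finset.sum_congr rfl fun t _ => ?_
  rw [twistedDeriv_apply, E_single, mul_smul]
  congr 1
  rw [← extLin_apply, map_sub, map_smul]
  rfl

theorem coSymbol_twistedDeriv_zero (Ω : N [⋀^Fin 2]→L[ℝ] ℝ) (c : ℝ) (κ : N →L[ℝ] ℝ)
    (φ : N → N [⋀^Fin 0]→L[ℝ] ℝ) (z : N) : coSymbol Ω (twistedDeriv c κ φ z) = 0 :=
  Finset.sum_eq_zero fun _ _ => (isHom_single _).I_eq_zero _

/-- At a parallel point the outer star passes through the derivative, and `star_ext_star` turns each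
`e^t ∧` between two stars into a contraction. -/
theorem coSymbol_twistedDeriv (hn : Module.finrank ℝ N = 2 * n) {k l : ℕ}
    (hkl : k + 1 + l = 2 * n) (hlk : l + 1 + k = 2 * n) {Ω : N → N [⋀^Fin 2]→L[ℝ] ℝ}
    (κ : N →L[ℝ] ℝ) {φ : N → N [⋀^Fin (k + 1)]→L[ℝ] ℝ} {z : N} (h : Nondeg (Ω z))
    (hΩ : HasFDerivAt Ω (0 : N →L[ℝ] _) z) (hφ : DifferentiableAt ℝ φ z) :
    coSymbol (Ω z) (twistedDeriv (1 / 2) κ φ z) =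
      Forms.single k ((-1 : ℝ) ^ (k + 1) •
        star (Ω z) n hlk (extDeriv (fun y => star (Ω y) n hkl (φ y)) z -
          ext κ (star (Ω z) n hkl (φ z))) + (1 / 2 : ℝ) • interior (sharpL (Ω z) κ) (φ z)) := by
  have h1 : ∀ a ψ, interior (sharpL (Ω z) a) ψ =
      (-1 : ℝ) ^ (k + 1) • star (Ω z) n hlk (ext a (star (Ω z) n hkl ψ)) := fun a ψ => by
    rw [star_ext_star hn h, smul_smul, neg_one_pow_mul_self, one_smul]
  have h2 : star (Ω z) n hlk (ext κ (star (Ω z) n hkl (φ z))) =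
      (-1 : ℝ) ^ (k + 1) • interior (sharpL (Ω z) κ) (φ z) := star_ext_star hn h _ _ _ _
  have h3 : interior (sharpL (Ω z) κ) (φ z) = ∑ t, κ (Module.finBasis ℝ N t) •
      interior (sharpL (Ω z) (coordL (Module.finBasis ℝ N) t)) (φ z) := by
    conv_lhs => rw [← sum_coordL_smul κ, map_sum, ← interiorLin_apply, map_sum,
      LinearMap.sum_apply]
    exact Finset.sum_congr rfl fun t _ => by
      rw [map_smul, map_smul, LinearMap.smul_apply, interiorLin_apply]
  -- Here the coefficients combine: the star-conjugate of `κ ∧` subtracts one copy of `i(κ^♯)`, the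
  -- correction term returns half of it, and the remaining half is the twist that also occurs in
  -- `d_κ`.
  have hB : ∀ A B : N [⋀^Fin k]→L[ℝ] ℝ, A - B + (1 / 2 : ℝ) • B = A - (1 / 2 : ℝ) • B :=
    fun A B => by module
  have h4 : star (Ω z) n hlk (extDeriv (fun y => star (Ω y) n hkl (φ y)) z) =
      (-1 : ℝ) ^ (k + 1) • ∑ t, interior (sharpL (Ω z) (coordL (Module.finBasis ℝ N) t))
        (fderiv ℝ φ z (Module.finBasis ℝ N t)) := by
    rw [extDeriv_eq_sum, ← starLin_apply hn h, map_sum, Finset.smul_sum]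
    refine Finset.sum_congr rfl fun t _ => ?_
    rw [fderiv_star hn hkl h hΩ hφ, starLin_apply, star_ext_star hn h]
  rw [← starLin_apply hn h, map_sub, starLin_apply, starLin_apply, h2, h4, smul_sub, smul_smul,
    smul_smul, neg_one_pow_mul_self, one_smul, one_smul, hB, h3, Finset.smul_sum,
    ← Finset.sum_sub_distrib, map_sum, coSymbol]
  refine Finset.sum_congr rfl fun t _ => ?_
  rw [twistedDeriv_apply, I_single]
  congr 1
  rw [← interiorLin_apply, map_sub, map_smul, interiorLin_apply, interiorLin_apply, mul_smul]

theorem twistedDeriv_lefPowLin {k l r : ℕ} (h : k + 2 * r = l) {Ω : N → N [⋀^Fin 2]→L[ℝ] ℝ}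
    (c : ℝ) (κ : N →L[ℝ] ℝ) {φ : N → N [⋀^Fin k]→L[ℝ] ℝ} {z : N}
    (hΩ : HasFDerivAt Ω (0 : N →L[ℝ] _) z) (hφ : DifferentiableAt ℝ φ z) :
    twistedDeriv c κ (fun y => lefPowLin (Ω y) r h (φ y)) z =
      (Lf (Ω z) ^ r) ∘ₗ twistedDeriv c κ φ z := by
  refine LinearMap.ext fun X => ?_
  rw [LinearMap.comp_apply, twistedDeriv_apply, twistedDeriv_apply, ← single_lefPowLin r h,
    fderiv_lefPowLin h hΩ hφ]
  simp only [map_sub, map_smul]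

end Symbols

/-! ### First-order Darboux coordinates. -/

section AdaptedMap

variable {N : Type*} [NormedAddCommGroup N] [NormedSpace ℝ N] [FiniteDimensional ℝ N]

/-- `flat`, as a linear map of the two-form. -/
def flatLin (N : Type*) [NormedAddCommGroup N] [NormedSpace ℝ N] [FiniteDimensional ℝ N] :
    (N [⋀^Fin 2]→L[ℝ] ℝ) →ₗ[ℝ] N →L[ℝ] N →L[ℝ] ℝ where
  toFun := flat
  map_add' φ ψ := by ext X Y; simp [flat_apply]
  map_smul' c φ := by ext X Y; simp [flat_apply]

@[simp] theorem flatLin_apply (Ω : N [⋀^Fin 2]→L[ℝ] ℝ) : flatLin N Ω = flat Ω := rfl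

/-- A symmetric bilinear map which is the Christoffel symbol at a point of a torsion-free
connection preserving the form. -/
theorem exists_christoffel {Ω : N [⋀^Fin 2]→L[ℝ] ℝ} (hΩ : Nondeg Ω)
    (D : N →L[ℝ] N [⋀^Fin 2]→L[ℝ] ℝ) :
    ∃ Γ : N →L[ℝ] N →L[ℝ] N, (∀ X Y, Γ X Y = Γ Y X) ∧ ∀ X Y Z,
      flat Ω (Γ X Y) Z = -(1 / 3) * (flat (D X) Y Z + flat (D Y) X Z) := by
  let S : N →ₗ[ℝ] N →ₗ[ℝ] N := LinearMap.mk₂ ℝ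
    (fun X Y => sharpL Ω ((-(1 / 3 : ℝ)) • (flatLin N (D X) Y + flatLin N (D Y) X)))
    (fun X X' Y => by
      simp only [map_add, add_apply, map_smul]
      module)
    (fun c X Y => by
      simp only [map_add, map_smul, smul_apply]
      module)
    (fun X Y Y' => by
      simp only [map_add, add_apply, map_smul]
      module)
    (fun c X Y => by
      simp only [map_add, map_smul, smul_apply]
      module)
  refine ⟨LinearMap.toContinuousLinearMap ((LinearMap.toContinuousLinearMap (𝕜 := ℝ) (E := N)
    (F' := N)).toLinearMap ∘ₗ S), fun X Y => ?_, fun X Y Z => ?_⟩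
  · change sharpL Ω _ = sharpL Ω _
    rw [add_comm]
  · change flat Ω (sharpL Ω _) Z = _
    rw [hΩ.flat_sharpL]
    rfl

/-- A quadratic map whose second derivative is the Christoffel symbol of a torsion-free symplectic
connection cancels the first derivative of the form. Closedness is exactly the solvability
condition. -/
theorem exists_adapted_map {Ω : N → N [⋀^Fin 2]→L[ℝ] ℝ} {z : N} (hs : ContDiffAt ℝ 1 Ω z)
    (h : Nondeg (Ω z)) (hd : extDeriv Ω z = 0) :
    ∃ f : N → N, ContDiff ℝ ∞ f ∧ f 0 = z ∧ fderiv ℝ f 0 = .id ℝ N ∧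
      HasFDerivAt (fun y => (Ω (f y)).compContinuousLinearMap (fderiv ℝ f y))
        (0 : N →L[ℝ] _) 0 := by
  obtain ⟨Γ, hsymm, hΓ⟩ := exists_christoffel h (fderiv ℝ Ω z)
  -- The factor one half makes the derivative at `y` equal to the identity plus `Γ y`, because `Γ`
  -- is symmetric.
  let f : N → N := fun y => z + y + (1 / 2 : ℝ) • Γ y y
  have hfd : ∀ y, HasFDerivAt f (.id ℝ N + Γ y) y := fun y => by
    have h1 : HasFDerivAt (fun y => Γ y y) (Γ y ∘SL .id ℝ N + Γ.flip y) y :=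
      Γ.hasFDerivAt.clm_apply (hasFDerivAt_id y)
    have h2 := ((hasFDerivAt_id (𝕜 := ℝ) y).const_add z).add (h1.const_smul (1 / 2 : ℝ))
    refine h2.congr_fderiv ?_
    ext1 X
    change X + (1 / 2 : ℝ) • (Γ y X + Γ X y) = X + Γ y X
    rw [hsymm X y, ← two_smul ℝ, smul_smul]
    norm_num
  have hfd' : ∀ y, fderiv ℝ f y = .id ℝ N + Γ y := fun y => (hfd y).fderiv
  have hf0 : f 0 = z := by simp [f]
  have hf : ContDiff ℝ ∞ f := by
    have h1 : ContDiff ℝ ∞ fun y => Γ y y := Γ.contDiff.clm_apply contDiff_id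
    exact (contDiff_const.add contDiff_id).add (contDiff_const.smul h1)
  refine ⟨f, hf, hf0, by rw [hfd']; simp, ?_⟩
  have hsm : ContDiffAt ℝ 1 (fun y => (Ω (f y)).compContinuousLinearMap (fderiv ℝ f y)) 0 := by
    refine contDiffAt_comp ?_ ?_
    · rw [← hf0] at hs
      exact hs.comp 0 (hf.contDiffAt.of_le (by norm_cast))
    · rw [show fderiv ℝ f = fun y => .id ℝ N + Γ y from funext hfd']
      exact contDiffAt_const.add Γ.contDiff.contDiffAt
  have hdiff := hsm.differentiableAt one_ne_zero
  refine hdiff.hasFDerivAt.congr_fderiv (ContinuousLinearMap.ext fun X => ?_)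
  refine ContinuousAlternatingMap.ext fun v => ?_
  obtain ⟨U, W, rfl⟩ : ∃ U W, v = ![U, W] := ⟨v 0, v 1, by ext i; fin_cases i <;> rfl⟩
  set D := fderiv ℝ Ω z with hD
  have hline : HasDerivAt (fun t : ℝ => t • X) X 0 := by
    simpa using (hasDerivAt_id (0 : ℝ)).smul_const X
  have hO : HasDerivAt (fun t : ℝ => Ω (f (t • X))) (D X) 0 := by
    have h1 : HasDerivAt (fun t : ℝ => f (t • X)) X 0 := by
      have h2 := hfd 0
      rw [map_zero, add_zero] at h2
      exact HasFDerivAt.comp_hasDerivAt_of_eq (0 : ℝ) h2 hline (by simp)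
    have h3 : HasFDerivAt Ω D z := (hs.differentiableAt one_ne_zero).hasFDerivAt
    exact HasFDerivAt.comp_hasDerivAt_of_eq (0 : ℝ) h3 h1 (by simp [hf0])
  have hq : ∀ A B, HasDerivAt (fun t : ℝ => flat (Ω (f (t • X))) A B) (flat (D X) A B) 0 :=
    fun A B => by
      simp only [flat_apply]
      exact (LinearMap.toContinuousLinearMap (evalLin ![A, B])).hasFDerivAt.comp_hasDerivAt
        (0 : ℝ) hO
  have hid := hasDerivAt_id (0 : ℝ)
  -- Along the line through `X`, the pulled-back form is a polynomial in `t` with coefficients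
  -- evaluated along the curve; the quadratic term contributes nothing to the derivative at zero.
  have h1 := (((hq U W).add (hid.mul (hq (Γ X U) W))).add (hid.mul (hq U (Γ X W)))).add
    (hid.mul (hid.mul (hq (Γ X U) (Γ X W))))
  have h2 : HasDerivAt (fun t : ℝ => (Ω (f (t • X))).compContinuousLinearMap
      (fderiv ℝ f (t • X)) ![U, W])
      (fderiv ℝ (fun y => (Ω (f y)).compContinuousLinearMap (fderiv ℝ f y)) 0 X ![U, W]) 0 := by
    have h3 := HasFDerivAt.comp_hasDerivAt_of_eq (0 : ℝ) hdiff.hasFDerivAt hline (by simp)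
    exact (LinearMap.toContinuousLinearMap (evalLin ![U, W])).hasFDerivAt.comp_hasDerivAt
      (0 : ℝ) h3
  have h3 := h2.unique (h1.congr_of_eventuallyEq (Filter.Eventually.of_forall fun t => ?_))
  swap
  · have e : ∀ A B : N, (fun i => (fderiv ℝ f (t • X)) (![A, B] i)) =
        ![A + t • Γ X A, B + t • Γ X B] := fun A B => by
      ext i
      fin_cases i <;> simp [hfd']
    change (Ω (f (t • X))) (fun i => (fderiv ℝ f (t • X)) (![U, W] i)) =
      flat (Ω (f (t • X))) U W + t * flat (Ω (f (t • X))) (Γ X U) W +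
        t * flat (Ω (f (t • X))) U (Γ X W) + t * (t * flat (Ω (f (t • X))) (Γ X U) (Γ X W))
    rw [e, ← flat_apply]
    simp only [map_add, add_apply, map_smul, smul_apply, smul_eq_mul]
    ring
  rw [h3]
  have h5 := DFunLike.congr_fun hd ![X, U, W]
  rw [extDeriv_apply (hs.differentiableAt one_ne_zero), Fin.sum_univ_three] at h5
  have h6 : ∀ (v : Fin 2 → N) (Y : N), fderiv ℝ (fun y => Ω y v) z Y = D Y v := fun v Y => by
    have := (LinearMap.toContinuousLinearMap (evalLin v)).hasFDerivAt.comp z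
      (hs.differentiableAt one_ne_zero).hasFDerivAt
    exact DFunLike.congr_fun this.fderiv Y
  have e0 : (0 : Fin 3).removeNth ![X, U, W] = ![U, W] := by ext i; fin_cases i <;> rfl
  have e1 : (1 : Fin 3).removeNth ![X, U, W] = ![X, W] := by ext i; fin_cases i <;> rfl
  have e2 : (2 : Fin 3).removeNth ![X, U, W] = ![X, U] := by ext i; fin_cases i <;> rfl
  rw [h6, h6, h6, e0, e1, e2, ← flat_apply, ← flat_apply, ← flat_apply] at h5
  -- Closedness, written as a cyclic identity. With the coefficient one third in `Γ`, the derivative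
  -- to be computed is one third of this expression.
  have h7 : flat (D X) U W - flat (D U) X W + flat (D W) X U = 0 := by
    simpa [sub_eq_add_neg] using h5
  simp only [zero_smul, hf0, id_eq, zero_mul, one_mul, add_zero, Pi.mul_apply]
  rw [hΓ, flat_swap (Ω z) U, hΓ, flat_swap (D X) W U]
  change _ = (0 : ℝ)
  linarith

/-- The inverse function theorem, with smoothness of the inverse in a whole neighbourhood: the
derivative stays invertible near `a`. -/
theorem exists_local_inverse {f : N → N} (hf : ContDiff ℝ ∞ f) {a : N}
    (hd : fderiv ℝ f a = .id ℝ N) :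
    ∃ h : N → N, h (f a) = a ∧ (∀ᶠ y in 𝓝 a, h (f y) = y) ∧ (∀ᶠ z in 𝓝 (f a), f (h z) = z) ∧
      ∀ᶠ z in 𝓝 (f a), ContDiffAt ℝ ∞ h z := by
  have hdf : ∀ y, HasFDerivAt f (fderiv ℝ f y) y := fun y =>
    (hf.differentiable (by simp)).differentiableAt.hasFDerivAt
  have ha : HasFDerivAt f ((ContinuousLinearEquiv.refl ℝ N : N ≃L[ℝ] N) : N →L[ℝ] N) a := by
    rw [ContinuousLinearEquiv.coe_refl, ← hd]
    exact hdf a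
  let e := ContDiffAt.toOpenPartialHomeomorph f hf.contDiffAt ha (by simp)
  have he : (e : N → N) = f := ContDiffAt.toOpenPartialHomeomorph_coe _ _ _
  have hae : a ∈ e.source := ContDiffAt.mem_toOpenPartialHomeomorph_source _ _ _
  have hat : f a ∈ e.target := by
    rw [← he]
    exact e.map_source hae
  have hinv : e.symm (f a) = a := by
    rw [← he]
    exact e.left_inv hae
  refine ⟨e.symm, hinv, ?_, ?_, ?_⟩
  · filter_upwards [e.open_source.mem_nhds hae] with y hy
    rw [← he]
    exact e.left_inv hy
  · filter_upwards [e.open_target.mem_nhds hat] with z hz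
    rw [← he]
    exact e.right_inv hz
  · have h1 : ∀ᶠ y in 𝓝 a, (fderiv ℝ f y).IsInvertible := by
      have h2 : ContinuousAt (fderiv ℝ f) a := (hf.continuous_fderiv (by simp)).continuousAt
      have h3 := (ContinuousLinearEquiv.refl ℝ N).nhds
      rw [ContinuousLinearEquiv.coe_refl, ← hd] at h3
      filter_upwards [h2.eventually_mem h3] with y hy using hy
    have h4 : Filter.Tendsto e.symm (𝓝 (f a)) (𝓝 a) := by
      have := e.symm.continuousAt (x := f a) hat
      rwa [ContinuousAt, hinv] at this
    filter_upwards [e.open_target.mem_nhds hat, h4.eventually h1] with z hz hi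
    obtain ⟨f', hf'⟩ := hi
    refine e.contDiffAt_symm (f₀' := f') hz ?_ ?_
    · rw [hf', he]
      exact hdf _
    · rw [he]
      exact hf.contDiffAt

end AdaptedMap

/-! ### Pulling forms back between the manifold and vector spaces. -/

section ManifoldPullback

variable {E : Type*} [NormedAddCommGroup E] [NormedSpace ℝ E]
  {M : Type*} [TopologicalSpace M] [ChartedSpace E M]
  {P : Type*} [NormedAddCommGroup P] [NormedSpace ℝ P]

/-- The derivative of a map from a vector space to the manifold. -/
def dmap (G : P → M) (z : P) : P →L[ℝ] E := mfderiv 𝓘(ℝ, P) 𝓘(ℝ, E) G z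

/-- The derivative of a map from the manifold to a vector space. -/
def dcomap (π : M → P) (y : M) : E →L[ℝ] P := mfderiv 𝓘(ℝ, E) 𝓘(ℝ, P) π y

/-- The value of a form at a point, on the model space. -/
def DForm.val {k : ℕ} (φ : DForm E M k) (y : M) : E [⋀^Fin k]→L[ℝ] ℝ := φ y

/-- The value of a vector field at a point, on the model space. -/
def VField.val (X : VField E M) (y : M) : E := X y

/-- The pullback of a form on the manifold to a vector space. -/
def pull (G : P → M) {k : ℕ} (φ : DForm E M k) (z : P) : P [⋀^Fin k]→L[ℝ] ℝ :=
  (φ.val (G z)).compContinuousLinearMap (dmap G z)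

/-- The pullback of a form on a vector space to the manifold, at a point. -/
def copull (π : M → P) {k : ℕ} (α : P → P [⋀^Fin k]→L[ℝ] ℝ) (y : M) : E [⋀^Fin k]→L[ℝ] ℝ :=
  (α (π y)).compContinuousLinearMap (dcomap π y)

theorem chartForm_eq {k : ℕ} (φ : DForm E M k) (x₀ : M) :
    chartForm φ x₀ = pull (extChartAt 𝓘(ℝ, E) x₀).symm φ := rfl

theorem extD_val {k : ℕ} (φ : DForm E M k) (x : M) :
    (extD φ).val x = (extDeriv (chartForm φ x) (extChartAt 𝓘(ℝ, E) x x)).compContinuousLinearMap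
      (dcomap (extChartAt 𝓘(ℝ, E) x) x) := rfl

variable {Z : Type*} [NormedAddCommGroup Z] [NormedSpace ℝ Z]

theorem dmap_comp {G : P → M} {f : Z → P} {z : Z}
    (hG : MDifferentiableAt 𝓘(ℝ, P) 𝓘(ℝ, E) G (f z)) (hf : DifferentiableAt ℝ f z) :
    dmap (E := E) (fun y => G (f y)) z = dmap G (f z) ∘L fderiv ℝ f z := by
  have := mfderiv_comp z hG hf.mdifferentiableAt
  rw [mfderiv_eq_fderiv] at this
  exact this

theorem dcomap_comp {π : M → P} {f : P → Z} {y : M}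
    (hπ : MDifferentiableAt 𝓘(ℝ, E) 𝓘(ℝ, P) π y) (hf : DifferentiableAt ℝ f (π y)) :
    dcomap (fun y => f (π y)) y = fderiv ℝ f (π y) ∘L dcomap (E := E) π y := by
  have := mfderiv_comp y hf.mdifferentiableAt hπ
  rw [mfderiv_eq_fderiv] at this
  exact this

theorem fderiv_comap_comp {π : M → P} {G : Z → M} {z : Z}
    (hπ : MDifferentiableAt 𝓘(ℝ, E) 𝓘(ℝ, P) π (G z))
    (hG : MDifferentiableAt 𝓘(ℝ, Z) 𝓘(ℝ, E) G z) :
    fderiv ℝ (fun y => π (G y)) z = dcomap (E := E) π (G z) ∘L dmap G z := by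
  have := mfderiv_comp z hπ hG
  rw [mfderiv_eq_fderiv] at this
  exact this

theorem dmap_dcomap {π : M → P} {G : P → M} {y : M}
    (hπ : MDifferentiableAt 𝓘(ℝ, E) 𝓘(ℝ, P) π y)
    (hG : MDifferentiableAt 𝓘(ℝ, P) 𝓘(ℝ, E) G (π y)) (h : ∀ᶠ y' in 𝓝 y, G (π y') = y') :
    dmap G (π y) ∘L dcomap (E := E) π y = .id ℝ E := by
  have h1 := mfderiv_comp y hG hπ
  have h2 : mfderiv 𝓘(ℝ, E) 𝓘(ℝ, E) (G ∘ π) y = mfderiv 𝓘(ℝ, E) 𝓘(ℝ, E) id y :=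
    Filter.EventuallyEq.mfderiv_eq h
  rw [h2, mfderiv_id] at h1
  exact h1.symm

theorem minSmoothness_two_le : minSmoothness ℝ 2 ≤ (∞ : WithTop ℕ∞) := by
  rw [minSmoothness_of_isRCLikeNormedField]
  norm_cast

theorem contDiffAt_fderiv {f : Z → P} {a : Z} (hf : ContDiffAt ℝ ∞ f a) :
    ContDiffAt ℝ ∞ (fderiv ℝ f) a := hf.fderiv_right (by simp)

theorem IsSmooth.contDiffAt_chartForm {k : ℕ} {φ : DForm E M k} (hφ : IsSmooth φ) (x₀ : M) {y : E}
    (hy : y ∈ (extChartAt 𝓘(ℝ, E) x₀).target) : ContDiffAt ℝ ∞ (chartForm φ x₀) y :=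
  (hφ x₀).contDiffAt ((isOpen_extChartAt_target x₀).mem_nhds hy)

theorem contDiffAt_comap {π : M → P} {G : Z → M} {a : Z}
    (hπ : ContMDiffAt 𝓘(ℝ, E) 𝓘(ℝ, P) ∞ π (G a)) (hG : ContMDiffAt 𝓘(ℝ, Z) 𝓘(ℝ, E) ∞ G a) :
    ContDiffAt ℝ ∞ (fun z => π (G z)) a := (hπ.comp a hG).contDiffAt

variable [IsManifold 𝓘(ℝ, E) ∞ M]

theorem mdifferentiableAt_of_contMDiffAt {G : P → M} {z : P}
    (hG : ContMDiffAt 𝓘(ℝ, P) 𝓘(ℝ, E) ∞ G z) :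
    ∀ᶠ y in 𝓝 z, MDifferentiableAt 𝓘(ℝ, P) 𝓘(ℝ, E) G y := by
  have : IsManifold 𝓘(ℝ, E) 1 M := .of_le (n := ∞) (by norm_cast)
  have h1 : ContMDiffAt 𝓘(ℝ, P) 𝓘(ℝ, E) 1 G z := hG.of_le (by norm_cast)
  filter_upwards [(contMDiffAt_iff_contMDiffAt_nhds (by decide)).1 h1] with y hy
  exact hy.mdifferentiableAt one_ne_zero

theorem mdifferentiableAt_of_contMDiffAt' {π : M → P} {y : M}
    (hπ : ContMDiffAt 𝓘(ℝ, E) 𝓘(ℝ, P) ∞ π y) :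
    ∀ᶠ y' in 𝓝 y, MDifferentiableAt 𝓘(ℝ, E) 𝓘(ℝ, P) π y' := by
  have : IsManifold 𝓘(ℝ, E) 1 M := .of_le (n := ∞) (by norm_cast)
  have h1 : ContMDiffAt 𝓘(ℝ, E) 𝓘(ℝ, P) 1 π y := hπ.of_le (by norm_cast)
  filter_upwards [(contMDiffAt_iff_contMDiffAt_nhds (by decide)).1 h1] with y' hy
  exact hy.mdifferentiableAt one_ne_zero

theorem contMDiffAt_chart_symm (x₀ : M) {y : E} (hy : y ∈ (extChartAt 𝓘(ℝ, E) x₀).target) :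
    ContMDiffAt 𝓘(ℝ, E) 𝓘(ℝ, E) ∞ (extChartAt 𝓘(ℝ, E) x₀).symm y :=
  (contMDiffOn_extChartAt_symm x₀).contMDiffAt ((isOpen_extChartAt_target x₀).mem_nhds hy)

theorem contMDiffAt_chart {x₀ y : M} (hy : y ∈ (extChartAt 𝓘(ℝ, E) x₀).source) :
    ContMDiffAt 𝓘(ℝ, E) 𝓘(ℝ, E) ∞ (extChartAt 𝓘(ℝ, E) x₀) y :=
  contMDiffAt_extChartAt' (by rwa [extChartAt_source] at hy)

/-- A pullback is a pullback of the form in the chart. -/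
theorem pull_eventuallyEq {G : P → M} {a : P} (hG : ContMDiffAt 𝓘(ℝ, P) 𝓘(ℝ, E) ∞ G a)
    {k : ℕ} (φ : DForm E M k) : pull G φ =ᶠ[𝓝 a] fun z =>
      (chartForm φ (G a) (extChartAt 𝓘(ℝ, E) (G a) (G z))).compContinuousLinearMap
        (fderiv ℝ (fun z => extChartAt 𝓘(ℝ, E) (G a) (G z)) z) := by
  set c := extChartAt 𝓘(ℝ, E) (G a) with hc
  have h1 : ∀ᶠ z in 𝓝 a, G z ∈ c.source :=
    hG.continuousAt.eventually_mem (extChartAt_source_mem_nhds (G a))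
  filter_upwards [h1, mdifferentiableAt_of_contMDiffAt hG] with z hz hGz
  have hd1 : MDifferentiableAt 𝓘(ℝ, E) 𝓘(ℝ, E) c (G z) :=
    (contMDiffAt_chart hz).mdifferentiableAt (by simp)
  have hd2 : MDifferentiableAt 𝓘(ℝ, E) 𝓘(ℝ, E) c.symm (c (G z)) :=
    (contMDiffAt_chart_symm (G a) (c.map_source hz)).mdifferentiableAt (by simp)
  have h2 : ∀ᶠ y in 𝓝 (G z), c.symm (c y) = y := by
    filter_upwards [(isOpen_extChartAt_source (G a)).mem_nhds hz] with y hy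
    exact c.left_inv hy
  have h3 := dmap_dcomap hd1 hd2 h2
  rw [fderiv_comap_comp hd1 hGz]
  change _ = ((φ.val (c.symm (c (G z)))).compContinuousLinearMap _).compContinuousLinearMap _
  rw [c.left_inv hz]
  change (φ.val (G z)).compContinuousLinearMap _ =
    (φ.val (G z)).compContinuousLinearMap (dmap c.symm (c (G z)) ∘L (dcomap c (G z) ∘L dmap G z))
  rw [← ContinuousLinearMap.comp_assoc, h3, ContinuousLinearMap.id_comp]

theorem contDiffAt_chart_comp {G : P → M} {a : P} (hG : ContMDiffAt 𝓘(ℝ, P) 𝓘(ℝ, E) ∞ G a) :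
    ContDiffAt ℝ ∞ (fun z => extChartAt 𝓘(ℝ, E) (G a) (G z)) a :=
  ((contMDiffAt_chart (mem_extChartAt_source (G a))).comp a hG).contDiffAt

theorem IsSmooth.contDiffAt_pull [FiniteDimensional ℝ E] [FiniteDimensional ℝ P] {k : ℕ}
    {φ : DForm E M k} (hφ : IsSmooth φ) {G : P → M} {a : P}
    (hG : ContMDiffAt 𝓘(ℝ, P) 𝓘(ℝ, E) ∞ G a) : ContDiffAt ℝ ∞ (pull G φ) a := by
  refine ContDiffAt.congr_of_eventuallyEq ?_ (pull_eventuallyEq hG φ)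
  have h1 := contDiffAt_chart_comp hG
  refine contDiffAt_comp ?_ (contDiffAt_fderiv h1)
  exact (hφ.contDiffAt_chartForm (G a) (mem_extChartAt_target (G a))).comp a h1

/-- Relative to the one chart at `G a` this is naturality of the exterior derivative between vector
spaces. -/
theorem IsSmooth.extDeriv_pull {k : ℕ}
    {φ : DForm E M k} (hφ : IsSmooth φ) {G : P → M} {a : P}
    (hG : ContMDiffAt 𝓘(ℝ, P) 𝓘(ℝ, E) ∞ G a) :
    extDeriv (pull G φ) a = pull G (extD φ) a := by
  rw [(pull_eventuallyEq hG φ).extDeriv_eq]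
  have h1 := contDiffAt_chart_comp hG
  have h2 : DifferentiableAt ℝ (chartForm φ (G a)) (extChartAt 𝓘(ℝ, E) (G a) (G a)) :=
    (hφ.contDiffAt_chartForm (G a) (mem_extChartAt_target (G a))).differentiableAt (by simp)
  rw [extDeriv_pullback (f := fun z => extChartAt 𝓘(ℝ, E) (G a) (G z)) h2 h1
    minSmoothness_two_le,
    fderiv_comap_comp ((contMDiffAt_chart (mem_extChartAt_source (G a))).mdifferentiableAt
      (by simp)) (hG.mdifferentiableAt (by simp))]
  rfl

theorem pull_copull {π : M → P} {G : Z → M} {a : Z}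
    (hπ : ContMDiffAt 𝓘(ℝ, E) 𝓘(ℝ, P) ∞ π (G a)) (hG : ContMDiffAt 𝓘(ℝ, Z) 𝓘(ℝ, E) ∞ G a)
    {k : ℕ} {φ : DForm E M k} {α : P → P [⋀^Fin k]→L[ℝ] ℝ}
    (h : φ.val =ᶠ[𝓝 (G a)] copull π α) : pull G φ =ᶠ[𝓝 a] fun z =>
      (α (π (G z))).compContinuousLinearMap (fderiv ℝ (fun z => π (G z)) z) := by
  filter_upwards [hG.continuousAt.eventually h, mdifferentiableAt_of_contMDiffAt hG,
    hG.continuousAt.eventually (mdifferentiableAt_of_contMDiffAt' hπ)] with z h1 h2 h3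
  rw [pull, h1, fderiv_comap_comp h3 h2]
  rfl

/-- A form which is locally a pullback of smooth forms is smooth. -/
theorem isSmooth_of_copull [FiniteDimensional ℝ E] [FiniteDimensional ℝ P] {k : ℕ}
    {φ : DForm E M k}
    (h : ∀ x, ∃ (π : M → P) (α : P → P [⋀^Fin k]→L[ℝ] ℝ),
      ContMDiffAt 𝓘(ℝ, E) 𝓘(ℝ, P) ∞ π x ∧ ContDiffAt ℝ ∞ α (π x) ∧ φ.val =ᶠ[𝓝 x] copull π α) :
    IsSmooth φ := by
  intro x₀ y hy
  obtain ⟨π, α, hπ, hα, hφ⟩ := h ((extChartAt 𝓘(ℝ, E) x₀).symm y)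
  have hG := contMDiffAt_chart_symm x₀ hy
  refine (ContDiffAt.congr_of_eventuallyEq ?_ (pull_copull hπ hG hφ)).contDiffWithinAt
  have h1 := contDiffAt_comap hπ hG
  exact contDiffAt_comp (hα.comp y h1) (contDiffAt_fderiv h1)

/-- The exterior derivative on `M` is defined through the preferred chart at `x`; the derivatives of
that chart and of its inverse cancel, leaving the derivative computed downstairs. -/
theorem extD_of_copull {k : ℕ} {φ : DForm E M k} {π : M → P} {α : P → P [⋀^Fin k]→L[ℝ] ℝ} {x : M}
    (hπ : ContMDiffAt 𝓘(ℝ, E) 𝓘(ℝ, P) ∞ π x) (hα : DifferentiableAt ℝ α (π x))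
    (hφ : φ.val =ᶠ[𝓝 x] copull π α) : (extD φ).val x = copull π (extDeriv α) x := by
  set c := extChartAt 𝓘(ℝ, E) x with hc
  have hx : c.symm (c x) = x := c.left_inv (mem_extChartAt_source x)
  have hG : ContMDiffAt 𝓘(ℝ, E) 𝓘(ℝ, E) ∞ c.symm (c x) :=
    contMDiffAt_chart_symm x (mem_extChartAt_target x)
  have hc' := contMDiffAt_chart (E := E) (mem_extChartAt_source (I := 𝓘(ℝ, E)) x)
  have hπ' : ContMDiffAt 𝓘(ℝ, E) 𝓘(ℝ, P) ∞ π (c.symm (c x)) := by rwa [hx]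
  have hφ' : φ.val =ᶠ[𝓝 (c.symm (c x))] copull π α := by rwa [hx]
  have h1 := contDiffAt_comap hπ' hG
  rw [extD_val, chartForm_eq, (pull_copull hπ' hG hφ').extDeriv_eq,
    extDeriv_pullback (by rwa [hx]) h1 minSmoothness_two_le,
    fderiv_comap_comp (hπ'.mdifferentiableAt (by simp)) (hG.mdifferentiableAt (by simp)), hx]
  have h2 : ∀ᶠ y in 𝓝 x, c.symm (c y) = y := by
    filter_upwards [extChartAt_source_mem_nhds (I := 𝓘(ℝ, E)) x] with y hy
    exact c.left_inv hy
  have h3 := dmap_dcomap (hc'.mdifferentiableAt (by simp)) (hG.mdifferentiableAt (by simp)) h2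
  change (extDeriv α (π x)).compContinuousLinearMap
    ((dcomap π x ∘L dmap c.symm (c x)) ∘L dcomap c x) = _
  rw [ContinuousLinearMap.comp_assoc, h3, ContinuousLinearMap.comp_id]
  rfl

end ManifoldPullback

/-! ### Pointwise characterization of basic forms. -/

section BasicForms

variable {E : Type*} [NormedAddCommGroup E] [NormedSpace ℝ E]
  {M : Type*} [TopologicalSpace M] [ChartedSpace E M]

theorem extD_zero (k : ℕ) : extD (0 : DForm E M k) = 0 := by
  funext x
  have h1 : chartForm (0 : DForm E M k) x = fun _ => 0 := rfl
  have h2 : extDeriv (fun _ : E => (0 : E [⋀^Fin k]→L[ℝ] ℝ)) (extChartAt 𝓘(ℝ, E) x x) = 0 := by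
    rw [extDeriv, fderiv_fun_const]
    exact map_zero (ContinuousAlternatingMap.alternatizeUncurryFinCLM ℝ E ℝ)
  change (extDeriv (chartForm (0 : DForm E M k) x) _).compContinuousLinearMap _ = 0
  rw [h1, h2]
  rfl

theorem isInvertible_mfderiv {e : OpenPartialHomeomorph M E}
    (he : e ∈ IsManifold.maximalAtlas 𝓘(ℝ, E) ∞ M) {y : M} (hy : y ∈ e.source) :
    (mfderiv 𝓘(ℝ, E) 𝓘(ℝ, E) e y).IsInvertible := by
  have h1 : ∀ y ∈ e.source, MDifferentiableAt 𝓘(ℝ, E) 𝓘(ℝ, E) e y := fun y hy =>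
    (contMDiffAt_of_mem_maximalAtlas he hy).mdifferentiableAt (by simp)
  have h2 : ∀ z ∈ e.target, MDifferentiableAt 𝓘(ℝ, E) 𝓘(ℝ, E) e.symm z := fun z hz =>
    (contMDiffAt_symm_of_mem_maximalAtlas he hz).mdifferentiableAt (by simp)
  have h3 : OpenPartialHomeomorph.MDifferentiable 𝓘(ℝ, E) 𝓘(ℝ, E) e :=
    ⟨fun y hy => (h1 y hy).mdifferentiableWithinAt, fun z hz => (h2 z hz).mdifferentiableWithinAt⟩
  exact ⟨h3.mfderiv hy, rfl⟩

variable {p : ℕ} {F : Foliation E M p}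

/-- The form vanishes as soon as one of its arguments is tangent to the leaves. -/
def IsTransversal (F : Foliation E M p) {k : ℕ} (φ : DForm E M k) : Prop :=
  ∀ (x : M) (Y : Fin k → TangentSpace 𝓘(ℝ, E) x), (∃ i, Y i ∈ F.tangent x) → φ x Y = 0

theorem IsTransversal.contract_eq_zero {k : ℕ} {φ : DForm E M (k + 1)} (hφ : IsTransversal F φ)
    {X : VField E M} (hX : ∀ x, X x ∈ F.tangent x) : contract X φ = 0 := by
  funext x
  refine ContinuousAlternatingMap.ext fun Y => hφ x _ ⟨0, ?_⟩
  exact hX x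

/-- A form which is killed by the contraction with the vectors tangent to the leaves. -/
theorem isTransversal_of_interior {k : ℕ} {φ : DForm E M (k + 1)}
    (h : ∀ x, ∀ v ∈ F.tangent x, interior v (φ x) = 0) : IsTransversal F φ := by
  have h0 : ∀ (x : M) (Y : Fin (k + 1) → TangentSpace 𝓘(ℝ, E) x), Y 0 ∈ F.tangent x →
      φ x Y = 0 := fun x Y hY => by
    have h1 := DFunLike.congr_fun (h x _ hY) (Fin.tail Y)
    rwa [interior_apply, Fin.cons_self_tail] at h1
  rintro x Y ⟨i, hi⟩
  by_cases hi0 : i = 0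
  · exact h0 x Y (hi0 ▸ hi)
  · have h1 := (φ x).toAlternatingMap.map_swap Y (i := 0) (j := i) (Ne.symm hi0)
    have h2 : φ x (Y ∘ Equiv.swap 0 i) = 0 := h0 x _ (by simpa using hi)
    exact neg_eq_zero.1 (h1.symm.trans h2)

variable [IsManifold 𝓘(ℝ, E) ∞ M]

/-- By Cartan's formula both terms of the Lie derivative vanish once the form and its exterior
derivative are killed by tangent vectors. With `IsBasic.isTransversal` and
`IsBasic.isTransversal_extD` this removes vector fields from the notion of basic form. -/
theorem isBasic_of_isTransversal {k : ℕ} {φ : DForm E M k} (hs : IsSmooth φ)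
    (hφ : IsTransversal F φ) (hdφ : IsTransversal F (extD φ)) : IsBasic F φ where
  smooth := hs
  contract_eq_zero := fun X _ hX x Y ⟨i, hi⟩ => hφ x Y ⟨i, hi ▸ hX x⟩
  lieD_eq_zero := fun X _ hX => by
    rcases k with _ | k
    · exact hdφ.contract_eq_zero hX
    · change extD (contract X φ) + contract X (extD φ) = 0
      rw [hdφ.contract_eq_zero hX, hφ.contract_eq_zero hX, extD_zero, add_zero]

variable [FiniteDimensional ℝ E] [T2Space M]

/-- Every vector tangent to the leaves extends to a smooth vector field tangent to the leaves. -/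
theorem exists_tangent_field (F : Foliation E M p) {x : M} {v : TangentSpace 𝓘(ℝ, E) x}
    (hv : v ∈ F.tangent x) :
    ∃ X : VField E M, X.SmoothOn Set.univ ∧ (∀ y, X y ∈ F.tangent y) ∧ X x = v := by
  obtain ⟨e, he, hx, W, -, hW⟩ := F.exists_flat_chart x
  have : CompleteSpace E := FiniteDimensional.complete ℝ E
  let w : E := mfderiv 𝓘(ℝ, E) 𝓘(ℝ, E) e x v
  have hw : w ∈ W := (hW x hx v).1 hv
  let C : (z : E) → TangentSpace 𝓘(ℝ, E) z := fun _ => w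
  let S : VField E M := VectorField.mpullback 𝓘(ℝ, E) 𝓘(ℝ, E) e C
  have hS : S.SmoothOn e.source := fun y hy => by
    refine ContMDiffAt.contMDiffWithinAt (ContMDiffAt.mpullback_vectorField_preimage (n := ∞) ?_
      (contMDiffAt_of_mem_maximalAtlas he hy) (isInvertible_mfderiv he hy) (by simp))
    exact contMDiffAt_vectorSpace_iff_contDiffAt.2 contDiffAt_const
  have hSe : ∀ y ∈ e.source, (mfderiv 𝓘(ℝ, E) 𝓘(ℝ, E) e y (S y) : E) = w := fun y hy => by
    obtain ⟨d, hd⟩ := isInvertible_mfderiv he hy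
    change mfderiv 𝓘(ℝ, E) 𝓘(ℝ, E) e y ((mfderiv 𝓘(ℝ, E) 𝓘(ℝ, E) e y).inverse w) = w
    rw [← hd, ContinuousLinearMap.inverse_equiv]
    exact d.apply_symm_apply w
  -- Basic forms are tested with globally defined fields, so the field that is constant in the flat
  -- chart is cut off by a bump function supported in that chart.
  obtain ⟨ρ, hρ⟩ := (SmoothBumpFunction.nhds_basis_support (I := 𝓘(ℝ, E)) (c := x)
    (e.open_source.mem_nhds hx)).ex_mem
  refine ⟨fun y => ρ y • S y, ?_, fun y => ?_, ?_⟩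
  · exact (ContMDiffOn.smul_section_of_tsupport ρ.contMDiff.contMDiffOn e.open_source hρ
      hS).contMDiffOn
  · by_cases hy : y ∈ e.source
    · refine Submodule.smul_mem _ _ ((hW y hy _).2 ?_)
      rw [hSe y hy]
      exact hw
    · have : ρ y = 0 := by
        by_contra h0
        exact hy (hρ (subset_tsupport _ h0))
      change ρ y • S y ∈ _
      rw [this, zero_smul]
      exact Submodule.zero_mem _
  · change ρ x • S x = v
    rw [ρ.eq_one, one_smul]
    obtain ⟨d, hd⟩ := isInvertible_mfderiv he hx
    have h1 : mfderiv 𝓘(ℝ, E) 𝓘(ℝ, E) e x (S x) = mfderiv 𝓘(ℝ, E) 𝓘(ℝ, E) e x v := hSe x hx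
    rw [← hd] at h1
    exact d.injective h1

theorem IsBasic.isTransversal {k : ℕ} {φ : DForm E M k} (hφ : IsBasic F φ) :
    IsTransversal F φ := by
  rintro x Y ⟨i, hi⟩
  obtain ⟨X, hX, hXF, hXx⟩ := exists_tangent_field F hi
  exact hφ.contract_eq_zero X hX hXF x Y ⟨i, hXx.symm⟩

/-- The contraction of the form itself is zero, so the Lie derivative along a tangent field reduces
to the contraction of `extD φ`. -/
theorem IsBasic.isTransversal_extD {k : ℕ} {φ : DForm E M k} (hφ : IsBasic F φ) :
    IsTransversal F (extD φ) := by
  refine isTransversal_of_interior fun x v hv => ?_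
  obtain ⟨X, hX, hXF, rfl⟩ := exists_tangent_field F hv
  have h1 := hφ.lieD_eq_zero X hX hXF
  have h2 : contract X (extD φ) = 0 := by
    rcases k with _ | k
    · exact h1
    · change extD (contract X φ) + contract X (extD φ) = 0 at h1
      rwa [hφ.isTransversal.contract_eq_zero hXF, extD_zero, zero_add] at h1
  exact congrFun h2 x

end BasicForms

/-! ### Translation invariance along the leaves in a flat chart. -/

section Invariance

variable {E : Type*} [NormedAddCommGroup E] [NormedSpace ℝ E]

/-- Cartan's formula for a constant field annihilating a form. -/
theorem fderiv_eq_zero_of_interior {k : ℕ} {α : E → E [⋀^Fin k]→L[ℝ] ℝ} {z w : E}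
    (hα : DifferentiableAt ℝ α z)
    (h0 : ∀ᶠ y in 𝓝 z, ∀ v : Fin k → E, (∃ i, v i = w) → α y v = 0)
    (h1 : ∀ v : Fin (k + 1) → E, v 0 = w → extDeriv α z v = 0) : fderiv ℝ α z w = 0 := by
  have he : ∀ v Y, fderiv ℝ (fun y => α y v) z Y = fderiv ℝ α z Y v := fun v Y =>
    fderiv_continuousAlternatingMap_apply_const_apply hα v Y
  ext v
  have h2 := h1 (Fin.cons w v) rfl
  rw [extDeriv_apply hα, Fin.sum_univ_succ] at h2
  -- In all terms but the first of the exterior derivative, `w` remains an argument of the form, so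
  -- a function vanishing near `z` is being differentiated.
  have h3 : ∀ i : Fin k, fderiv ℝ (fun y => α y (i.succ.removeNth (Fin.cons w v : Fin (k + 1) → E))) z
      ((Fin.cons w v : Fin (k + 1) → E) i.succ) = 0 := fun i => by
    have h4 : (fun y => α y (i.succ.removeNth (Fin.cons w v : Fin (k + 1) → E))) =ᶠ[𝓝 z] fun _ => 0 := by
      filter_upwards [h0] with y hy
      refine hy _ ?_
      obtain ⟨k, rfl⟩ : ∃ j, k = j + 1 := ⟨k - 1, by have := i.pos; omega⟩
      exact ⟨0, rfl⟩
    rw [h4.fderiv_eq]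
    simp
  simp only [h3, smul_zero, Finset.sum_const_zero, add_zero] at h2
  simp only [Fin.val_zero, pow_zero, one_smul, Fin.cons_zero] at h2
  rw [he] at h2
  exact h2

/-- A form annihilated by a subspace together with its exterior derivative is invariant under the
translations by the subspace. -/
theorem eq_of_sub_mem {k : ℕ} {α : E → E [⋀^Fin k]→L[ℝ] ℝ} {U : Set E} (hU : IsOpen U)
    (hc : Convex ℝ U) {W : Submodule ℝ E} (hα : ∀ z ∈ U, DifferentiableAt ℝ α z)
    (h0 : ∀ z ∈ U, ∀ v : Fin k → E, (∃ i, v i ∈ W) → α z v = 0)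
    (h1 : ∀ z ∈ U, ∀ v : Fin (k + 1) → E, (∃ i, v i ∈ W) → extDeriv α z v = 0) {z z' : E}
    (hz : z ∈ U) (hz' : z' ∈ U) (h : z' - z ∈ W) : α z = α z' := by
  have hd : ∀ y ∈ U, fderiv ℝ α y (z' - z) = 0 := fun y hy => by
    refine fderiv_eq_zero_of_interior (hα y hy) ?_ fun v hv => h1 y hy v ⟨0, hv ▸ h⟩
    filter_upwards [hU.mem_nhds hy] with y' hy' v hv
    obtain ⟨i, hi⟩ := hv
    exact h0 y' hy' v ⟨i, hi ▸ h⟩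
  have hline : ∀ t ∈ Set.Icc (0 : ℝ) 1, z + t • (z' - z) ∈ U := fun t ht =>
    hc.add_smul_sub_mem hz hz' ht
  have hder : ∀ t ∈ Set.Icc (0 : ℝ) 1,
      HasDerivWithinAt (fun t : ℝ => α (z + t • (z' - z))) 0 (Set.Icc 0 1) t := fun t ht => by
    have h2 : HasDerivAt (fun t : ℝ => z + t • (z' - z)) (z' - z) t := by
      simpa using ((hasDerivAt_id t).smul_const (z' - z)).const_add z
    have h3 := (hα _ (hline t ht)).hasFDerivAt.comp_hasDerivAt t h2
    rw [hd _ (hline t ht)] at h3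
    exact h3.hasDerivWithinAt
  -- Convexity keeps the segment inside `U`, and the form has zero derivative along it.
  have h4 := (convex_Icc (0 : ℝ) 1).norm_image_sub_le_of_norm_hasDerivWithin_le (C := 0) hder
    (fun _ _ => by simp) (Set.left_mem_Icc.2 zero_le_one) (Set.right_mem_Icc.2 zero_le_one)
  rw [zero_mul, norm_le_zero_iff, sub_eq_zero] at h4
  simpa using h4.symm

end Invariance

/-! ### Local submersions whose fibres are the leaves. -/

section TransverseCharts

variable {E : Type*} [NormedAddCommGroup E] [NormedSpace ℝ E]
  {M : Type*} [TopologicalSpace M] [ChartedSpace E M] [IsManifold 𝓘(ℝ, E) ∞ M]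
  {p : ℕ} {F : Foliation E M p}
  {N : Type*} [NormedAddCommGroup N] [NormedSpace ℝ N]

/-- A submersion `π` around `x` whose fibres are the leaves, with a section `σ` through `x`, such
that basic forms are pulled back along `π`. -/
structure IsTransverseChart (F : Foliation E M p) (x : M) (π : M → N) (σ : N → M) : Prop where
  contMDiffAt_proj : ∀ᶠ y in 𝓝 x, ContMDiffAt 𝓘(ℝ, E) 𝓘(ℝ, N) ∞ π y
  contMDiffAt_sec : ∀ᶠ z in 𝓝 (π x), ContMDiffAt 𝓘(ℝ, N) 𝓘(ℝ, E) ∞ σ z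
  sec_proj : σ (π x) = x
  proj_sec : ∀ᶠ z in 𝓝 (π x), π (σ z) = z
  surjective : ∀ᶠ y in 𝓝 x, Function.Surjective (dcomap (E := E) π y)
  ker : ∀ᶠ y in 𝓝 x, ∀ X : E, X ∈ F.tangent y ↔ dcomap (E := E) π y X = 0
  eq_copull : ∀ {k : ℕ} (φ : DForm E M k), IsBasic F φ → φ.val =ᶠ[𝓝 x] copull π (pull σ φ)

/-- The projection is the flat chart followed by the quotient by the leaf directions, and the
section is an affine slice through `x`. A basic form is killed by these directions together with its
exterior derivative, so `eq_of_sub_mem` shows that it is determined by its restriction to the slice.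
-/
theorem exists_isTransverseChart [FiniteDimensional ℝ E] [T2Space M] [FiniteDimensional ℝ N]
    (F : Foliation E M p) (hdim : Module.finrank ℝ E = p + Module.finrank ℝ N) (x : M) :
    ∃ (π : M → N) (σ : N → M), IsTransverseChart F x π σ := by
  obtain ⟨e, he, hx, W, hWp, hW⟩ := F.exists_flat_chart x
  obtain ⟨q, hq, hqW⟩ : ∃ q : E →L[ℝ] N, Function.Surjective q ∧ ∀ X, q X = 0 ↔ X ∈ W := by
    have h1 : Module.finrank ℝ (E ⧸ W) = Module.finrank ℝ N := by
      have := W.finrank_quotient_add_finrank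
      omega
    let d := LinearEquiv.ofFinrankEq _ _ h1
    refine ⟨LinearMap.toContinuousLinearMap (d.toLinearMap ∘ₗ W.mkQ),
      d.surjective.comp W.mkQ_surjective, fun X => ?_⟩
    change d (W.mkQ X) = 0 ↔ _
    rw [d.map_eq_zero_iff, Submodule.mkQ_apply, Submodule.Quotient.mk_eq_zero]
  obtain ⟨s, hs⟩ := exists_section hq
  have hsrc : ∀ᶠ y in 𝓝 x, y ∈ e.source := e.open_source.mem_nhds hx
  have hce : ∀ y ∈ e.source, ContMDiffAt 𝓘(ℝ, E) 𝓘(ℝ, E) ∞ e y := fun y hy =>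
    contMDiffAt_of_mem_maximalAtlas he hy
  have hcs : ∀ z ∈ e.target, ContMDiffAt 𝓘(ℝ, E) 𝓘(ℝ, E) ∞ e.symm z := fun z hz =>
    contMDiffAt_symm_of_mem_maximalAtlas he hz
  have hde : ∀ y ∈ e.source, MDifferentiableAt 𝓘(ℝ, E) 𝓘(ℝ, E) e y := fun y hy =>
    (hce y hy).mdifferentiableAt (by simp)
  have hds : ∀ z ∈ e.target, MDifferentiableAt 𝓘(ℝ, E) 𝓘(ℝ, E) e.symm z := fun z hz =>
    (hcs z hz).mdifferentiableAt (by simp)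
  -- The slice is shifted so that it meets the leaf through `x` at `x` itself.
  let a : N → E := fun z => e x + s (z - q (e x))
  have ha : ∀ z, HasFDerivAt a s z := fun z => by
    have := s.hasFDerivAt.comp z ((hasFDerivAt_id z).sub_const (q (e x)))
    exact (this.const_add (e x)).congr_fderiv (ContinuousLinearMap.comp_id s)
  have hac : ContDiff ℝ ∞ a := contDiff_const.add (s.contDiff.comp (contDiff_id.sub contDiff_const))
  have hax : a (q (e x)) = e x := by simp [a]
  let π : M → N := fun y => q (e y)
  let σ : N → M := fun z => e.symm (a z)
  have hat : ∀ᶠ z in 𝓝 (π x), a z ∈ e.target := by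
    have : ContinuousAt a (π x) := hac.continuous.continuousAt
    refine this.eventually_mem ?_
    change e.target ∈ 𝓝 (a (q (e x)))
    rw [hax]
    exact e.open_target.mem_nhds (e.map_source hx)
  have hπd : ∀ y ∈ e.source, dcomap (E := E) π y = q ∘L dcomap (E := E) e y := fun y hy => by
    rw [dcomap_comp (hde y hy) q.differentiableAt, ContinuousLinearMap.fderiv]
  have hinv : ∀ y ∈ e.source, dmap e.symm (e y) ∘L dcomap (E := E) e y = .id ℝ E := fun y hy => by
    refine dmap_dcomap (hde y hy) (hds _ (e.map_source hy)) ?_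
    filter_upwards [e.open_source.mem_nhds hy] with y' hy' using e.left_inv hy'
  refine ⟨π, σ, ?_, ?_, ?_, ?_, ?_, ?_, ?_⟩
  · filter_upwards [hsrc] with y hy
    exact q.contDiff.contMDiff.contMDiffAt.comp y (hce y hy)
  · filter_upwards [hat] with z hz
    exact (hcs _ hz).comp z hac.contMDiff.contMDiffAt
  · change e.symm (a (q (e x))) = x
    rw [hax, e.left_inv hx]
  · filter_upwards [hat] with z hz
    change q (e (e.symm (a z))) = z
    rw [e.right_inv hz]
    simp [a, hs]
  · filter_upwards [hsrc] with y hy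
    rw [hπd y hy]
    refine hq.comp ?_
    obtain ⟨d, hd⟩ := isInvertible_mfderiv he hy
    intro X
    refine ⟨d.symm X, ?_⟩
    change mfderiv 𝓘(ℝ, E) 𝓘(ℝ, E) e y (d.symm X) = X
    rw [← hd]
    exact d.apply_symm_apply X
  · filter_upwards [hsrc] with y hy X
    rw [hπd y hy]
    exact (hW y hy X).trans (hqW _).symm
  · intro k φ hφ
    -- A ball in the chart is chosen because invariance under leaf translations is proved along
    -- segments.
    obtain ⟨ε, hε, hball⟩ := Metric.isOpen_iff.1 e.open_target (e x) (e.map_source hx)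
    have h0 : ∀ z ∈ e.target, ∀ (l : ℕ) (ψ : DForm E M l), IsTransversal F ψ →
        ∀ v : Fin l → E, (∃ i, v i ∈ W) → pull e.symm ψ z v = 0 := by
      rintro z hz l ψ hψ v ⟨i, hi⟩
      refine hψ (e.symm z) _ ⟨i, (hW _ (e.map_target hz) _).2 ?_⟩
      have h1 : dcomap e (e.symm z) ∘L dmap (E := E) e.symm z = .id ℝ E := by
        rw [← fderiv_comap_comp (hde _ (e.map_target hz)) (hds z hz)]
        have : (fun y => e (e.symm y)) =ᶠ[𝓝 z] id := by
          filter_upwards [e.open_target.mem_nhds hz] with y hy using e.right_inv hy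
        rw [this.fderiv_eq, fderiv_id]
      have h2 := DFunLike.congr_fun h1 (v i)
      change (dcomap e (e.symm z) (dmap (E := E) e.symm z (v i))) ∈ W
      exact h2 ▸ hi
    have hcst : ∀ z ∈ Metric.ball (e x) ε, ∀ z' ∈ Metric.ball (e x) ε, z' - z ∈ W →
        pull e.symm φ z = pull e.symm φ z' := fun z hz z' hz' h => by
      refine eq_of_sub_mem Metric.isOpen_ball (convex_ball _ _) (fun z hz => ?_)
        (fun z hz v hv => h0 z (hball hz) k φ hφ.isTransversal v hv)
        (fun z hz v hv => ?_) hz hz' h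
      · exact (hφ.smooth.contDiffAt_pull (hcs z (hball hz))).differentiableAt (by simp)
      · rw [hφ.smooth.extDeriv_pull (hcs z (hball hz))]
        exact h0 z (hball hz) (k + 1) _ hφ.isTransversal_extD v hv
    have hb1 : ∀ᶠ y in 𝓝 x, e y ∈ Metric.ball (e x) ε :=
      (e.continuousAt hx).eventually_mem (Metric.ball_mem_nhds _ hε)
    have hb2 : ∀ᶠ y in 𝓝 x, a (q (e y)) ∈ Metric.ball (e x) ε := by
      have : ContinuousAt (fun y => a (q (e y))) x :=
        (hac.continuous.comp q.continuous).continuousAt.comp (e.continuousAt hx)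
      refine this.eventually_mem ?_
      rw [hax]
      exact Metric.ball_mem_nhds _ hε
    filter_upwards [hsrc, hb1, hb2] with y hy hy1 hy2
    have h3 : pull e.symm φ (e y) = pull e.symm φ (a (q (e y))) := hcst _ hy1 _ hy2 <| by
      rw [← hqW]
      simp [a, hs]
    have h4 : φ.val y = (pull e.symm φ (e y)).compContinuousLinearMap (dcomap (E := E) e y) := by
      change _ = (φ.val (e.symm (e y))).compContinuousLinearMap
        (dmap e.symm (e y) ∘L dcomap (E := E) e y)
      rw [hinv y hy, e.left_inv hy]
      rfl
    have h5 : dmap (E := E) σ (π y) = dmap e.symm (a (π y)) ∘L s := by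
      rw [dmap_comp (hds _ (hball hy2)) (ha _).differentiableAt, (ha _).fderiv]
    rw [h4, h3]
    ext v
    change pull e.symm φ (a (q (e y))) (fun i => dcomap (E := E) e y (v i)) =
      φ.val (σ (π y)) (fun i => dmap (E := E) σ (π y) (dcomap (E := E) π y (v i)))
    rw [h5, hπd y hy]
    change _ = pull e.symm φ (a (q (e y))) (fun i => s (q (dcomap (E := E) e y (v i))))
    refine apply_eq_of_sub_mem (h0 _ (hball hy2) k φ hφ.isTransversal) fun i => ?_
    rw [← hqW, map_sub, hs, sub_self]

/-- Transverse coordinates may be changed freely: the projection is followed by a local inverse of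
`f` and the section is preceded by `f`, so the two derivatives cancel in the pullback formula. -/
theorem IsTransverseChart.comp [FiniteDimensional ℝ N] {x : M} {π : M → N} {σ : N → M}
    (h : IsTransverseChart F x π σ) {f : N → N} (hf : ContDiff ℝ ∞ f) {a : N} (hfa : f a = π x)
    (hd : fderiv ℝ f a = .id ℝ N) :
    ∃ f' : N → N, f' (π x) = a ∧
      IsTransverseChart F x (fun y => f' (π y)) (fun z => σ (f z)) := by
  obtain ⟨f', h1, h2, h3, h4⟩ := exists_local_inverse hf hd
  rw [hfa] at h1 h3 h4
  have hfd : ∀ y, DifferentiableAt ℝ f y := fun y =>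
    (hf.differentiable (by simp)).differentiableAt
  have hπc : Filter.Tendsto π (𝓝 x) (𝓝 (π x)) := h.contMDiffAt_proj.self_of_nhds.continuousAt
  have hfc : Filter.Tendsto f (𝓝 a) (𝓝 (π x)) := by
    have := hf.continuous.continuousAt (x := a)
    rwa [ContinuousAt, hfa] at this
  have hcomp : ∀ᶠ z in 𝓝 (π x), fderiv ℝ f (f' z) ∘L fderiv ℝ f' z = .id ℝ N := by
    filter_upwards [eventually_eventually_nhds.2 h3, h4] with z hz hz'
    have h5 : (fun z => f (f' z)) =ᶠ[𝓝 z] id := hz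
    have h6 := (hfd (f' z)).hasFDerivAt.comp z (hz'.differentiableAt (by simp)).hasFDerivAt
    rw [← h6.fderiv]
    exact (h5.fderiv_eq).trans fderiv_id
  have hπ' : ∀ᶠ y in 𝓝 x, dcomap (E := E) (fun y => f' (π y)) y =
      fderiv ℝ f' (π y) ∘L dcomap (E := E) π y := by
    filter_upwards [h.contMDiffAt_proj, hπc.eventually h4] with y hy hy'
    exact dcomap_comp (hy.mdifferentiableAt (by simp)) (hy'.differentiableAt (by simp))
  have hinj : ∀ᶠ z in 𝓝 (π x), Function.Injective (fderiv ℝ f' z) := by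
    filter_upwards [hcomp] with z hz
    exact Function.LeftInverse.injective (g := fderiv ℝ f (f' z)) fun X => DFunLike.congr_fun hz X
  refine ⟨f', h1, ?_, ?_, ?_, ?_, ?_, ?_, ?_⟩
  · filter_upwards [h.contMDiffAt_proj, hπc.eventually h4] with y hy hy'
    exact hy'.contMDiffAt.comp y hy
  · rw [h1]
    filter_upwards [hfc.eventually h.contMDiffAt_sec] with z hz
    exact hz.comp z hf.contMDiff.contMDiffAt
  · rw [h1, hfa, h.sec_proj]
  · rw [h1]
    filter_upwards [h2, hfc.eventually h.proj_sec] with z hz hz'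
    rw [hz', hz]
  · filter_upwards [hπ', h.surjective, hπc.eventually hinj] with y hy hy' hy''
    rw [hy]
    exact (LinearMap.injective_iff_surjective.1 hy'' :
      Function.Surjective (fderiv ℝ f' (π y)).toLinearMap).comp hy'
  · filter_upwards [hπ', h.ker, hπc.eventually hinj] with y hy hy' hy'' X
    rw [hy', hy]
    exact (map_eq_zero_iff (fderiv ℝ f' (π y)) hy'').symm
  · intro k φ hφ
    filter_upwards [h.eq_copull φ hφ, hπ', hπc.eventually hcomp, hπc.eventually h3,
      hπc.eventually h.contMDiffAt_sec] with y hy hy1 hy2 hy3 hy4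
    have h5 : dmap (E := E) (fun z => σ (f z)) (f' (π y)) =
        dmap σ (π y) ∘L fderiv ℝ f (f' (π y)) := by
      have h6 : MDifferentiableAt 𝓘(ℝ, N) 𝓘(ℝ, E) σ (f (f' (π y))) := by
        rw [hy3]
        exact hy4.mdifferentiableAt (by simp)
      rw [dmap_comp h6 (hfd _), hy3]
    rw [hy]
    change (φ.val (σ (π y))).compContinuousLinearMap (dmap σ (π y) ∘L dcomap π y) =
      (φ.val (σ (f (f' (π y))))).compContinuousLinearMap
        (dmap (fun z => σ (f z)) (f' (π y)) ∘L dcomap (fun y => f' (π y)) y)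
    rw [h5, hy1, hy3, ContinuousLinearMap.comp_assoc,
      ← ContinuousLinearMap.comp_assoc (fderiv ℝ f (f' (π y))), hy2, ContinuousLinearMap.id_comp]

end TransverseCharts

/-! ### The operators of the foliation computed in a transverse chart. -/

section Reduction

variable {E : Type*} [NormedAddCommGroup E] [NormedSpace ℝ E]
  {M : Type*} [TopologicalSpace M] [ChartedSpace E M]
  {p n : ℕ} {F : Foliation E M p} {Ω : DForm E M 2}
  {N : Type*} [NormedAddCommGroup N] [NormedSpace ℝ N]
  {x : M} {π : M → N} {σ : N → M}

/-- The kernel upstairs is tangent to the leaf, which is precisely the kernel of the projection, so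
nothing degenerate survives downstairs. -/
theorem nondeg_of_comp [FiniteDimensional ℝ N] (hΩ : IsTransverselySymplectic F Ω) {y : M}
    {Ω' : N [⋀^Fin 2]→L[ℝ] ℝ} {g : E →L[ℝ] N} (hg : Function.Surjective g)
    (hk : ∀ X : E, X ∈ F.tangent y ↔ g X = 0) (h : Ω.val y = Ω'.compContinuousLinearMap g) :
    Nondeg Ω' := by
  intro X hX
  obtain ⟨X, rfl⟩ := hg X
  rw [← hk]
  change X ∈ (F.tangent y : Set (TangentSpace 𝓘(ℝ, E) y))
  rw [← hΩ.ker_eq]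
  intro Y
  change Ω.val y ![X, Y] = 0
  have h1 : Ω' ![g X, g Y] = 0 := by rw [← flat_apply, hX]; rfl
  rw [h, ← h1, ContinuousAlternatingMap.compContinuousLinearMap_apply]
  congr 1
  ext i
  fin_cases i <;> rfl

theorem exists_toOne [FiniteDimensional ℝ N] (φ : N [⋀^Fin 1]→L[ℝ] ℝ) :
    ∃ a : N →L[ℝ] ℝ, φ = toOne a := by
  refine ⟨(ContinuousAlternatingMap.ofSubsingleton ℝ N ℝ (0 : Fin 1)).symm φ, ?_⟩
  ext v
  rw [toOne, wedgeOneForms_apply, Matrix.det_fin_one, Matrix.of_apply]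
  change φ v = φ _
  congr 1
  ext i
  rw [Subsingleton.elim i 0]

theorem castDeg_wedge_toOne_comp [FiniteDimensional ℝ N] {k : ℕ} (a : N →L[ℝ] ℝ)
    (φ : N [⋀^Fin k]→L[ℝ] ℝ) (g : E →L[ℝ] N) :
    castDeg (Nat.add_comm 1 k) (wedge ((toOne a).compContinuousLinearMap g)
      (φ.compContinuousLinearMap g)) = (ext a φ).compContinuousLinearMap g := by
  rw [← compContinuousLinearMap_wedge, ← compContinuousLinearMap_castDeg, wedge_toOne]

variable {κ : DForm E M 1} {a : N →L[ℝ] ℝ}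

theorem oneWedge_val [FiniteDimensional ℝ N] (hκ : κ.val x =
    (toOne a).compContinuousLinearMap (dcomap π x)) {k : ℕ} {φ : DForm E M k}
    {α : N [⋀^Fin k]→L[ℝ] ℝ} (hφ : φ.val x = α.compContinuousLinearMap (dcomap π x)) :
    (oneWedge κ φ).val x = (ext a α).compContinuousLinearMap (dcomap (E := E) π x) := by
  rw [← castDeg_wedge_toOne_comp, ← hκ, ← hφ]
  rfl

theorem starForm_val [FiniteDimensional ℝ E] [FiniteDimensional ℝ N]
    (hn : Module.finrank ℝ N = 2 * n) {k l : ℕ} (hkl : k + l = 2 * n) {y : M} {φ : DForm E M k}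
    {Ω' : N [⋀^Fin 2]→L[ℝ] ℝ} {α : N [⋀^Fin k]→L[ℝ] ℝ} {g : E →L[ℝ] N}
    (hg : Function.Surjective g) (h : Nondeg Ω') (hΩ : Ω.val y = Ω'.compContinuousLinearMap g)
    (hφ : φ.val y = α.compContinuousLinearMap g) :
    (starForm Ω n hkl φ).val y = (star Ω' n hkl α).compContinuousLinearMap g := by
  rw [← star_comp hn h hg, ← hΩ, ← hφ]
  rfl

variable [IsManifold 𝓘(ℝ, E) ∞ M]

theorem IsTransverselySymplectic.isBasic (hΩ : IsTransverselySymplectic F Ω) : IsBasic F Ω := by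
  refine isBasic_of_isTransversal hΩ.smooth ?_ ?_
  · rintro x Y ⟨i, hi⟩
    have hi' : Y i ∈ formKer (Ω x) := by
      rw [hΩ.ker_eq]
      exact hi
    obtain ⟨A, B, rfl⟩ : ∃ A B, Y = ![A, B] := ⟨Y 0, Y 1, by ext i; fin_cases i <;> rfl⟩
    fin_cases i
    · exact hi' B
    · exact (two_form_swap (N := E) (Ω.val x) A B).trans (neg_eq_zero.2 (hi' A))
  · intro x Y _
    rw [hΩ.closed]
    rfl

theorem IsTransverseChart.contDiffAt_pull [FiniteDimensional ℝ E] [FiniteDimensional ℝ N]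
    (h : IsTransverseChart F x π σ) {k : ℕ} {φ : DForm E M k} (hφ : IsSmooth φ) :
    ∀ᶠ z in 𝓝 (π x), ContDiffAt ℝ ∞ (pull σ φ) z := by
  filter_upwards [h.contMDiffAt_sec] with z hz using hφ.contDiffAt_pull hz

theorem IsTransverseChart.nondeg [FiniteDimensional ℝ N] (h : IsTransverseChart F x π σ)
    (hΩ : IsTransverselySymplectic F Ω) : ∀ᶠ y in 𝓝 x, Nondeg (pull σ Ω (π y)) := by
  filter_upwards [h.surjective, h.ker, h.eq_copull Ω hΩ.isBasic] with y h1 h2 h3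
  exact nondeg_of_comp hΩ h1 h2 h3

/-- Forms which are locally pulled back along transverse charts are basic. -/
theorem isBasic_of_copull [FiniteDimensional ℝ E] [FiniteDimensional ℝ N] {k : ℕ}
    {φ : DForm E M k}
    (h : ∀ x, ∃ (π : M → N) (σ : N → M) (α : N → N [⋀^Fin k]→L[ℝ] ℝ),
      IsTransverseChart F x π σ ∧ ContDiffAt ℝ ∞ α (π x) ∧ φ.val =ᶠ[𝓝 x] copull π α) :
    IsBasic F φ := by
  refine isBasic_of_isTransversal (isSmooth_of_copull (P := N) fun x => ?_) (fun x Y hY => ?_)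
    fun x Y hY => ?_
  · obtain ⟨π, σ, α, h1, h2, h3⟩ := h x
    exact ⟨π, α, h1.contMDiffAt_proj.self_of_nhds, h2, h3⟩
  · obtain ⟨π, σ, α, h1, h2, h3⟩ := h x
    obtain ⟨i, hi⟩ := hY
    change φ.val x Y = 0
    rw [h3.self_of_nhds]
    exact (α (π x)).map_coord_zero i ((h1.ker.self_of_nhds _).1 hi)
  · obtain ⟨π, σ, α, h1, h2, h3⟩ := h x
    obtain ⟨i, hi⟩ := hY
    change (extD φ).val x Y = 0
    rw [extD_of_copull h1.contMDiffAt_proj.self_of_nhds (h2.differentiableAt (by simp)) h3]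
    exact (extDeriv α (π x)).map_coord_zero i ((h1.ker.self_of_nhds _).1 hi)

/-- Around every point there is a transverse chart in which the symplectic form is constant to
first order. -/
theorem exists_adapted_chart [FiniteDimensional ℝ E] [FiniteDimensional ℝ N] [T2Space M]
    (hdim : Module.finrank ℝ E = p + Module.finrank ℝ N)
    (hΩ : IsTransverselySymplectic F Ω) (x : M) :
    ∃ (π : M → N) (σ : N → M), IsTransverseChart F x π σ ∧
      HasFDerivAt (pull σ Ω) (0 : N →L[ℝ] _) (π x) := by
  obtain ⟨π, σ, h⟩ := exists_isTransverseChart (N := N) F hdim x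
  have hs := (h.contDiffAt_pull hΩ.smooth).self_of_nhds
  have hd : extDeriv (pull σ Ω) (π x) = 0 := by
    rw [hΩ.smooth.extDeriv_pull h.contMDiffAt_sec.self_of_nhds, hΩ.closed]
    rfl
  obtain ⟨f, hf, hf0, hfd, hf'⟩ := exists_adapted_map (hs.of_le (by norm_cast))
    (h.nondeg hΩ).self_of_nhds hd
  obtain ⟨f', hf1, hc⟩ := h.comp hf hf0 hfd
  refine ⟨_, _, hc, ?_⟩
  rw [hf1]
  refine hf'.congr_of_eventuallyEq ?_
  have hfc : Filter.Tendsto f (𝓝 0) (𝓝 (π x)) := by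
    have := hf.continuous.continuousAt (x := 0)
    rwa [ContinuousAt, hf0] at this
  filter_upwards [hfc.eventually h.contMDiffAt_sec] with z hz
  change (Ω.val (σ (f z))).compContinuousLinearMap (dmap (fun z => σ (f z)) z) = _
  rw [dmap_comp (hz.mdifferentiableAt (by simp))
    (hf.differentiable (by simp)).differentiableAt]
  rfl

theorem starForm_eventuallyEq [FiniteDimensional ℝ E] [FiniteDimensional ℝ N]
    (hn : Module.finrank ℝ N = 2 * n) (h : IsTransverseChart F x π σ)
    (hΩ : IsTransverselySymplectic F Ω) {k l : ℕ} (hkl : k + l = 2 * n) {φ : DForm E M k}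
    (hφ : IsBasic F φ) : (starForm Ω n hkl φ).val =ᶠ[𝓝 x]
      copull π (fun z => star (pull σ Ω z) n hkl (pull σ φ z)) := by
  filter_upwards [h.surjective, h.nondeg hΩ, h.eq_copull Ω hΩ.isBasic, h.eq_copull φ hφ]
    with y h1 h2 h3 h4
  exact starForm_val hn hkl h1 h2 h3 h4

theorem dKappa_val [FiniteDimensional ℝ E] [FiniteDimensional ℝ N] (h : IsTransverseChart F x π σ)
    (hκ : κ.val x = (toOne a).compContinuousLinearMap (dcomap π x)) {k : ℕ} {φ : DForm E M k}
    (hφ : IsBasic F φ) : (dKappa κ φ).val x =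
      (extDeriv (pull σ φ) (π x) - (1 / 2 : ℝ) • ext a (pull σ φ (π x))).compContinuousLinearMap
        (dcomap π x) := by
  have h1 := h.eq_copull φ hφ
  have h2 := extD_of_copull h.contMDiffAt_proj.self_of_nhds
    ((h.contDiffAt_pull hφ.smooth).self_of_nhds.differentiableAt (by simp)) h1
  change (extD φ).val x - (1 / 2 : ℝ) • (oneWedge κ φ).val x = _
  rw [h2, oneWedge_val hκ h1.self_of_nhds]
  rfl

/-- Orthogonal projection for a positive definite symmetric form. -/
theorem exists_orthogonal_sub [FiniteDimensional ℝ E] (g : Metric E M) (x : M)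
    (W : Submodule ℝ (TangentSpace 𝓘(ℝ, E) x)) (X : TangentSpace 𝓘(ℝ, E) x) :
    ∃ w ∈ W, ∀ Y ∈ W, g.inner x (X - w) Y = 0 := by
  have : FiniteDimensional ℝ (TangentSpace 𝓘(ℝ, E) x) := inferInstanceAs (FiniteDimensional ℝ E)
  let B : TangentSpace 𝓘(ℝ, E) x →ₗ[ℝ] Module.Dual ℝ W :=
    { toFun := fun Z => (g.inner x Z).toLinearMap ∘ₗ W.subtype
      map_add' := fun Z Z' => by rw [map_add]; rfl
      map_smul' := fun c Z => by rw [map_smul]; rfl }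
  have hinj : Function.Injective (B ∘ₗ W.subtype) := by
    rw [injective_iff_map_eq_zero]
    intro w hw
    by_contra h0
    have h1 : g.inner x (w : TangentSpace 𝓘(ℝ, E) x) w = 0 := LinearMap.congr_fun hw w
    exact (g.pos x w (fun h => h0 (Subtype.ext h))).ne' h1
  have hsurj := (LinearMap.injective_iff_surjective_of_finrank_eq_finrank
    (Subspace.dual_finrank_eq (K := ℝ) (V := W)).symm).1 hinj
  obtain ⟨w, hw⟩ := hsurj (B X)
  refine ⟨w, w.2, fun Y hY => ?_⟩
  have h1 : g.inner x (w : TangentSpace 𝓘(ℝ, E) x) Y = g.inner x X Y :=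
    LinearMap.congr_fun hw ⟨Y, hY⟩
  rw [map_sub, sub_apply, h1, sub_self]

/-- Solutions of `i(X)Ω = κ` at `x` differ by leaf vectors, which the projection kills. The metric
selects one of them, and its image downstairs is the sharp for the reduced form. -/
theorem dcomap_sharp [FiniteDimensional ℝ E] [FiniteDimensional ℝ N]
    (h : IsTransverseChart F x π σ) (hΩ : IsTransverselySymplectic F Ω) (g : Metric E M)
    (hκ : κ.val x = (toOne a).compContinuousLinearMap (dcomap π x)) :
    dcomap (E := E) π x ((sharp F g Ω κ).val x) = sharpL (pull σ Ω (π x)) a := by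
  have hnd := (h.nondeg hΩ).self_of_nhds
  have hsurj := h.surjective.self_of_nhds
  have hker := h.ker.self_of_nhds
  have h1 : ∀ X Z : E, Ω.val x ![X, Z] =
      flat (pull σ Ω (π x)) (dcomap π x X) (dcomap π x Z) := fun X Z => by
    rw [(h.eq_copull Ω hΩ.isBasic).self_of_nhds, copull, flat_apply,
      ContinuousAlternatingMap.compContinuousLinearMap_apply]
    congr 1
    ext i
    fin_cases i <;> rfl
  have h2 : ∀ Z : E, κ.val x ![Z] = a (dcomap π x Z) := fun Z => by
    rw [hκ, ContinuousAlternatingMap.compContinuousLinearMap_apply, toOne, wedgeOneForms_apply,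
      Matrix.det_fin_one]
    rfl
  -- A lift of the sharp downstairs is corrected by its orthogonal projection onto the leaf, so the
  -- existence condition in the definition of `sharp` holds.
  have hex : ∃ X : TangentSpace 𝓘(ℝ, E) x, (∀ Y ∈ F.tangent x, g.inner x X Y = 0) ∧
      ∀ Z, Ω x ![X, Z] = κ x ![Z] := by
    obtain ⟨X, hX⟩ := hsurj (sharpL (pull σ Ω (π x)) a)
    obtain ⟨w, hw, hw'⟩ : ∃ w : E, w ∈ F.tangent x ∧ ∀ Y ∈ F.tangent x,
        g.inner x (X - w : E) Y = 0 := exists_orthogonal_sub g x (F.tangent x) X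
    refine ⟨X - w, hw', fun Z => (h1 (X - w) Z).trans ?_⟩
    have h3 : dcomap (E := E) π x (X - w) = sharpL (pull σ Ω (π x)) a := by
      rw [map_sub, hX, (hker w).1 hw, sub_zero]
    rw [h3, hnd.flat_sharpL]
    exact (h2 Z).symm
  have h4 : ∀ Z : E, Ω.val x ![(sharp F g Ω κ).val x, Z] = κ.val x ![Z] := by
    have h5 : (sharp F g Ω κ).val x = hex.choose := dif_pos hex
    rw [h5]
    exact hex.choose_spec.2
  rw [← hnd.sharpL_flat (dcomap (E := E) π x ((sharp F g Ω κ).val x))]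
  congr 1
  ext Z
  obtain ⟨Z, rfl⟩ := hsurj Z
  rw [← h1, h4, h2]

/-- Near `x` the inner star of a basic form is a pullback, so it can be differentiated downstairs;
the remaining operations are pointwise and commute with the projection. -/
theorem deltaKappa_val [FiniteDimensional ℝ E] [FiniteDimensional ℝ N]
    (hn : Module.finrank ℝ N = 2 * n) (h : IsTransverseChart F x π σ)
    (hΩ : IsTransverselySymplectic F Ω) (g : Metric E M)
    (hκ : κ.val x = (toOne a).compContinuousLinearMap (dcomap π x)) {k : ℕ} (hk : k + 1 ≤ 2 * n)
    {φ : DForm E M (k + 1)} (hφ : IsBasic F φ) :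
    (deltaKappa F g Ω n κ φ : DForm E M k).val x =
      ((-1 : ℝ) ^ (k + 1) • star (pull σ Ω (π x)) n (k := 2 * n - (k + 1) + 1) (l := k) (by omega)
        (extDeriv (fun z => star (pull σ Ω z) n (l := 2 * n - (k + 1)) (by omega) (pull σ φ z))
            (π x) -
          ext a (star (pull σ Ω (π x)) n (l := 2 * n - (k + 1)) (by omega) (pull σ φ (π x)))) +
        (1 / 2 : ℝ) • interior (sharpL (pull σ Ω (π x)) a)
          (pull σ φ (π x))).compContinuousLinearMap (dcomap π x) := by
  have hkl : k + 1 + (2 * n - (k + 1)) = 2 * n := by omega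
  have hlk : 2 * n - (k + 1) + 1 + k = 2 * n := by omega
  have h1 := starForm_eventuallyEq hn h hΩ hkl hφ
  have hnd := (h.nondeg hΩ).self_of_nhds
  have hsurj := h.surjective.self_of_nhds
  have h2 : DifferentiableAt ℝ (fun z => star (pull σ Ω z) n hkl (pull σ φ z)) (π x) :=
    (contDiffAt_star hn hkl (h.contDiffAt_pull hΩ.smooth).self_of_nhds
      (h.contDiffAt_pull hφ.smooth).self_of_nhds hnd).differentiableAt (by simp)
  have h3 := extD_of_copull h.contMDiffAt_proj.self_of_nhds h2 h1
  have h4 : (extD (starForm Ω n hkl φ) - oneWedge κ (starForm Ω n hkl φ)).val x =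
      (extDeriv (fun z => star (pull σ Ω z) n hkl (pull σ φ z)) (π x) -
        ext a (star (pull σ Ω (π x)) n hkl (pull σ φ (π x)))).compContinuousLinearMap
          (dcomap π x) := by
    change (extD (starForm Ω n hkl φ)).val x - (oneWedge κ (starForm Ω n hkl φ)).val x = _
    rw [h3, oneWedge_val hκ h1.self_of_nhds]
    rfl
  have h5 := starForm_val hn hlk hsurj hnd (h.eq_copull Ω hΩ.isBasic).self_of_nhds h4
  have h6 : (contract (sharp F g Ω κ) φ).val x =
      (interior (sharpL (pull σ Ω (π x)) a) (pull σ φ (π x))).compContinuousLinearMap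
        (dcomap π x) := by
    rw [← dcomap_sharp h hΩ g hκ, ← compContinuousLinearMap_interior]
    change interior ((sharp F g Ω κ).val x) (φ.val x) = _
    rw [(h.eq_copull φ hφ).self_of_nhds]
    rfl
  have h7 : deltaB Ω n κ φ = (-1 : ℝ) ^ (k + 1) • starForm Ω n hlk
      (extD (starForm Ω n hkl φ) - oneWedge κ (starForm Ω n hkl φ)) := dif_pos hk
  change (deltaB Ω n κ φ).val x + (1 / 2 : ℝ) • (contract (sharp F g Ω κ) φ).val x = _
  rw [h7, h6]
  change (-1 : ℝ) ^ (k + 1) • (starForm Ω n hlk (extD (starForm Ω n hkl φ) -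
    oneWedge κ (starForm Ω n hkl φ))).val x + _ = _
  rw [h5]
  rfl

end Reduction

/-! ### Harmonic forms as solutions of the symbol equations. -/

section Harmonic

variable {E : Type*} [NormedAddCommGroup E] [NormedSpace ℝ E]
  {M : Type*} [TopologicalSpace M] [ChartedSpace E M]
  {p n : ℕ} {F : Foliation E M p} {Ω : DForm E M 2}
  {N : Type*} [NormedAddCommGroup N] [NormedSpace ℝ N]
  {x : M} {π : M → N} {σ : N → M} {κ : DForm E M 1} {a : N →L[ℝ] ℝ}

theorem comp_eq_zero_iff {g : E →L[ℝ] N} (hg : Function.Surjective g) {k : ℕ}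
    {φ : N [⋀^Fin k]→L[ℝ] ℝ} : φ.compContinuousLinearMap g = 0 ↔ φ = 0 := by
  constructor
  · intro h
    exact comp_injective hg h
  · rintro rfl
    rfl

theorem single_eq_zero_iff {k : ℕ} {φ : N [⋀^Fin k]→L[ℝ] ℝ} :
    Forms.single k φ = 0 ↔ φ = 0 := by
  constructor
  · intro h
    rw [← Forms.single_deg k φ, h, Forms.deg_zero]
  · rintro rfl
    exact map_zero _

/-- `L^r` as a linear map on forms on the manifold. -/
def lefForm (Ω : DForm E M 2) {k l : ℕ} (r : ℕ) (h : k + 2 * r = l) :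
    DForm E M k →ₗ[ℝ] DForm E M l where
  toFun φ := fun y => lefPowLin (Ω.val y) r h (φ.val y)
  map_add' φ ψ := funext fun y => map_add (lefPowLin (Ω.val y) r h) (φ.val y) (ψ.val y)
  map_smul' c φ := funext fun y => map_smul (lefPowLin (Ω.val y) r h) c (φ.val y)

theorem lefForm_val {k l r : ℕ} (h : k + 2 * r = l) (φ : DForm E M k) (y : M) :
    (lefForm Ω r h φ).val y = lefPowLin (Ω.val y) r h (φ.val y) := rfl

theorem lefPowLin_comp {k l r : ℕ} (h : k + 2 * r = l) (Ω' : N [⋀^Fin 2]→L[ℝ] ℝ)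
    (φ : N [⋀^Fin k]→L[ℝ] ℝ) (g : E →L[ℝ] N) :
    lefPowLin (Ω'.compContinuousLinearMap g) r h (φ.compContinuousLinearMap g) =
      (lefPowLin Ω' r h φ).compContinuousLinearMap g := by
  change castDeg h (lefPow _ _ r) = (castDeg h (lefPow _ _ r)).compContinuousLinearMap g
  rw [compContinuousLinearMap_castDeg, compContinuousLinearMap_lefPow]

theorem pull_lefForm {k l r : ℕ} (h : k + 2 * r = l) (φ : DForm E M k) :
    pull σ (lefForm Ω r h φ) = fun z => lefPowLin (pull σ Ω z) r h (pull σ φ z) := by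
  funext z
  change (castDeg h (lefPow _ _ r)).compContinuousLinearMap _ = castDeg h (lefPow _ _ r)
  rw [compContinuousLinearMap_castDeg, compContinuousLinearMap_lefPow]
  rfl

theorem twistedDeriv_lin {k : ℕ} (c b : ℝ) (a : N →L[ℝ] ℝ) {φ ψ : N → N [⋀^Fin k]→L[ℝ] ℝ} {z : N}
    (hφ : DifferentiableAt ℝ φ z) (hψ : DifferentiableAt ℝ ψ z) :
    twistedDeriv c a (fun y => φ y + b • ψ y) z = twistedDeriv c a φ z + b • twistedDeriv c a ψ z := by
  refine LinearMap.ext fun X => ?_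
  have h : fderiv ℝ (fun y => φ y + b • ψ y) z = fderiv ℝ φ z + b • fderiv ℝ ψ z :=
    (hφ.hasFDerivAt.add (hψ.hasFDerivAt.const_smul b)).fderiv
  rw [LinearMap.add_apply, LinearMap.smul_apply, twistedDeriv_apply, twistedDeriv_apply,
    twistedDeriv_apply, h, ← map_smul, ← map_add]
  congr 1
  simp only [add_apply, smul_apply]
  module

theorem pull_lin {k : ℕ} (φ ψ : DForm E M k) (c : ℝ) :
    pull σ (φ + c • ψ) = fun z => pull σ φ z + c • pull σ ψ z := by
  funext z
  rfl

variable [IsManifold 𝓘(ℝ, E) ∞ M]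

theorem mem_modHarmonic_iff {g : Metric E M} {k : ℕ} {φ : DForm E M k} :
    φ ∈ modHarmonic F g Ω n k ↔ IsBasic F φ ∧ ∀ x, (dKappa (meanCurvature F g) φ).val x = 0 ∧
      (deltaKappa F g Ω n (meanCurvature F g) φ).val x = 0 := by
  constructor
  · rintro ⟨h1, h2, h3⟩
    exact ⟨h1, fun x => ⟨congrFun h2 x, congrFun h3 x⟩⟩
  · rintro ⟨h1, h2⟩
    exact ⟨h1, funext fun x => (h2 x).1, funext fun x => (h2 x).2⟩

variable [FiniteDimensional ℝ E] [FiniteDimensional ℝ N]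

/-- The equations of the harmonic forms in a transverse chart. -/
theorem harmonic_iff (hn : Module.finrank ℝ N = 2 * n) (h : IsTransverseChart F x π σ)
    (hp : HasFDerivAt (pull σ Ω) (0 : N →L[ℝ] _) (π x))
    (hΩ : IsTransverselySymplectic F Ω) (g : Metric E M)
    (hκ : κ.val x = (toOne a).compContinuousLinearMap (dcomap π x)) {k : ℕ} (hk : k ≤ 2 * n)
    {φ : DForm E M k} (hφ : IsBasic F φ) :
    ((dKappa κ φ).val x = 0 ∧ (deltaKappa F g Ω n κ φ).val x = 0) ↔
      (altSymbol (twistedDeriv (1 / 2) a (pull σ φ) (π x)) = 0 ∧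
        coSymbol (pull σ Ω (π x)) (twistedDeriv (1 / 2) a (pull σ φ) (π x)) = 0) := by
  have hsurj := h.surjective.self_of_nhds
  rw [altSymbol_twistedDeriv, single_eq_zero_iff, dKappa_val h hκ hφ, comp_eq_zero_iff hsurj]
  refine and_congr_right fun _ => ?_
  rcases k with _ | k
  -- On functions both codifferentials vanish by convention.
  · rw [coSymbol_twistedDeriv_zero]
    exact ⟨fun _ => rfl, fun _ => rfl⟩
  · have h1 := deltaKappa_val hn h hΩ g hκ hk hφ
    rw [coSymbol_twistedDeriv hn (l := 2 * n - (k + 1)) (by omega) (by omega) a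
      (h.nondeg hΩ).self_of_nhds hp
      ((h.contDiffAt_pull hφ.smooth).self_of_nhds.differentiableAt (by simp)),
      single_eq_zero_iff, ← comp_eq_zero_iff hsurj, ← h1]

/-- In a transverse chart `L^r` acts on the reduced forms and depends smoothly on them, so its
result is again locally a smooth pullback. -/
theorem IsBasic.lefForm (hΩ : IsTransverselySymplectic F Ω)
    (hchart : ∀ x, ∃ (π : M → N) (σ : N → M), IsTransverseChart F x π σ) {k l r : ℕ}
    (h : k + 2 * r = l) {φ : DForm E M k} (hφ : IsBasic F φ) :
    IsBasic F (TransSymp.lefForm Ω r h φ) := by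
  refine isBasic_of_copull (N := N) fun x => ?_
  obtain ⟨π, σ, hc⟩ := hchart x
  refine ⟨π, σ, fun z => lefPowLin (pull σ Ω z) r h (pull σ φ z), hc, contDiffAt_lefPowLin h
    (hc.contDiffAt_pull hΩ.smooth).self_of_nhds (hc.contDiffAt_pull hφ.smooth).self_of_nhds, ?_⟩
  filter_upwards [hc.eq_copull Ω hΩ.isBasic, hc.eq_copull φ hφ] with y h1 h2
  rw [lefForm_val, h1, h2]
  exact lefPowLin_comp h _ _ _

theorem IsBasic.lin (hchart : ∀ x, ∃ (π : M → N) (σ : N → M), IsTransverseChart F x π σ) {k : ℕ}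
    {φ ψ : DForm E M k} (hφ : IsBasic F φ) (hψ : IsBasic F ψ) (c : ℝ) :
    IsBasic F (φ + c • ψ) := by
  refine isBasic_of_copull (N := N) fun x => ?_
  obtain ⟨π, σ, hc⟩ := hchart x
  refine ⟨π, σ, fun z => pull σ φ z + c • pull σ ψ z, hc,
    (hc.contDiffAt_pull hφ.smooth).self_of_nhds.add
      ((hc.contDiffAt_pull hψ.smooth).self_of_nhds.const_smul c), ?_⟩
  filter_upwards [hc.eq_copull φ hφ, hc.eq_copull ψ hψ] with y h1 h2
  change φ.val y + c • ψ.val y = _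
  rw [h1, h2]
  rfl

theorem altSymbol_lin (S T : N →ₗ[ℝ] Forms N) (b : ℝ) :
    altSymbol (S + b • T) = altSymbol S + b • altSymbol T := by
  simp only [altSymbol, LinearMap.add_apply, LinearMap.smul_apply, map_add, map_smul,
    Finset.sum_add_distrib, Finset.smul_sum]

theorem coSymbol_lin (Ω : N [⋀^Fin 2]→L[ℝ] ℝ) (S T : N →ₗ[ℝ] Forms N) (b : ℝ) :
    coSymbol Ω (S + b • T) = coSymbol Ω S + b • coSymbol Ω T := by
  simp only [coSymbol, LinearMap.add_apply, LinearMap.smul_apply, map_add, map_smul,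
    Finset.sum_add_distrib, Finset.smul_sum]

end Harmonic

/-! ### The global isomorphism. -/

section Main

variable {E : Type*} [NormedAddCommGroup E] [NormedSpace ℝ E] [FiniteDimensional ℝ E]
  {M : Type*} [TopologicalSpace M] [T2Space M] [ChartedSpace E M] [IsManifold 𝓘(ℝ, E) ∞ M]
  {p n : ℕ} {F : Foliation E M p} {Ω : DForm E M 2} {g : Metric E M}

/-- At each point, the equations of the harmonic forms are the symbol equations in an adapted
transverse chart. -/
theorem exists_harmonic_chart (hdim : Module.finrank ℝ E = p + 2 * n)
    (hΩ : IsTransverselySymplectic F Ω) (hiso : IsIsoparametric F g) (x : M) :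
    ∃ (π : M → (Fin (2 * n) → ℝ)) (σ : (Fin (2 * n) → ℝ) → M) (a : (Fin (2 * n) → ℝ) →L[ℝ] ℝ),
      IsTransverseChart F x π σ ∧
      HasFDerivAt (pull σ Ω) (0 : (Fin (2 * n) → ℝ) →L[ℝ] _) (π x) ∧
      ∀ (k : ℕ) (_ : k ≤ 2 * n) (φ : DForm E M k), IsBasic F φ →
        (((dKappa (meanCurvature F g) φ).val x = 0 ∧
          (deltaKappa F g Ω n (meanCurvature F g) φ).val x = 0) ↔
        (altSymbol (twistedDeriv (1 / 2) a (pull σ φ) (π x)) = 0 ∧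
          coSymbol (pull σ Ω (π x)) (twistedDeriv (1 / 2) a (pull σ φ) (π x)) = 0)) := by
  have hn : Module.finrank ℝ (Fin (2 * n) → ℝ) = 2 * n := by simp
  obtain ⟨π, σ, h, hp⟩ := exists_adapted_chart (N := Fin (2 * n) → ℝ) (by rw [hn, hdim]) hΩ x
  obtain ⟨a, ha⟩ := exists_toOne (pull σ (meanCurvature F g) (π x))
  refine ⟨π, σ, a, h, hp, fun k hk φ hφ => harmonic_iff hn h hp hΩ g ?_ hk hφ⟩
  rw [(h.eq_copull _ hiso).self_of_nhds, copull, ha]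

/-- The harmonic forms are a linear subspace. -/
theorem exists_harmonic_submodule (hdim : Module.finrank ℝ E = p + 2 * n)
    (hΩ : IsTransverselySymplectic F Ω) (hiso : IsIsoparametric F g) {k : ℕ} (hk : k ≤ 2 * n) :
    ∃ A : Submodule ℝ (DForm E M k), (A : Set (DForm E M k)) = modHarmonic F g Ω n k := by
  have hchart : ∀ x, ∃ (π : M → (Fin (2 * n) → ℝ)) (σ : (Fin (2 * n) → ℝ) → M),
      IsTransverseChart F x π σ := fun x => by
    obtain ⟨π, σ, a, h, -⟩ := exists_harmonic_chart hdim hΩ hiso x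
    exact ⟨π, σ, h⟩
  have hlin : ∀ (φ ψ : DForm E M k) (c : ℝ), φ ∈ modHarmonic F g Ω n k →
      ψ ∈ modHarmonic F g Ω n k → φ + c • ψ ∈ modHarmonic F g Ω n k := by
    intro φ ψ c hφ hψ
    rw [mem_modHarmonic_iff] at hφ hψ ⊢
    have hb := hφ.1.lin hchart hψ.1 c
    refine ⟨hb, fun x => ?_⟩
    obtain ⟨π, σ, a, h, hp, hi⟩ := exists_harmonic_chart hdim hΩ hiso x
    have h1 := (hi k hk φ hφ.1).1 (hφ.2 x)
    have h2 := (hi k hk ψ hψ.1).1 (hψ.2 x)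
    have h3 : twistedDeriv (1 / 2) a (pull σ (φ + c • ψ)) (π x) =
        twistedDeriv (1 / 2) a (pull σ φ) (π x) + c • twistedDeriv (1 / 2) a (pull σ ψ) (π x) := by
      rw [pull_lin]
      exact twistedDeriv_lin (1 / 2) c a
        ((h.contDiffAt_pull hφ.1.smooth).self_of_nhds.differentiableAt (by simp))
        ((h.contDiffAt_pull hψ.1.smooth).self_of_nhds.differentiableAt (by simp))
    refine (hi k hk _ hb).2 ?_
    rw [h3]
    constructor
    · rw [altSymbol_lin, h1.1, h2.1, smul_zero, add_zero]
    · rw [coSymbol_lin, h1.2, h2.2, smul_zero, add_zero]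
  have hzero : (0 : DForm E M k) ∈ modHarmonic F g Ω n k := by
    rw [mem_modHarmonic_iff]
    have hb : IsBasic F (0 : DForm E M k) := by
      refine isBasic_of_copull (N := Fin (2 * n) → ℝ) fun x => ?_
      obtain ⟨π, σ, h⟩ := hchart x
      exact ⟨π, σ, fun _ => 0, h, contDiffAt_const, Filter.Eventually.of_forall fun y => rfl⟩
    refine ⟨hb, fun x => ?_⟩
    obtain ⟨π, σ, a, h, hp, hi⟩ := exists_harmonic_chart hdim hΩ hiso x
    have h3 : twistedDeriv (1 / 2) a (pull σ (0 : DForm E M k)) (π x) = 0 := by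
      have h4 : pull σ (0 : DForm E M k) = fun _ => 0 := rfl
      refine LinearMap.ext fun X => ?_
      rw [twistedDeriv_apply, h4]
      simp
    refine (hi k hk _ hb).2 ?_
    rw [h3]
    constructor
    · exact Finset.sum_eq_zero fun t _ => map_zero _
    · exact Finset.sum_eq_zero fun t _ => map_zero _
  refine ⟨{ carrier := modHarmonic F g Ω n k
            add_mem' := fun {φ ψ} hφ hψ => ?_
            zero_mem' := hzero
            smul_mem' := fun c φ hφ => ?_ }, rfl⟩
  · have := hlin φ ψ 1 hφ hψ
    rwa [one_smul] at this
  · have := hlin 0 φ c hzero hφ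
    rwa [zero_add] at this

/-- At each point an adapted chart makes `Ω` parallel, so the symbol of `L^r φ` is `L^r` of the
symbol of `φ`, and `symbols_Lf_pow_iff` gives both directions at once. -/
theorem lefForm_mem_iff (hdim : Module.finrank ℝ E = p + 2 * n)
    (hΩ : IsTransverselySymplectic F Ω) (hiso : IsIsoparametric F g) {k l r : ℕ}
    (h : k + 2 * r = l) (hk : k + r = n) {φ : DForm E M k} (hφ : IsBasic F φ) :
    lefForm Ω r h φ ∈ modHarmonic F g Ω n l ↔ φ ∈ modHarmonic F g Ω n k := by
  have hchart : ∀ x, ∃ (π : M → (Fin (2 * n) → ℝ)) (σ : (Fin (2 * n) → ℝ) → M),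
      IsTransverseChart F x π σ := fun x => by
    obtain ⟨π, σ, a, h, -⟩ := exists_harmonic_chart hdim hΩ hiso x
    exact ⟨π, σ, h⟩
  have hn : Module.finrank ℝ (Fin (2 * n) → ℝ) = 2 * n := by simp
  have hb := hφ.lefForm hΩ hchart h
  rw [mem_modHarmonic_iff, mem_modHarmonic_iff]
  refine and_congr (iff_of_true hb hφ) (forall_congr' fun x => ?_)
  obtain ⟨π, σ, a, hc, hp, hi⟩ := exists_harmonic_chart hdim hΩ hiso x
  rw [hi l (by omega) _ hb, hi k (by omega) _ hφ, pull_lefForm, twistedDeriv_lefPowLin h _ _ hp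
    ((hc.contDiffAt_pull hφ.smooth).self_of_nhds.differentiableAt (by simp))]
  exact symbols_Lf_pow_iff hn (hc.nondeg hΩ).self_of_nhds hk fun X => isHom_single _

/-- Injectivity of `L^r` at a point, on transversal forms. -/
theorem lefPowLin_val_injective (hdim : Module.finrank ℝ E = p + 2 * n)
    (hΩ : IsTransverselySymplectic F Ω) {k l r : ℕ} (h : k + 2 * r = l) (hk : k + r = n) {y : M}
    {φ ψ : E [⋀^Fin k]→L[ℝ] ℝ} (hφ : ∀ X : Fin k → E, (∃ i, X i ∈ F.tangent y) → φ X = 0)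
    (hψ : ∀ X : Fin k → E, (∃ i, X i ∈ F.tangent y) → ψ X = 0)
    (heq : lefPowLin (Ω.val y) r h φ = lefPowLin (Ω.val y) r h ψ) : φ = ψ := by
  have hn : Module.finrank ℝ (Fin (2 * n) → ℝ) = 2 * n := by simp
  obtain ⟨π, σ, hc⟩ := exists_isTransverseChart (N := Fin (2 * n) → ℝ) F (by rw [hn, hdim]) y
  have hs := hc.surjective.self_of_nhds
  have hker := hc.ker.self_of_nhds
  obtain ⟨φ', rfl⟩ := exists_eq_comp hs fun X ⟨i, hi⟩ => hφ X ⟨i, (hker _).2 hi⟩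
  obtain ⟨ψ', rfl⟩ := exists_eq_comp hs fun X ⟨i, hi⟩ => hψ X ⟨i, (hker _).2 hi⟩
  rw [(hc.eq_copull Ω hΩ.isBasic).self_of_nhds, copull, lefPowLin_comp, lefPowLin_comp] at heq
  rw [lefPowLin_injective hn (hc.nondeg hΩ).self_of_nhds h hk.le (comp_injective hs heq)]

/-- `L^r` is onto the basic forms of complementary degree. -/
theorem exists_lefForm_eq (hdim : Module.finrank ℝ E = p + 2 * n)
    (hΩ : IsTransverselySymplectic F Ω) {k l r : ℕ} (h : k + 2 * r = l) (hk : k + r = n)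
    {ψ : DForm E M l} (hψ : IsBasic F ψ) :
    ∃ φ : DForm E M k, IsBasic F φ ∧ lefForm Ω r h φ = ψ := by
  have hn : Module.finrank ℝ (Fin (2 * n) → ℝ) = 2 * n := by simp
  have hchart := exists_isTransverseChart (N := Fin (2 * n) → ℝ) F (by rw [hn, hdim])
  have hloc : ∀ {x : M} {π : M → (Fin (2 * n) → ℝ)} {σ : (Fin (2 * n) → ℝ) → M},
      IsTransverseChart F x π σ → ∀ᶠ y in 𝓝 x,
        (∀ X : Fin k → E, (∃ i, X i ∈ F.tangent y) →
          copull π (fun z => lefInv (pull σ Ω z) r h (pull σ ψ z)) y X = 0) ∧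
        lefPowLin (Ω.val y) r h (copull π (fun z => lefInv (pull σ Ω z) r h (pull σ ψ z)) y) =
          ψ.val y := by
    intro x π σ hc
    filter_upwards [hc.ker, hc.eq_copull Ω hΩ.isBasic, hc.eq_copull ψ hψ, hc.nondeg hΩ]
      with y h1 h2 h3 h4
    refine ⟨fun X ⟨i, hi⟩ => ?_, ?_⟩
    · exact (lefInv (pull σ Ω (π y)) r h (pull σ ψ (π y))).map_coord_zero i ((h1 _).1 hi)
    · rw [h2, h3, copull, copull, lefPowLin_comp, lefPowLin_lefInv hn h4 h hk]
      rfl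
  have hex : ∀ y, ∃ η : E [⋀^Fin k]→L[ℝ] ℝ,
      (∀ X : Fin k → E, (∃ i, X i ∈ F.tangent y) → η X = 0) ∧
        lefPowLin (Ω.val y) r h η = ψ.val y := fun y => by
    obtain ⟨π, σ, hc⟩ := hchart y
    exact ⟨_, (hloc hc).self_of_nhds⟩
  -- The preimage is chosen point by point. Smoothness is recovered afterwards: injectivity forces
  -- the choice to agree with the smooth local preimage given by `lefInv` in a chart.
  choose φ hφ hφψ using hex
  refine ⟨φ, ?_, funext hφψ⟩
  refine isBasic_of_copull (N := Fin (2 * n) → ℝ) fun x => ?_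
  obtain ⟨π, σ, hc⟩ := hchart x
  refine ⟨π, σ, fun z => lefInv (pull σ Ω z) r h (pull σ ψ z), hc,
    contDiffAt_lefInv hn h hk (hc.contDiffAt_pull hΩ.smooth).self_of_nhds
      (hc.contDiffAt_pull hψ.smooth).self_of_nhds (hc.nondeg hΩ).self_of_nhds, ?_⟩
  filter_upwards [hloc hc] with y hy
  exact lefPowLin_val_injective hdim hΩ h hk (hφ y) hy.1 ((hφψ y).trans hy.2.symm)

end Main

end TransSymp

end

theorem proposition4p12 {E : Type*} [NormedAddCommGroup E] [NormedSpace ℝ E]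
    [FiniteDimensional ℝ E] {M : Type*} [TopologicalSpace M] [T2Space M] [ChartedSpace E M]
    [IsManifold 𝓘(ℝ, E) ∞ M] (p n : ℕ) (hdim : Module.finrank ℝ E = p + 2 * n)
    (F : TransSymp.Foliation E M p) (Ω : TransSymp.DForm E M 2)
    (hΩ : TransSymp.IsTransverselySymplectic F Ω) (g : TransSymp.Metric E M)
    (hiso : TransSymp.IsIsoparametric F g) (r : ℕ) (hr : r ≤ n) :
    ∃ (A : Submodule ℝ (TransSymp.DForm E M (n - r)))
      (B : Submodule ℝ (TransSymp.DForm E M (n + r))),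
      (A : Set (TransSymp.DForm E M (n - r))) = TransSymp.modHarmonic F g Ω n (n - r) ∧
      (B : Set (TransSymp.DForm E M (n + r))) = TransSymp.modHarmonic F g Ω n (n + r) ∧
      ∃ f : A ≃ₗ[ℝ] B, ∀ φ : A,
        (f φ : TransSymp.DForm E M (n + r)) = TransSymp.lefschetz Ω n r hr φ := by
  have h : n - r + 2 * r = n + r := by omega
  have hk : n - r + r = n := by omega
  obtain ⟨A, hA⟩ := TransSymp.exists_harmonic_submodule hdim hΩ hiso
    (show n - r ≤ 2 * n by omega)
  obtain ⟨B, hB⟩ := TransSymp.exists_harmonic_submodule hdim hΩ hiso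
    (show n + r ≤ 2 * n by omega)
  have hA' : ∀ φ, φ ∈ A ↔ φ ∈ TransSymp.modHarmonic F g Ω n (n - r) := fun φ =>
    Set.ext_iff.1 hA φ
  have hB' : ∀ φ, φ ∈ B ↔ φ ∈ TransSymp.modHarmonic F g Ω n (n + r) := fun φ =>
    Set.ext_iff.1 hB φ
  let f₀ : A →ₗ[ℝ] B := (TransSymp.lefForm Ω r h).restrict fun φ hφ =>
    (hB' _).2 ((TransSymp.lefForm_mem_iff hdim hΩ hiso h hk ((hA' φ).1 hφ).1).2 ((hA' φ).1 hφ))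
  have hf₀ : Function.Bijective f₀ := by
    constructor
    · intro φ ψ hφψ
      have h1 : TransSymp.lefForm Ω r h φ.1 = TransSymp.lefForm Ω r h ψ.1 :=
        congrArg Subtype.val hφψ
      refine Subtype.ext (funext fun y => ?_)
      exact TransSymp.lefPowLin_val_injective hdim hΩ h hk
        (fun X hX => ((hA' _).1 φ.2).1.isTransversal y X hX)
        (fun X hX => ((hA' _).1 ψ.2).1.isTransversal y X hX) (congrFun h1 y)
    · rintro ⟨ψ, hψ⟩
      -- A basic preimage of a harmonic form exists by `exists_lefForm_eq`; it is itself harmonic by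
      -- the converse direction of `lefForm_mem_iff`.
      obtain ⟨φ, hφ, rfl⟩ := TransSymp.exists_lefForm_eq hdim hΩ h hk ((hB' ψ).1 hψ).1
      exact ⟨⟨φ, (hA' φ).2 ((TransSymp.lefForm_mem_iff hdim hΩ hiso h hk hφ).1 ((hB' _).1 hψ))⟩,
        rfl⟩
  exact ⟨A, B, hA, hB, LinearEquiv.ofBijective f₀ hf₀, fun φ => rfl⟩
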